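/- **Conventions.** Let $k$ be a field. Graded vector spaces are $\mathbb{Z}$-graded over $k$, gradings are cohomological, and the Koszul sign rule is applied when tensor products of maps are evaluated on elements. Algebras are not assumed to be unital. * An *$\mathcal A_\infty$-algebra* is a graded vector space $A$ with maps $m_n\colon A^{\otimes n}\to A$ of degree $2-n$ ($n\ge 1$) such that, for all $n\geq 1$, $\sum_{p+q+r=n}(-1)^{p+qr}\,m_{p+1+r}\circ(\mathrm{id}^{\otimes p}\otimes m_q\otimes \mathrm{id}^{\otimes r})=0$. A dg-algebra is an $\mathcal A_\infty$-algebra with $m_1=d$, $m_2$ its product and $m_n=0$ for $n\ge 3$. * An *$\infty$-morphism* $f\colon A\rightsquigarrow B$ is a family of maps $f_n\colon A^{\otimes n}\to B$ of degree $1-n$ ($n\ge1$) such that, for all $n\ge 1$, $$\sum_{p+q+r=n}(-1)^{p+qr}f_{p+1+r}\circ(\mathrm{id}^{\otimes p}\otimes m_q^A\otimes\mathrm{id}^{\otimes r})=\sum_{i_1+\cdots+i_j=n}(-1)^{\sum_{l}(j-l)(i_l-1)}\,m^B_j\circ(f_{i_1}\otimes\cdots\otimes f_{i_j}).$$ With composition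 $(g\circ f)_n=\sum_{i_1+\cdots+i_j=n}(-1)^{\sum_{l}(j-l)(i_l-1)}\,g_j\circ(f_{i_1}\otimes\cdots\otimes f_{i_j})$ these form a category $\infty\text{-}\mathsf{Alg}_{\mathcal A_\infty}$. An $\infty$-morphism $f$ is an *$\infty$-quasi-isomorphism* if $f_1\colon (A,m_1)\to (B,m_1)$ is a quasi-isomorphism, and $\mathsf{ho}(\infty\text{-}\mathsf{Alg}_{\mathcal A_\infty})$ is the localization at the $\infty$-quasi-isomorphisms; $[f]$ denotes the class of $f$ there. The *forgetful functor* $\mathsf{ho}(\infty\text{-}\mathsf{Alg}_{\mathcal A_\infty})\to\mathsf{gr}\text{-}\mathsf{Vect}$ is the one induced by $A\mapsto H^*(A,m_1)$ (so it sends an $\mathcal A_\infty$-algebra with $m_1=0$ to its underlying graded vector space). * A *transfer datum* $D=(A,H,i,p,h)$ is a dg-algebra $A$, a graded vector space $H$, maps of cochain complexes $i\colon(H,0)\to A$ and $p\colon A\to(H,0)$ of degree $0$, and $h\colon A\to A$ of degree $-1$, with $ip-\mathrm{id}_A=dh+hd$, $pi=\mathrm{id}_H$, $hi=0$, $ph=0$,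 $h^2=0$ (we call $(H,i,p,h)$ a *contraction* of $A$). A morphism of transfer data $D\to D'$ is a morphism of dg-algebras $A\to A'$, with no compatibility with the contractions. * A *copersistent object* of a category $\mathsf C$ is a functor $(\mathbb R,\le)^{\mathrm{op}}\to\mathsf C$. *Copersistent transfer data with finitely many changes* are those copersistent transfer data $D^\bullet$ for which the set $\mathbb{R}$ has finitely many classes for the equivalence relation generated by $r\sim s$ whenever $r\le s$ and the structure morphism $D^s\to D^r$ is an isomorphism; they form the full subcategory $\mathsf{fTrans}^{\mathbb R^{\mathrm{op}}}$. The *persistent cohomology* of $D^\bullet$ is $r\mapsto H^*(A^r)$. * *Finite filtered data* form the full subcategory $\mathsf{fData}$ of the functors $X\colon(\mathbb R,\leq)\to\Delta\mathsf{Cpx}$ to $\Delta$-complexes (semi-simplicial sets) such that every $X_r$ is finite; every $X_a\to X_b$ is injective; $\mathbb R$ has finitely many classes for the equivalence relation generated by $a\sim b$ whenever $a\le b$ and $X_a\to X_b$ is an isomorphism; and there are total orders $\le_a$ on the sets of simplices of the $X_a$ such that $\alpha\le_a\beta$ if $\alpha$ is a face of $\beta$, and such that, for $a<b$, $\alpha\le_b\beta$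 if $\alpha$ lies in the image of $X_a$ and $\beta\in X_b$ does not. Given, for every finite filtered datum $X$ and every $r$, a choice $c$ of a contraction of the dg-algebra $C^*(X_r)$ of simplicial cochains with coefficients in $k$ (with the cup product), one gets a functor $\mathrm{TC}^*_c\colon\mathsf{fData}^{\mathrm{op}}\to\mathsf{fTrans}^{\mathbb R^{\mathrm{op}}}$. * Two copersistent objects $F,G$ of $\mathsf C$ are *$\varepsilon$-interleaved* ($\varepsilon\geq 0$) if there are natural families $\mu^r\colon F^r\to G^{r-\varepsilon}$, $\nu^r\colon G^r\to F^{r-\varepsilon}$ such that $\nu^{r-\varepsilon}\mu^r$ and $\mu^{r-\varepsilon}\nu^r$ are the structure morphisms $F^r\to F^{r-2\varepsilon}$ and $G^r\to G^{r-2\varepsilon}$ for all $r$; $d_{\mathsf C}(F,G)\in[0,\infty]$ is the infimum of all such $\varepsilon$ ($\infty$ if there are none). **Theorem.** Every dg-algebra over $k$ has a contraction. Moreover, there are * for every transfer datum $D=(A,H,i,p,h)$, an $\mathcal A_\infty$-structure $\{m^D_n\}$ on $H$ and $\infty$-morphisms $i^D_\infty\colon H\rightsquigarrow A$ and $p^D_\infty\colon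 A\rightsquigarrow H$, and * a functor $\mathrm H_*\colon \mathsf{fTrans}^{\mathbb R^{\mathrm{op}}}\to \mathsf{ho}(\infty\text{-}\mathsf{Alg}_{\mathcal A_\infty})^{\mathbb R^{\mathrm{op}}}$, such that the following holds. 1. $(H,\{m^D_n\})$ is the homotopy-transferred $\mathcal A_\infty$-structure: $m^D_1=0$, $(i^D_\infty)_1=i$ and, for $n\ge2$, $m^D_n=p\circ\lambda_n$ and $(i^D_\infty)_n=h\circ\lambda_n$, where $\lambda_n=\sum_{s+t=n,\ s,t\ge1}(-1)^{s+1}\mu_A\circ((i^D_\infty)_s\otimes(i^D_\infty)_t)$ and $\mu_A$ is the product of $A$. Moreover $(p^D_\infty)_1=p$, both $i^D_\infty$ and $p^D_\infty$ are $\infty$-quasi-isomorphisms, and $[i^D_\infty]$ and $[p^D_\infty]$ are inverse to each other in $\mathsf{ho}(\infty\text{-}\mathsf{Alg}_{\mathcal A_\infty})$. 2. For $D^\bullet=(A,H,i,p,h)^\bullet$ in $\mathsf{fTrans}^{\mathbb R^{\mathrm{op}}}$ one has $\mathrm H_*(D^\bullet)^r=(H^r,\{m_n^{D^r}\})$, and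 for $s\le r$ with structure morphism $\eta\colon A^r\to A^s$ the structure morphism of $\mathrm H_*(D^\bullet)$ is $[p^{D^s}_\infty\circ\eta\circ i_\infty^{D^r}]$. A morphism $g\colon D^\bullet\to E^\bullet$ is sent to the family of the $[p^{E^r}_\infty\circ g^r\circ i_\infty^{D^r}]$. 3. The composition of $\mathrm H_*$ with the forgetful functor to $\mathsf{gr}\text{-}\mathsf{Vect}^{\mathbb R^{\mathrm{op}}}$ is naturally isomorphic to persistent cohomology, through the maps $H^r\to H^*(A^r)$ induced by $i_\infty^{D^r}$ (that is, by $i^r$). 4. For every choice $c$ of contractions as above, $d_{\mathcal A_\infty}(X,Y):=d_{\mathsf{ho}(\infty\text{-}\mathsf{Alg}_{\mathcal A_\infty})}\big(\mathrm H_*(\mathrm{TC}_c^*(X)),\mathrm H_*(\mathrm{TC}_c^*(Y))\big)$ is an extended pseudo-distance on finite filtered data (it vanishes for $X=Y$, is symmetric and satisfies the triangle inequality), and it does not depend on $c$. -/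

import Mathlib

open CategoryTheory DirectSum

universe u

namespace AInf

/-! ### Decompositions of finite lists -/

section Combinatorics

variable {α β : Type*} {M : Type*} [AddCommMonoid M]

/-- The sum of `f x` over the entries `x` of the list `L`. -/
def lsum (L : List α) (f : α → M) : M := (L.map f).sum

/-- All ways of writing a list as a concatenation `p ++ r` (`p` and `r` may be empty). -/
def splits : List α → List (List α × List α)
  | [] => [([], [])]
  | a :: l => ([], a :: l) :: (splits l).map (fun s => (a :: s.1, s.2))

/-- Given a decomposition `s` of a list `l` into consecutive nonempty blocks, the decompositions
of `a :: l` which restrict to `s`: either `a` is a block, or `a` joins the first block. -/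
def consParts (a : α) : List (List α) → List (List (List α))
  | [] => [[[a]]]
  | b :: s => [[a] :: b :: s, (a :: b) :: s]

/-- All ways of writing a list as a concatenation of consecutive nonempty blocks. -/
def parts : List α → List (List (List α))
  | [] => [[]]
  | a :: l => (parts l).flatMap (consParts a)

@[simp] lemma consParts_nil (a : α) : consParts a [] = [[[a]]] := rfl

@[simp] lemma consParts_cons (a : α) (b : List α) (s : List (List α)) :
    consParts a (b :: s) = [[a] :: b :: s, (a :: b) :: s] := rfl

@[simp] lemma lsum_nil (f : α → M) : lsum [] f = 0 := rfl

@[simp] lemma lsum_cons (a : α) (L : List α) (f : α → M) :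
    lsum (a :: L) f = f a + lsum L f := by simp [lsum]

@[simp] lemma lsum_append (L L' : List α) (f : α → M) :
    lsum (L ++ L') f = lsum L f + lsum L' f := by simp [lsum]

@[simp] lemma lsum_map (g : β → α) (L : List β) (f : α → M) :
    lsum (L.map g) f = lsum L (fun x => f (g x)) := by simp [lsum, Function.comp_def]

@[simp] lemma lsum_flatMap (g : β → List α) (L : List β) (f : α → M) :
    lsum (L.flatMap g) f = lsum L (fun x => lsum (g x) f) := by
  induction L with
  | nil => rfl
  | cons a L ih => simp [ih]

@[simp] lemma lsum_zero (L : List α) : lsum L (fun _ => (0 : M)) = 0 := by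
  induction L with
  | nil => rfl
  | cons a L ih => simp [ih]

lemma lsum_add (L : List α) (f g : α → M) :
    lsum L (fun x => f x + g x) = lsum L f + lsum L g := by
  induction L with
  | nil => simp
  | cons a L ih => simp [ih]; abel

lemma lsum_congr {L : List α} {f g : α → M} (h : ∀ x ∈ L, f x = g x) : lsum L f = lsum L g := by
  induction L with
  | nil => rfl
  | cons a L ih =>
    rw [lsum_cons, lsum_cons, h a (by simp), ih fun x hx => h x (by simp [hx])]

lemma lsum_comm (L : List α) (L' : List β) (f : α → β → M) :
    lsum L (fun x => lsum L' (f x)) = lsum L' (fun y => lsum L (fun x => f x y)) := by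
  induction L with
  | nil => simp
  | cons a L ih => simp [ih, lsum_add]

lemma map_lsum {N F : Type*} [AddCommMonoid N] [FunLike F M N] [AddMonoidHomClass F M N]
    (φ : F) (L : List α) (f : α → M) : φ (lsum L f) = lsum L (fun x => φ (f x)) := by
  induction L with
  | nil => simp
  | cons a L ih => simp [ih]

lemma smul_lsum {R : Type*} [Semiring R] [Module R M] (c : R) (L : List α) (f : α → M) :
    c • lsum L f = lsum L (fun x => c • f x) := by
  induction L with
  | nil => simp
  | cons a L ih => simp [ih]

lemma mem_splits {l : List α} {s : List α × List α} (h : s ∈ splits l) : s.1 ++ s.2 = l := by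
  induction l generalizing s with
  | nil => simp [splits] at h; simp [h]
  | cons a l ih =>
    simp only [splits, List.mem_cons, List.mem_map] at h
    rcases h with rfl | ⟨t, ht, rfl⟩
    · rfl
    · simp [ih ht]

lemma splits_map (f : α → β) (l : List α) :
    splits (l.map f) = (splits l).map (fun s => (s.1.map f, s.2.map f)) := by
  induction l with
  | nil => rfl
  | cons a l ih => simp [splits, ih, Function.comp_def]

lemma consParts_map (f : α → β) (a : α) (s : List (List α)) :
    consParts (f a) (s.map (List.map f)) = (consParts a s).map (List.map (List.map f)) := by
  cases s <;> simp [consParts]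

lemma parts_map (f : α → β) (l : List α) :
    parts (l.map f) = (parts l).map (List.map (List.map f)) := by
  induction l with
  | nil => rfl
  | cons a l ih =>
    simp [parts, ih, List.flatMap_map, List.map_flatMap, consParts_map]

lemma lsum_parts_cons (a : α) (l : List α) (Ψ : List (List α) → M) :
    lsum (parts (a :: l)) Ψ = lsum (parts l) (fun s => lsum (consParts a s) Ψ) := by
  simp [parts]

lemma mem_parts {l : List α} {s : List (List α)} (h : s ∈ parts l) :
    s.flatten = l ∧ ∀ B ∈ s, B ≠ [] := by
  induction l generalizing s with
  | nil => simp [parts] at h; simp [h]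
  | cons a l ih =>
    simp only [parts, List.mem_flatMap] at h
    obtain ⟨t, ht, hs⟩ := h
    obtain ⟨h1, h2⟩ := ih ht
    cases t with
    | nil => simp [consParts] at hs; subst hs; simp at h1; simp [← h1]
    | cons b t =>
      simp only [consParts, List.mem_cons, List.not_mem_nil, or_false] at hs
      rcases hs with rfl | rfl
      · refine ⟨by simp [← h1], ?_⟩
        intro B hB
        rcases List.mem_cons.1 hB with rfl | hB
        · simp
        · exact h2 B hB
      · refine ⟨by simp [← h1], ?_⟩
        intro B hB
        rcases List.mem_cons.1 hB with rfl | hB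
        · simp
        · exact h2 B (by simp [hB])

lemma parts_cons_ne_nil {a : α} {l : List α} {s : List (List α)} (h : s ∈ parts (a :: l)) :
    s ≠ [] := by
  rintro rfl
  simpa using (mem_parts h).1

lemma splits_coassoc (l : List α) (Ψ : List α → List α → List α → M) :
    lsum (splits l) (fun s => lsum (splits s.1) (fun t => Ψ t.1 t.2 s.2)) =
      lsum (splits l) (fun s => lsum (splits s.2) (fun t => Ψ s.1 t.1 t.2)) := by
  induction l generalizing Ψ with
  | nil => simp [splits]
  | cons a l ih =>
    simp only [splits, lsum_cons, lsum_map, lsum_add, lsum_nil, add_zero]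
    rw [ih fun x y z => Ψ (a :: x) y z, add_assoc]

lemma parts_splits (l : List α) (Ψ : List (List α) → List (List α) → M) :
    lsum (parts l) (fun s => lsum (splits s) (fun t => Ψ t.1 t.2)) =
      lsum (splits l) (fun t => lsum (parts t.1) (fun s₁ => lsum (parts t.2) (Ψ s₁))) := by
  induction l generalizing Ψ with
  | nil => simp [splits, parts]
  | cons a l ih =>
    have key : ∀ s : List (List α),
        lsum (consParts a s) (fun s => lsum (splits s) (fun t => Ψ t.1 t.2)) =
          lsum (consParts a s) (Ψ []) +
            lsum (splits s) (fun t => lsum (consParts a t.1) (fun s₁ => Ψ s₁ t.2)) := by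
      intro s
      cases s with
      | nil => simp [splits, consParts]
      | cons b s => simp [splits, consParts, lsum_add]; abel
    rw [lsum_parts_cons, lsum_congr fun s _ => key s, lsum_add, ← lsum_parts_cons,
      ih fun s₁ s₂ => lsum (consParts a s₁) (fun s₁ => Ψ s₁ s₂)]
    simp only [splits, lsum_cons, lsum_map]
    congr 1
    · simp [parts]
    · refine lsum_congr fun t _ => ?_
      rw [lsum_parts_cons]
      refine lsum_congr fun s₁ _ => ?_
      rw [lsum_comm]

lemma parts_cons (v : α) (Z : List α) (Ψ : List (List α) → M) :
    lsum (parts (v :: Z)) Ψ =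
      lsum (splits Z) (fun t => lsum (parts t.2) (fun s => Ψ ((v :: t.1) :: s))) := by
  induction Z generalizing v Ψ with
  | nil => simp [parts, splits, consParts]
  | cons w Z ih =>
    rw [lsum_parts_cons, ih]
    simp only [consParts, lsum_cons, lsum_nil, add_zero, lsum_add, splits, lsum_map]
    rw [ih w]

lemma parts_append_cons (X : List α) (v : α) (Z : List α) (Ψ : List (List α) → M) :
    lsum (parts (X ++ v :: Z)) Ψ =
      lsum (splits X) (fun t => lsum (splits Z) (fun r => lsum (parts t.1) (fun s₁ =>
        lsum (parts r.2) (fun s₃ => Ψ (s₁ ++ (t.2 ++ v :: r.1) :: s₃))))) := by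
  induction X generalizing Ψ with
  | nil =>
    rw [List.nil_append, parts_cons]
    simp [splits, parts]
  | cons a X ih =>
    rw [List.cons_append, lsum_parts_cons, ih]
    simp only [splits, lsum_cons, lsum_map, lsum_parts_cons]
    have hne : ∀ (s₁ : List (List α)) (B : List α) (s₃ : List (List α)), s₁ ≠ [] →
        lsum (consParts a (s₁ ++ B :: s₃)) Ψ =
          lsum (consParts a s₁) (fun s => Ψ (s ++ B :: s₃)) := by
      intro s₁ B s₃ h
      cases s₁ with
      | nil => exact absurd rfl h
      | cons c s₁ => simp [consParts]
    cases X with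
    | nil => simp [splits, parts, consParts, lsum_add]; abel
    | cons c X =>
      simp only [splits, lsum_cons, lsum_map]
      rw [← add_assoc]
      congr 1
      · simp [parts, consParts, lsum_add]; abel
      · refine lsum_congr fun t _ => lsum_congr fun r _ => lsum_congr fun s₁ hs₁ => ?_
        simp only [hne s₁ _ _ (parts_cons_ne_nil hs₁)]
        rw [lsum_comm]

/-- The sum of `Ψ` over the choices of a decomposition of each entry of `u`. -/
def msum : List (List α) → (List (List (List α)) → M) → M
  | [], Ψ => Ψ []
  | B :: u, Ψ => lsum (parts B) (fun c => msum u (fun t => Ψ (c :: t)))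

lemma msum_add (u : List (List α)) (Ψ Φ : List (List (List α)) → M) :
    msum u (fun t => Ψ t + Φ t) = msum u Ψ + msum u Φ := by
  induction u generalizing Ψ Φ with
  | nil => rfl
  | cons B u ih => simp [msum, ih, lsum_add]

lemma parts_parts (l : List α) (Ψ : List (List (List α)) → M) :
    lsum (parts l) (fun s => lsum (parts s) Ψ) = lsum (parts l) (fun u => msum u Ψ) := by
  induction l generalizing Ψ with
  | nil => simp [parts, msum]
  | cons a l ih =>
    let Ψ' : List (List (List α)) → M := fun t => match t with
      | [] => Ψ [[[a]]]
      | c :: cs => Ψ ([[a]] :: c :: cs) + lsum (consParts a c) (fun c' => Ψ (c' :: cs))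
    have h1 : ∀ s ∈ parts l, lsum (consParts a s) (fun s => lsum (parts s) Ψ) =
        lsum (parts s) Ψ' := by
      intro s _
      cases s with
      | nil => simp [consParts, parts, Ψ']
      | cons b bs =>
        simp only [consParts_cons, lsum_cons, lsum_nil, add_zero, lsum_parts_cons]
        rw [← lsum_add]
        refine lsum_congr fun t _ => ?_
        cases t with
        | nil => simp [consParts, Ψ', add_assoc]
        | cons c cs => simp [consParts, Ψ']; abel
    have h2 : ∀ u ∈ parts l, lsum (consParts a u) (fun u => msum u Ψ) = msum u Ψ' := by
      intro u hu
      cases u with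
      | nil => simp [consParts, msum, parts, Ψ']
      | cons B u =>
        simp only [consParts, lsum_cons, lsum_nil, add_zero, msum]
        rw [lsum_parts_cons a B, lsum_parts_cons a []]
        simp only [parts, lsum_cons, lsum_nil, add_zero, consParts]
        have : ∀ c ∈ parts B, msum u (fun t => Ψ' (c :: t)) =
            msum u (fun t => Ψ ([[a]] :: c :: t)) +
              lsum (consParts a c) (fun c' => msum u (fun t => Ψ (c' :: t))) := by
          intro c _
          simp only [Ψ', msum_add]
          congr 1
          cases c <;> simp [consParts, msum_add]
        rw [lsum_congr this, lsum_add]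
        rfl
    rw [lsum_parts_cons, lsum_congr h1, ih, lsum_parts_cons, lsum_congr h2]

end Combinatorics

/-! ### Graded vector spaces and families of multilinear maps -/

/-- A function on finite lists whose restriction to the lists of each length `n` is a
`k`-multilinear map in `n` variables. -/
structure Multilin (k : Type*) {A M : Type*} [Field k] [AddCommGroup A] [Module k A]
    [AddCommGroup M] [Module k M] (φ : List A → M) : Prop where
  add : ∀ p x y r, φ (p ++ (x + y) :: r) = φ (p ++ x :: r) + φ (p ++ y :: r)
  smul : ∀ p (c : k) x r, φ (p ++ (c • x) :: r) = c • φ (p ++ x :: r)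

namespace Multilin

variable {k A B M : Type*} [Field k] [AddCommGroup A] [Module k A] [AddCommGroup B] [Module k B]
  [AddCommGroup M] [Module k M] {φ ψ : List A → M}

/-- The linear map given by one of the variables. -/
def slot (h : Multilin k φ) (p r : List A) : A →ₗ[k] M where
  toFun x := φ (p ++ x :: r)
  map_add' x y := h.add p x y r
  map_smul' c x := h.smul p c x r

lemma zero (h : Multilin k φ) (p r : List A) : φ (p ++ 0 :: r) = 0 := (h.slot p r).map_zero

lemma lsum (h : Multilin k φ) {ι : Type*} (p r : List A) (L : List ι) (f : ι → A) :
    φ (p ++ AInf.lsum L f :: r) = AInf.lsum L (fun i => φ (p ++ f i :: r)) :=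
  map_lsum (h.slot p r) L f

lemma smul_map (h : Multilin k φ) {ι : Type*} (p : List A) (l : List ι) (c : ι → k) (x : ι → A) :
    φ (p ++ l.map (fun a => c a • x a)) = (l.map c).prod • φ (p ++ l.map x) := by
  induction l generalizing p with
  | nil => simp
  | cons a l ih =>
    have := ih (p ++ [x a])
    simp only [List.append_assoc, List.singleton_append] at this
    rw [List.map_cons, h.smul, this, List.map_cons, List.prod_cons, mul_smul, List.map_cons]

lemma smul_map_const (h : Multilin k φ) (p r l : List A) (c : k) :
    φ (p ++ (l.map (fun x => c • x) ++ r)) = c ^ l.length • φ (p ++ (l ++ r)) := by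
  induction l generalizing p with
  | nil => simp
  | cons a l ih =>
    have := ih (p ++ [a])
    simp only [List.append_assoc, List.singleton_append] at this
    rw [List.map_cons, List.cons_append, h.smul, this, List.length_cons, pow_succ', mul_smul,
      List.cons_append]

lemma eq_zero (h : Multilin k φ) {l : List A} (h0 : (0 : A) ∈ l) : φ l = 0 := by
  obtain ⟨p, r, rfl⟩ := List.append_of_mem h0
  exact h.zero p r

lemma zero_fun : Multilin k (fun _ : List A => (0 : M)) := ⟨by simp, by simp⟩

lemma add_fun (h : Multilin k φ) (h' : Multilin k ψ) : Multilin k (fun l => φ l + ψ l) where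
  add p x y r := by simp only [h.add, h'.add]; abel
  smul p c x r := by simp only [h.smul, h'.smul, smul_add]

lemma comp_linear {N : Type*} [AddCommGroup N] [Module k N] (h : Multilin k φ) (g : M →ₗ[k] N) :
    Multilin k (fun l => g (φ l)) where
  add p x y r := by simp [h.add]
  smul p c x r := by simp [h.smul]

lemma comp_map (h : Multilin k φ) (f : B →ₗ[k] A) : Multilin k (fun l => φ (l.map f)) where
  add p x y r := by simp [h.add]
  smul p c x r := by simp [h.smul]

end Multilin

/-- The category of `ℤ`-graded vector spaces over `k`. -/
abbrev GrVect (k : Type u) [Field k] := GradedObject ℤ (ModuleCat.{u} k)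

variable {k : Type u} [Field k]

/-- The total space of a graded vector space. -/
abbrev Tot (V : GrVect k) : Type u := ⨁ i : ℤ, V i

/-- The inclusion of the component of degree `i` into the total space. -/
abbrev el (V : GrVect k) (i : ℤ) : V i →ₗ[k] Tot V := DirectSum.lof k ℤ (fun i => V i) i

/-- The subspace of homogeneous elements of degree `i` of the total space. -/
def homog (V : GrVect k) (i : ℤ) : Submodule k (Tot V) := LinearMap.range (el V i)

/-- The Koszul sign of an operator of degree `n` moving past an element:
`x ↦ (-1) ^ (n * |x|) • x` on homogeneous elements. -/
def sgn (V : GrVect k) (n : ℕ) : Tot V →ₗ[k] Tot V :=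
  DirectSum.toModule k ℤ (Tot V) (fun i => (-1 : k) ^ (n * i.natAbs) • el V i)

@[simp] lemma sgn_el (V : GrVect k) (n : ℕ) (i : ℤ) (x : V i) :
    sgn V n (el V i x) = (-1 : k) ^ (n * i.natAbs) • el V i x := by
  simp [sgn]

lemma neg_one_pow_congr {a b : ℕ} (h : Even a ↔ Even b) : (-1 : k) ^ a = (-1) ^ b := by
  by_cases ha : Even a
  · rw [ha.neg_one_pow, (h.1 ha).neg_one_pow]
  · rw [(Nat.not_even_iff_odd.1 ha).neg_one_pow,
      (Nat.not_even_iff_odd.1 fun hb => ha (h.2 hb)).neg_one_pow]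

lemma sgn_congr (V : GrVect k) {a b : ℕ} (h : Even a ↔ Even b) : sgn V a = sgn V b := by
  apply DirectSum.linearMap_ext
  intro i
  ext x
  simp only [LinearMap.comp_apply, sgn_el]
  rw [neg_one_pow_congr (a := a * i.natAbs) (b := b * i.natAbs)]
  simp [Nat.even_mul, h]

@[simp] lemma sgn_sgn (V : GrVect k) (a b : ℕ) (x : Tot V) :
    sgn V a (sgn V b x) = sgn V (a + b) x := by
  have : (sgn V a) ∘ₗ (sgn V b) = sgn V (a + b) := by
    apply DirectSum.linearMap_ext
    intro i
    ext x
    simp only [LinearMap.comp_apply, sgn_el, map_smul, smul_smul]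
    rw [add_mul, pow_add, mul_comm]
  exact LinearMap.congr_fun this x

@[simp] lemma sgn_zero (V : GrVect k) : sgn V 0 = LinearMap.id := by
  apply DirectSum.linearMap_ext
  intro i
  ext x
  simp

lemma sgn_even (V : GrVect k) {a : ℕ} (h : Even a) : sgn V a = LinearMap.id := by
  rw [sgn_congr V (b := 0) (by simpa using h), sgn_zero]

lemma Multilin.ext_homog {V : GrVect k} {M : Type*} [AddCommGroup M] [Module k M]
    {φ ψ : List (Tot V) → M} (hφ : Multilin k φ) (hψ : Multilin k ψ)
    (h : ∀ l : List (Σ i : ℤ, V i),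
      φ (l.map fun a => el V a.1 a.2) = ψ (l.map fun a => el V a.1 a.2)) : φ = ψ := by
  have key : ∀ (r : List (Tot V)) (l : List (Σ i : ℤ, V i)),
      φ (l.map (fun a => el V a.1 a.2) ++ r) = ψ (l.map (fun a => el V a.1 a.2) ++ r) := by
    intro r
    induction r with
    | nil => intro l; simpa using h l
    | cons x r ih =>
      intro l
      have : hφ.slot (l.map fun a => el V a.1 a.2) r = hψ.slot (l.map fun a => el V a.1 a.2) r := by
        apply DirectSum.linearMap_ext
        intro i
        ext y
        have := ih (l ++ [⟨i, y⟩])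
        simpa [Multilin.slot] using this
      exact LinearMap.congr_fun this x
  funext r
  simpa using key r []

/-- A family of `k`-multilinear maps `V^{⊗ n} → W`, `n ≥ 1`, the `n`-ary map being of
(cohomological) degree `c - n`. The family is recorded as a function on the finite lists of
elements of `V`, with value `0` on the empty list. -/
structure Ops (V W : GrVect k) (c : ℤ) where
  op : List (Tot V) → Tot W
  nil : op [] = 0
  multilin : Multilin k op
  degree : ∀ l : List (Σ i : ℤ, V i), op (l.map fun a => el V a.1 a.2) ∈
    homog W ((l.map Sigma.fst).sum + c - l.length)

lemma Ops.ext {V W : GrVect k} {c : ℤ} {f g : Ops V W c} (h : f.op = g.op) : f = g := by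
  cases f; cases g; cases h; rfl

lemma even_natAbs_sum (l : List ℤ) :
    Even (l.map Int.natAbs).sum ↔ Even l.sum := by
  induction l with
  | nil => simp
  | cons a l ih => simp [Nat.even_add, Int.even_add, ih, Int.natAbs_even]

lemma Ops.sgn_comm {V W : GrVect k} {c : ℤ} (f : Ops V W c) (n : ℕ) (l : List (Tot V)) :
    f.op (l.map (sgn V n)) = (-1 : k) ^ (n * (c.natAbs + l.length)) • sgn W n (f.op l) := by
  have h1 : Multilin k (fun l : List (Tot V) =>
      (-1 : k) ^ (n * (c.natAbs + l.length)) • sgn W n (f.op l)) := by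
    refine ⟨fun p x y r => ?_, fun p a x r => ?_⟩
    · simp [f.multilin.add]
    · simp [f.multilin.smul, smul_comm a]
  refine congrFun (Multilin.ext_homog (f.multilin.comp_map (sgn V n)) h1 fun l => ?_) l
  obtain ⟨y, hy⟩ := f.degree l
  simp only [List.map_map, Function.comp_def, sgn_el]
  have h2 := f.multilin.smul_map [] l (fun a => (-1 : k) ^ (n * a.1.natAbs))
    (fun a => el V a.1 a.2)
  simp only [List.nil_append] at h2
  rw [h2, ← hy, sgn_el, smul_smul, ← pow_add]
  congr 1
  have h3 : (l.map fun a => (-1 : k) ^ (n * a.1.natAbs)).prod =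
      (-1 : k) ^ (n * ((l.map Sigma.fst).map Int.natAbs).sum) := by
    clear h2 hy y
    induction l with
    | nil => simp
    | cons a l ih => simp [ih, mul_add, pow_add]
  rw [h3]
  apply neg_one_pow_congr
  rw [← mul_add, Nat.even_mul, Nat.even_mul]
  have := even_natAbs_sum (l.map Sigma.fst)
  simp only [Nat.even_add, Int.natAbs_even, Int.even_sub, Int.even_add, this, List.length_map,
    Int.even_coe_nat]
  tauto

/-! ### The signed sums occurring in the relations -/

section Sums

variable {U V W : GrVect k} {M : Type*} [AddCommGroup M] [Module k M]

/-- `∑ (-1)^{p + q r} φ_{p + 1 + r} ∘ (id^{⊗ p} ⊗ m_q ⊗ id^{⊗ r})`, evaluated on a list `l`: the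
sum is over all ways of writing `l` as a concatenation of lists of lengths `p`, `q`, `r`.
The Koszul sign rule is applied, `m_q` being of degree `2 - q`, i.e. of the parity of `q`.
(The terms with `q = 0` vanish when `φ` is multilinear and `m [] = 0`.) -/
def insertSum (m : List (Tot V) → Tot V) (φ : List (Tot V) → M) (l : List (Tot V)) : M :=
  lsum (splits l) fun s => lsum (splits s.2) fun t =>
    (-1 : k) ^ (s.1.length + t.1.length * t.2.length) •
      φ (s.1.map (sgn V t.1.length) ++ m t.1 :: t.2)

/-- `∑ (i_j - 1)` for a list of blocks of lengths `i_1, …, i_n`. -/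
def blockDeg {α : Type*} (s : List (List α)) : ℕ := (s.map fun B => B.length - 1).sum

/-- The exponent `(n - 1) (i_1 - 1) + (n - 2) (i_2 - 1) + ⋯ + (i_{n - 1} - 1)` for a list of
blocks of lengths `i_1, …, i_n`. -/
def blockSign {α : Type*} : List (List α) → ℕ
  | [] => 0
  | B :: s => s.length * (B.length - 1) + blockSign s

/-- The tensor product `f_{i_1} ⊗ ⋯ ⊗ f_{i_n}` evaluated on a list of blocks of lengths
`i_1, …, i_n`, with the Koszul sign rule, `f_i` being of degree `1 - i`. -/
def blockMap (f : List (Tot V) → Tot W) : List (List (Tot V)) → List (Tot W)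
  | [] => []
  | B :: s => f (B.map (sgn V (blockDeg s))) :: blockMap f s

/-- `∑ (-1)^ε φ_n ∘ (f_{i_1} ⊗ ⋯ ⊗ f_{i_n})` with
`ε = (n - 1) (i_1 - 1) + (n - 2) (i_2 - 1) + ⋯ + (i_{n - 1} - 1)`, evaluated on a list `l`:
the sum is over all ways of cutting `l` into consecutive blocks of lengths
`i_1, …, i_n ≥ 1`. -/
def blockSum (f : List (Tot V) → Tot W) (φ : List (Tot W) → M) (l : List (Tot V)) : M :=
  lsum (parts l) fun s => (-1 : k) ^ blockSign s • φ (blockMap f s)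

/-! The same sums on suspensions, where most signs disappear. -/

/-- The sign of the identification of `V^{⊗ n}` with its suspension. -/
def tw (V : GrVect k) : List (Tot V) → List (Tot V)
  | [] => []
  | x :: l => sgn V l.length x :: tw V l

/-- The sign operator of the suspension. -/
def ssgn (V : GrVect k) : Tot V →ₗ[k] Tot V := -sgn V 1

/-- The unsigned counterpart of `insertSum`. -/
def barInsert (b : List (Tot V) → Tot V) (φ : List (Tot V) → M) (l : List (Tot V)) : M :=
  lsum (splits l) fun s => lsum (splits s.2) fun t => φ (s.1.map (ssgn V) ++ b t.1 :: t.2)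

/-- The unsigned counterpart of `blockSum`. -/
def barBlock (F : List (Tot V) → Tot W) (φ : List (Tot W) → M) (l : List (Tot V)) : M :=
  lsum (parts l) fun s => φ (s.map F)

@[simp] lemma length_tw (l : List (Tot V)) : (tw V l).length = l.length := by
  induction l with
  | nil => rfl
  | cons a l ih => simp [tw, ih]

lemma tw_append (l l' : List (Tot V)) :
    tw V (l ++ l') = (tw V l).map (sgn V l'.length) ++ tw V l' := by
  induction l with
  | nil => rfl
  | cons a l ih => simp [tw, ih, add_comm]

lemma tw_map_sgn (n : ℕ) (l : List (Tot V)) : tw V (l.map (sgn V n)) = (tw V l).map (sgn V n) := by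
  induction l with
  | nil => rfl
  | cons a l ih => simp [tw, ih, add_comm]

lemma tw_tw (l : List (Tot V)) : tw V (tw V l) = l := by
  induction l with
  | nil => rfl
  | cons a l ih => simp [tw, ih, sgn_even V (Even.add_self l.length)]

lemma tw_surjective : Function.Surjective (tw V) := fun l => ⟨tw V l, tw_tw l⟩

lemma Multilin.comp_tw {φ : List (Tot V) → M} (h : Multilin k φ) :
    Multilin k (fun l => φ (tw V l)) where
  add p x y r := by simp [tw_append, tw, h.add]
  smul p c x r := by simp [tw_append, tw, h.smul]

lemma splits_tw (l : List (Tot V)) :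
    splits (tw V l) = (splits l).map fun s => ((tw V s.1).map (sgn V s.2.length), tw V s.2) := by
  induction l with
  | nil => rfl
  | cons a l ih =>
    simp only [tw, splits, ih, List.map_cons, List.map_map, List.map_nil, List.cons.injEq, true_and]
    refine List.map_congr_left fun s hs => ?_
    have := congrArg List.length (mem_splits hs)
    rw [List.length_append] at this
    simp [← this, tw, add_comm]

lemma map_map_sgn (a b : ℕ) (l : List (Tot V)) :
    (l.map (sgn V b)).map (sgn V a) = l.map (sgn V (a + b)) := by simp

lemma map_ssgn (l : List (Tot V)) :
    l.map (ssgn V) = (l.map (sgn V 1)).map (fun x => (-1 : k) • x) := by simp [ssgn]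

lemma insertSum_tw (m : Ops V V 2) {φ : List (Tot V) → M} (hφ : Multilin k φ)
    (l : List (Tot V)) :
    insertSum m.op φ (tw V l) = barInsert (fun l => m.op (tw V l)) (fun l => φ (tw V l)) l := by
  unfold insertSum barInsert
  rw [splits_tw, lsum_map]
  refine lsum_congr fun s _ => ?_
  rw [splits_tw, lsum_map]
  refine lsum_congr fun t ht => ?_
  have hl := congrArg List.length (mem_splits ht)
  rw [List.length_append] at hl
  dsimp only
  rw [m.sgn_comm, map_map_sgn]
  simp only [length_tw, List.length_map]
  rw [tw_append, tw, map_ssgn]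
  have e1 : (tw V ((s.1.map (sgn V 1)).map fun x => (-1 : k) • x)) =
      ((tw V s.1).map (sgn V 1)).map (fun x => (-1 : k) • x) := by
    rw [← tw_map_sgn]
    generalize s.1.map (sgn V 1) = q
    induction q with
    | nil => rfl
    | cons a q ih => simp only [List.map_cons, tw, ih, List.length_map, map_smul]
  have e2 : (((tw V s.1).map (sgn V 1)).map (fun x => (-1 : k) • x)).map
      (sgn V (m.op (tw V t.1) :: t.2).length) =
      ((tw V s.1).map (sgn V ((t.2.length + 1) + 1))).map (fun x => (-1 : k) • x) := by
    simp [Function.comp_def]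
  rw [e1, e2, hφ.smul]
  have e3 := hφ.smul_map_const [] (sgn V t.2.length (m.op (tw V t.1)) :: tw V t.2)
    ((tw V s.1).map (sgn V ((t.2.length + 1) + 1))) (-1 : k)
  simp only [List.nil_append] at e3
  rw [e3, smul_smul, ← pow_add]
  have e4 : sgn V (t.1.length + s.2.length) = sgn V (t.2.length + 1 + 1) := by
    apply sgn_congr
    rw [← hl]
    simp only [Nat.even_add, Nat.not_even_one]
    tauto
  rw [e4]
  congr 1
  rw [List.length_map, length_tw]
  apply neg_one_pow_congr
  simp only [Nat.even_add, Nat.even_mul, (by decide : (2 : ℤ).natAbs = 2), even_two, true_iff]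
  tauto

/-- The effect of `tw` on a decomposition into blocks. -/
def twBlocks (V : GrVect k) : List (List (Tot V)) → List (List (Tot V))
  | [] => []
  | B :: s => (tw V B).map (sgn V s.flatten.length) :: twBlocks V s

lemma consParts_tw (a : Tot V) (s : List (List (Tot V))) :
    consParts (sgn V s.flatten.length a) (twBlocks V s) = (consParts a s).map (twBlocks V) := by
  cases s with
  | nil => simp [twBlocks, tw]
  | cons B s =>
    simp only [twBlocks, consParts_cons, List.map_cons, List.map_nil, tw]
    simp [add_comm]

lemma parts_tw (l : List (Tot V)) : parts (tw V l) = (parts l).map (twBlocks V) := by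
  induction l with
  | nil => rfl
  | cons a l ih =>
    simp only [tw, parts, ih, List.flatMap_map, List.map_flatMap]
    apply List.flatMap_congr
    intro s hs
    rw [← (mem_parts hs).1, consParts_tw]

lemma length_twBlocks (s : List (List (Tot V))) : (twBlocks V s).length = s.length := by
  induction s with
  | nil => rfl
  | cons B s ih => simp [twBlocks, ih]

lemma blockDeg_twBlocks (s : List (List (Tot V))) : blockDeg (twBlocks V s) = blockDeg s := by
  induction s with
  | nil => rfl
  | cons B s ih => simpa [twBlocks, blockDeg] using ih

lemma blockSign_twBlocks (s : List (List (Tot V))) : blockSign (twBlocks V s) = blockSign s := by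
  induction s with
  | nil => rfl
  | cons B s ih => simp [twBlocks, blockSign, ih, length_twBlocks]

lemma even_blockDeg {α : Type*} (s : List (List α)) (h : ∀ B ∈ s, B ≠ []) :
    Even (blockDeg s + s.flatten.length) ↔ Even s.length := by
  induction s with
  | nil => simp [blockDeg]
  | cons B s ih =>
    have := ih fun B hB => h B (by simp [hB])
    have hB := h B (by simp)
    obtain ⟨b, B, rfl⟩ := List.exists_cons_of_ne_nil hB
    simp only [blockDeg, List.map_cons, List.sum_cons, List.flatten_cons, List.length_append,
      List.length_cons, Nat.add_sub_cancel, Nat.even_add, Nat.not_even_one] at this ⊢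
    tauto

lemma blockMap_tw (f : Ops V W 1) {φ : List (Tot W) → M} (hφ : Multilin k φ)
    (p : List (Tot W)) (s : List (List (Tot V))) (hs : ∀ B ∈ s, B ≠ []) :
    (-1 : k) ^ blockSign s • φ (p ++ blockMap f.op (twBlocks V s)) =
      φ (p ++ tw W (s.map fun B => f.op (tw V B))) := by
  induction s generalizing p with
  | nil => simp [blockSign, twBlocks, blockMap, tw]
  | cons B s ih =>
    have hs' : ∀ B ∈ s, B ≠ [] := fun B hB => hs B (by simp [hB])
    have hB : B ≠ [] := hs B (by simp)
    simp only [blockSign, twBlocks, blockMap, List.map_cons, tw, List.length_map]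
    have h1 := ih (p ++ [sgn W s.length (f.op (tw V B))]) hs'
    simp only [List.append_assoc, List.singleton_append] at h1
    rw [← h1, map_map_sgn, blockDeg_twBlocks, sgn_congr V (even_blockDeg s hs'), f.sgn_comm,
      hφ.smul, smul_smul, ← pow_add]
    congr 1
    apply neg_one_pow_congr
    obtain ⟨b, B, rfl⟩ := List.exists_cons_of_ne_nil hB
    simp only [length_tw, List.length_cons, Nat.add_sub_cancel, Nat.even_add, Nat.even_mul,
      Int.natAbs_one, Nat.not_even_one]
    tauto

lemma blockSum_tw (f : Ops V W 1) {φ : List (Tot W) → M} (hφ : Multilin k φ)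
    (l : List (Tot V)) :
    blockSum f.op φ (tw V l) = barBlock (fun l => f.op (tw V l)) (fun l => φ (tw W l)) l := by
  unfold blockSum barBlock
  rw [parts_tw, lsum_map]
  refine lsum_congr fun s hs => ?_
  have := blockMap_tw f hφ [] s (mem_parts hs).2
  rw [blockSign_twBlocks]
  simpa using this

end Sums

section Bar

variable {U V W X : GrVect k} {M : Type*} [AddCommGroup M] [Module k M]

lemma multilin_barBlock {F : List (Tot V) → Tot W} (hF : Multilin k F)
    {φ : List (Tot W) → M} (hφ : Multilin k φ) : Multilin k (barBlock F φ) where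
  add p x y r := by
    simp only [barBlock, parts_append_cons, List.map_append, List.map_cons, hF.add, hφ.add,
      lsum_add]
  smul p c x r := by
    simp only [barBlock, parts_append_cons, List.map_append, List.map_cons, hF.smul, hφ.smul,
      smul_lsum]

lemma barInsert_barBlock {b : List (Tot V) → Tot V} {b' : List (Tot W) → Tot W}
    {F : List (Tot V) → Tot W} (hF : ∀ l, barInsert b F l = barBlock F b' l)
    (hτ : ∀ l, F (l.map (ssgn V)) = ssgn W (F l)) {φ : List (Tot W) → M} (hφ : Multilin k φ)
    (l : List (Tot V)) :
    barInsert b (barBlock F φ) l = barBlock F (barInsert b' φ) l := by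
  have hτ' : ∀ s : List (List (Tot V)),
      (s.map (List.map (ssgn V))).map F = (s.map F).map (ssgn W) := by
    intro s
    simp [Function.comp_def, hτ]
  have hR : barBlock F (barInsert b' φ) l =
      lsum (splits l) fun s => lsum (parts s.1) fun s₁ => lsum (splits s.2) fun t =>
        lsum (parts t.2) fun s₃ =>
          φ ((s₁.map F).map (ssgn W) ++ barBlock F b' t.1 :: s₃.map F) := by
    simp only [barBlock, barInsert, splits_map, lsum_map]
    rw [parts_splits l fun s₁ s' => lsum (splits s') fun t =>
      φ ((s₁.map F).map (ssgn W) ++ b' (t.1.map F) :: t.2.map F)]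
    refine lsum_congr fun s _ => lsum_congr fun s₁ _ => ?_
    rw [parts_splits s.2 fun s₂ s₃ =>
      φ ((s₁.map F).map (ssgn W) ++ b' (s₂.map F) :: s₃.map F)]
    refine lsum_congr fun t _ => ?_
    rw [lsum_comm]
    refine lsum_congr fun s₃ _ => ?_
    rw [hφ.lsum]
  rw [hR]
  simp only [← hF]
  simp only [barBlock, barInsert, parts_append_cons, splits_map, parts_map, lsum_map,
    List.map_append, List.map_cons, hτ', hφ.lsum]
  rw [lsum_congr fun s _ => lsum_comm (splits s.2) (splits s.1) _]
  rw [splits_coassoc l fun l₁ x r => lsum (splits r) fun t => lsum (splits t.2) fun z =>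
    lsum (parts l₁) fun s₁ => lsum (parts z.2) fun s₃ =>
      φ ((s₁.map F).map (ssgn W) ++ F (x.map (ssgn V) ++ b t.1 :: z.1) :: s₃.map F)]
  refine lsum_congr fun s _ => ?_
  have h1 : ∀ s₁ : List (List (Tot V)), (lsum (splits s.2) fun t => lsum (parts t.2) fun s₃ =>
      lsum (splits t.1) fun x => lsum (splits x.2) fun y =>
        φ ((s₁.map F).map (ssgn W) ++ F (x.1.map (ssgn V) ++ b y.1 :: y.2) :: s₃.map F)) =
      lsum (splits s.2) fun x => lsum (splits x.2) fun y => lsum (splits y.2) fun z =>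
        lsum (parts z.2) fun s₃ =>
          φ ((s₁.map F).map (ssgn W) ++ F (x.1.map (ssgn V) ++ b y.1 :: z.1) :: s₃.map F) := by
    intro s₁
    have h2 : ∀ t : List (Tot V) × List (Tot V), (lsum (parts t.2) fun s₃ =>
        lsum (splits t.1) fun x => lsum (splits x.2) fun y =>
        φ ((s₁.map F).map (ssgn W) ++ F (x.1.map (ssgn V) ++ b y.1 :: y.2) :: s₃.map F)) =
        lsum (splits t.1) fun x => lsum (splits x.2) fun y => lsum (parts t.2) fun s₃ =>
        φ ((s₁.map F).map (ssgn W) ++ F (x.1.map (ssgn V) ++ b y.1 :: y.2) :: s₃.map F) := by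
      intro t
      rw [lsum_comm]
      refine lsum_congr fun x _ => ?_
      rw [lsum_comm]
    rw [lsum_congr fun t _ => h2 t]
    rw [splits_coassoc s.2 fun x y' l₃ => lsum (splits y') fun y => lsum (parts l₃) fun s₃ =>
      φ ((s₁.map F).map (ssgn W) ++ F (x.map (ssgn V) ++ b y.1 :: y.2) :: s₃.map F)]
    refine lsum_congr fun x _ => ?_
    rw [splits_coassoc x.2 fun y z l₃ => lsum (parts l₃) fun s₃ =>
      φ ((s₁.map F).map (ssgn W) ++ F (x.1.map (ssgn V) ++ b y :: z) :: s₃.map F)]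
  rw [lsum_congr fun s₁ _ => h1 s₁]
  rw [lsum_comm (parts s.1)]
  refine lsum_congr fun x _ => ?_
  rw [lsum_comm (parts s.1)]
  refine lsum_congr fun y _ => ?_
  rw [lsum_comm (parts s.1)]

lemma msum_multilin {φ : List (Tot W) → M} (hφ : Multilin k φ) (g : List (List (Tot V)) → Tot W)
    (p : List (Tot W)) (u : List (List (Tot V))) :
    φ (p ++ u.map fun B => lsum (parts B) g) = msum u fun t => φ (p ++ t.map g) := by
  induction u generalizing p with
  | nil => simp [msum]
  | cons B u ih =>
    simp only [List.map_cons, msum, hφ.lsum]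
    refine lsum_congr fun c _ => ?_
    simpa using ih (p ++ [g c])

lemma barBlock_assoc (F : List (Tot U) → Tot V) (G : List (Tot V) → Tot W)
    {φ : List (Tot W) → M} (hφ : Multilin k φ) (l : List (Tot U)) :
    barBlock F (barBlock G φ) l = barBlock (barBlock F G) φ l := by
  simp only [barBlock, parts_map, lsum_map]
  rw [parts_parts l fun t => φ ((t.map (List.map F)).map G)]
  refine lsum_congr fun u _ => ?_
  have := msum_multilin hφ (fun s => G (s.map F)) [] u
  simp only [List.nil_append] at this
  have e : barBlock F G = fun B => lsum (parts B) fun s => G (s.map F) := rfl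
  rw [e, this]
  simp [Function.comp_def]

lemma barBlock_strict {F : List (Tot V) → Tot W} (hF : ∀ x y l, F (x :: y :: l) = 0)
    {φ : List (Tot W) → M} (hφ : Multilin k φ) (l : List (Tot V)) :
    barBlock F φ l = φ (l.map fun x => F [x]) := by
  induction l generalizing φ with
  | nil => simp [barBlock, parts]
  | cons a l ih =>
    have h1 : Multilin k fun r => φ (F [a] :: r) :=
      ⟨fun p x y r => hφ.add (F [a] :: p) x y r, fun p c x r => hφ.smul (F [a] :: p) c x r⟩
    have h2 := ih h1
    simp only [List.map_cons]
    rw [← h2]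
    unfold barBlock
    rw [lsum_parts_cons]
    refine lsum_congr fun s hs => ?_
    cases s with
    | nil => simp
    | cons B s =>
      obtain ⟨c, B, rfl⟩ := List.exists_cons_of_ne_nil ((mem_parts hs).2 B (by simp))
      have h3 : φ (0 :: s.map F) = 0 := hφ.zero [] _
      simp [hF, h3]

lemma multilin_blockSum (f : Ops V W 1) {φ : List (Tot W) → M} (hφ : Multilin k φ) :
    Multilin k (blockSum f.op φ) := by
  have h := (multilin_barBlock f.multilin.comp_tw hφ.comp_tw).comp_tw
  have e : (fun l => barBlock (fun l => f.op (tw V l)) (fun l => φ (tw W l)) (tw V l)) =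
      blockSum f.op φ := by
    funext l
    rw [← blockSum_tw f hφ, tw_tw]
  rwa [e] at h

lemma sgn_mem_homog (n : ℕ) {i : ℤ} {x : Tot V} (h : x ∈ homog V i) : sgn V n x ∈ homog V i := by
  obtain ⟨y, rfl⟩ := h
  rw [sgn_el]
  exact Submodule.smul_mem _ _ ⟨y, rfl⟩

lemma blockMap_homog (f : Ops V W 1) (s : List (List (Σ i : ℤ, V i))) :
    ∃ l' : List (Σ i : ℤ, W i),
      blockMap f.op (s.map (List.map fun a => el V a.1 a.2)) = l'.map (fun a => el W a.1 a.2) ∧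
      l'.length = s.length ∧
      (l'.map Sigma.fst).sum = (s.flatten.map Sigma.fst).sum + s.length - s.flatten.length := by
  induction s with
  | nil => exact ⟨[], by simp [blockMap]⟩
  | cons B s ih =>
    obtain ⟨l', h1, h2, h3⟩ := ih
    have hm : f.op ((B.map fun a => el V a.1 a.2).map
        (sgn V (blockDeg (s.map (List.map fun a => el V a.1 a.2))))) ∈
        homog W ((B.map Sigma.fst).sum + 1 - B.length) := by
      rw [f.sgn_comm]
      exact Submodule.smul_mem _ _ (sgn_mem_homog _ (f.degree B))
    obtain ⟨y, hy⟩ := hm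
    refine ⟨⟨_, y⟩ :: l', ?_, by simp [h2], ?_⟩
    · simp only [List.map_cons, blockMap, h1, hy]
    · simp only [List.map_cons, List.sum_cons, h3, List.flatten_cons, List.map_append,
        List.sum_append, List.length_cons, List.length_append]
      push_cast
      ring

/-- The family of multilinear maps given by `blockSum`. -/
def Ops.comp {c : ℤ} (f : Ops V W 1) (φ : Ops W X c) : Ops V X c where
  op := blockSum f.op φ.op
  nil := by simp [blockSum, parts, blockSign, blockMap, φ.nil]
  multilin := multilin_blockSum f φ.multilin
  degree l := by
    unfold blockSum
    rw [parts_map, lsum_map]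
    have : ∀ s ∈ parts l, (-1 : k) ^ blockSign (s.map (List.map fun a => el V a.1 a.2)) •
        φ.op (blockMap f.op (s.map (List.map fun a => el V a.1 a.2))) ∈
        homog X ((l.map Sigma.fst).sum + c - l.length) := by
      intro s hs
      obtain ⟨l', h1, h2, h3⟩ := blockMap_homog f s
      rw [h1]
      have h4 := φ.degree l'
      rw [h2, h3, (mem_parts hs).1] at h4
      refine Submodule.smul_mem _ _ ?_
      convert h4 using 2
      ring
    generalize parts l = L at this
    induction L with
    | nil => simp
    | cons s L ih =>
      rw [lsum_cons]
      exact Submodule.add_mem _ (this s (by simp)) (ih fun s hs => this s (by simp [hs]))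

end Bar

/-! ### `A_∞`-algebras and `∞`-morphisms -/

/-- An `A_∞`-algebra structure on a graded vector space: maps `m_n : V^{⊗ n} → V` of
cohomological degree `2 - n` for `n ≥ 1` such that, for all `n`,
`∑_{p + q + r = n} (-1)^{p + q r} m_{p + 1 + r} ∘ (id^{⊗ p} ⊗ m_q ⊗ id^{⊗ r}) = 0`. -/
structure AInfStr (V : GrVect k) extends Ops V V 2 where
  rel : ∀ l, insertSum op op l = 0

/-- An `A_∞`-algebra over `k`. -/
structure AInfAlg (k : Type u) [Field k] where
  V : GrVect k
  str : AInfStr V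

/-- An `∞`-morphism of `A_∞`-algebras: maps `f_n : A^{⊗ n} → B` of cohomological degree `1 - n`
for `n ≥ 1` such that, for all `n`,
`∑_{p + q + r = n} (-1)^{p + q r} f_{p + 1 + r} ∘ (id^{⊗ p} ⊗ m_q^A ⊗ id^{⊗ r}) =
  ∑_{i_1 + ⋯ + i_j = n} (-1)^ε m_j^B ∘ (f_{i_1} ⊗ ⋯ ⊗ f_{i_j})`.
(The terms with `q = 1` and with `j = 1` make up `-∂(f_n)`, up to moving them to one side.) -/
structure AInfHom (A B : AInfAlg k) extends Ops A.V B.V 1 where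
  rel : ∀ l, insertSum A.str.op op l = blockSum op B.str.op l

section Category

variable {A B C D : AInfAlg k}

lemma AInfHom.ext {f g : AInfHom A B} (h : f.op = g.op) : f = g := by
  obtain ⟨f, hf⟩ := f
  obtain ⟨g, hg⟩ := g
  obtain rfl : f = g := Ops.ext h
  rfl

lemma Ops.ssgn_comm {V W : GrVect k} (f : Ops V W 1) (l : List (Tot V)) :
    f.op (tw V (l.map (ssgn V))) = ssgn W (f.op (tw V l)) := by
  have e1 : tw V (l.map (ssgn V)) = ((tw V l).map (sgn V 1)).map (fun x => (-1 : k) • x) := by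
    rw [map_ssgn, ← tw_map_sgn]
    generalize l.map (sgn V 1) = q
    induction q with
    | nil => rfl
    | cons a q ih => simp only [List.map_cons, tw, ih, List.length_map, map_smul]
  have e2 := f.multilin.smul_map_const [] [] ((tw V l).map (sgn V 1)) (-1 : k)
  simp only [List.nil_append, List.append_nil] at e2
  rw [e1, e2, f.sgn_comm, smul_smul, ← pow_add]
  rw [neg_one_pow_congr (b := 1)]
  · simp [ssgn]
  · simp only [List.length_map, length_tw, Nat.even_add, Nat.even_mul, Nat.not_even_one,
      Int.natAbs_one]
    tauto

lemma AInfHom.bar_rel (f : AInfHom A B) (l : List (Tot A.V)) :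
    barInsert (fun l => A.str.op (tw A.V l)) (fun l => f.op (tw A.V l)) l =
      barBlock (fun l => f.op (tw A.V l)) (fun l => B.str.op (tw B.V l)) l := by
  rw [← insertSum_tw A.str.toOps f.multilin, ← blockSum_tw f.toOps B.str.multilin, f.rel]

/-- The composite of `f : A ⇝ B` and `g : B ⇝ C`, given by
`∑ (-1)^ε g_j ∘ (f_{i_1} ⊗ ⋯ ⊗ f_{i_j})`. -/
def AInfHom.comp (f : AInfHom A B) (g : AInfHom B C) : AInfHom A C where
  toOps := Ops.comp f.toOps g.toOps
  rel l := by
    obtain ⟨l, rfl⟩ := tw_surjective l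
    have e1 : (fun l => (Ops.comp f.toOps g.toOps).op (tw A.V l)) =
        barBlock (fun l => f.op (tw A.V l)) (fun l => g.op (tw B.V l)) := by
      funext l
      exact blockSum_tw f.toOps g.multilin l
    rw [insertSum_tw A.str.toOps (Ops.comp f.toOps g.toOps).multilin,
      blockSum_tw (Ops.comp f.toOps g.toOps) C.str.multilin, e1,
      barInsert_barBlock f.bar_rel f.toOps.ssgn_comm g.multilin.comp_tw,
      ← barBlock_assoc _ _ C.str.multilin.comp_tw]
    exact congrArg (fun φ => barBlock _ φ l) (funext g.bar_rel)

lemma blockSum_strict {V W : GrVect k} (f : Ops V W 1) (hf : ∀ x y l, f.op (x :: y :: l) = 0)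
    {M : Type*} [AddCommGroup M] [Module k M] {φ : List (Tot W) → M} (hφ : Multilin k φ)
    (l : List (Tot V)) : blockSum f.op φ l = φ (l.map fun x => f.op [x]) := by
  obtain ⟨l, rfl⟩ := tw_surjective l
  rw [blockSum_tw f hφ, barBlock_strict (by simp [tw, hf]) hφ.comp_tw]
  congr 1
  induction l with
  | nil => rfl
  | cons a l ih =>
    have ih' : tw W (l.map fun x => f.op [x]) = (tw V l).map fun x => f.op [x] := by
      simpa [tw] using ih
    simp only [List.map_cons, tw, ih', List.length_map, List.length_nil, sgn_zero,
      LinearMap.id_apply]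
    congr 1
    have := f.sgn_comm l.length [a]
    simp only [List.map_cons, List.map_nil] at this
    rw [this, Even.neg_one_pow, one_smul]
    simp

/-- A linear map of degree `0` as a family of multilinear maps concentrated in arity `1`. -/
def Ops.ofLinear {V W : GrVect k} (f : Tot V →ₗ[k] Tot W)
    (hf : ∀ i x, f (el V i x) ∈ homog W i) : Ops V W 1 where
  op
    | [x] => f x
    | _ => 0
  nil := rfl
  multilin := by
    constructor
    · intro p x y r
      rcases p with _ | ⟨a, p⟩
      · cases r <;> simp
      · cases p <;> simp
    · intro p c x r
      rcases p with _ | ⟨a, p⟩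
      · cases r <;> simp
      · cases p <;> simp
  degree l := by
    rcases l with _ | ⟨a, _ | ⟨b, l⟩⟩
    · simp
    · simpa using hf a.1 a.2
    · simp

lemma Ops.ofLinear_single {V W : GrVect k} (f : Tot V →ₗ[k] Tot W)
    (hf : ∀ i x, f (el V i x) ∈ homog W i) (x : Tot V) : (Ops.ofLinear f hf).op [x] = f x := rfl

lemma Ops.ofLinear_cons_cons {V W : GrVect k} (f : Tot V →ₗ[k] Tot W)
    (hf : ∀ i x, f (el V i x) ∈ homog W i) (x y : Tot V) (l : List (Tot V)) :
    (Ops.ofLinear f hf).op (x :: y :: l) = 0 := rfl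

lemma insertSum_strict {V W : GrVect k} (m : Ops V V 2) (f : Ops V W 1)
    (hf : ∀ x y l, f.op (x :: y :: l) = 0) (l : List (Tot V)) :
    insertSum m.op f.op l = f.op [m.op l] := by
  have hz : ∀ (p r : List (Tot V)) (x : Tot V), p ≠ [] → f.op (p ++ x :: r) = 0 := by
    intro p r x hp
    obtain ⟨a, p, rfl⟩ := List.exists_cons_of_ne_nil hp
    cases p <;> simp [hf]
  have hlast : ∀ l : List (Tot V), (lsum (splits l) fun t =>
      (-1 : k) ^ (t.1.length * t.2.length) • f.op (m.op t.1 :: t.2)) = f.op [m.op l] := by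
    intro l
    have : ∀ (q l : List (Tot V)), (lsum (splits l) fun t =>
      (-1 : k) ^ ((q ++ t.1).length * t.2.length) • f.op (m.op (q ++ t.1) :: t.2)) =
        f.op [m.op (q ++ l)] := by
      intro q l
      induction l generalizing q with
      | nil => simp [splits]
      | cons a l ih =>
        simp only [splits, lsum_cons, lsum_map, hf, smul_zero, zero_add]
        simpa using ih (q ++ [a])
    simpa using this [] l
  have h0 : ∀ (p : List (Tot V)) (x : Tot V) (r : List (Tot V)), p ≠ [] →
      ∀ n, f.op (p.map (sgn V n) ++ x :: r) = 0 := fun p x r hp n => hz _ _ _ (by simpa using hp)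
  unfold insertSum
  cases l with
  | nil => simp [splits]
  | cons a l =>
    have := hlast (a :: l)
    rw [splits, lsum_cons, lsum_map]
    have hr : ∀ s ∈ splits l, (lsum (splits s.2) fun t =>
        (-1 : k) ^ ((a :: s.1).length + t.1.length * t.2.length) •
          f.op ((a :: s.1).map (sgn V t.1.length) ++ m.op t.1 :: t.2)) = 0 := by
      intro s _
      simp only [h0 (a :: s.1) _ _ (by simp), smul_zero, lsum_zero]
    rw [lsum_congr hr, lsum_zero, add_zero, ← this]
    simp

/-- The `∞`-morphism given by a strict morphism of `A_∞`-algebras. -/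
def AInfHom.ofStrict (f : Tot A.V →ₗ[k] Tot B.V) (hf : ∀ i x, f (el A.V i x) ∈ homog B.V i)
    (hm : ∀ l, f (A.str.op l) = B.str.op (l.map f)) : AInfHom A B where
  toOps := Ops.ofLinear f hf
  rel l := by
    rw [insertSum_strict _ _ (Ops.ofLinear_cons_cons f hf),
      blockSum_strict _ (Ops.ofLinear_cons_cons f hf) B.str.multilin]
    exact hm l

/-- The identity `∞`-morphism. -/
def AInfHom.id (A : AInfAlg k) : AInfHom A A :=
  AInfHom.ofStrict LinearMap.id (fun _ x => ⟨x, rfl⟩) (by simp)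

lemma lsum_parts_single {α M : Type*} [AddCommMonoid M] {Ψ : List (List α) → M}
    (h : ∀ B C s, Ψ (B :: C :: s) = 0) (a : α) (l : List α) :
    lsum (parts (a :: l)) Ψ = Ψ [a :: l] := by
  induction l generalizing a Ψ with
  | nil => simp [parts]
  | cons b l ih =>
    rw [lsum_parts_cons, ih]
    · simp [h]
    · intro B C s
      simp [h]

/-- The category of `A_∞`-algebras and `∞`-morphisms. -/
instance : Category (AInfAlg k) where
  Hom A B := AInfHom A B
  id A := AInfHom.id A
  comp f g := AInfHom.comp f g
  id_comp {A B} f := AInfHom.ext (funext fun l => by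
    refine (blockSum_strict (AInfHom.id A).toOps (fun _ _ _ => rfl) f.multilin l).trans ?_
    exact congrArg f.op (List.map_id l))
  comp_id {A B} f := AInfHom.ext (funext fun l => by
    change blockSum f.op (AInfHom.id B).op l = f.op l
    unfold blockSum
    cases l with
    | nil => simp [parts, blockSign, blockMap, f.nil, (AInfHom.id B).nil]
    | cons a l =>
      rw [lsum_parts_single]
      · simp [blockSign, blockMap, blockDeg]
        rfl
      · intro B' C s
        have : ∀ (x y : Tot B.V) (r : List (Tot B.V)), (AInfHom.id B).op (x :: y :: r) = 0 :=
          fun _ _ _ => rfl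
        simp [blockMap, this])
  assoc {A B C D} f g h := AInfHom.ext (funext fun l => by
    obtain ⟨l, rfl⟩ := tw_surjective l
    change blockSum (f.comp g).op h.op (tw _ l) = blockSum f.op (g.comp h).op (tw _ l)
    rw [blockSum_tw (f.comp g).toOps h.multilin, blockSum_tw f.toOps (g.comp h).multilin]
    have e1 : (fun l => (f.comp g).op (tw A.V l)) =
        barBlock (fun l => f.op (tw A.V l)) (fun l => g.op (tw B.V l)) :=
      funext fun l => blockSum_tw f.toOps g.multilin l
    have e2 : (fun l => (g.comp h).op (tw B.V l)) =
        barBlock (fun l => g.op (tw B.V l)) (fun l => h.op (tw C.V l)) :=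
      funext fun l => blockSum_tw g.toOps h.multilin l
    rw [e1, e2]
    exact (barBlock_assoc _ _ h.multilin.comp_tw l).symm)

end Category

/-! ### Cohomology and the homotopy category -/

section Cohomology

lemma el_component {V : GrVect k} {i : ℤ} {z : Tot V} (h : z ∈ homog V i) :
    el V i (DirectSum.component k ℤ (fun i => V i) i z) = z := by
  obtain ⟨y, rfl⟩ := h
  rw [DirectSum.component.lof_self]

lemma component_eq_zero {V : GrVect k} {i j : ℤ} {z : Tot V} (h : z ∈ homog V i) (hij : i ≠ j) :
    DirectSum.component k ℤ (fun i => V i) j z = 0 := by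
  obtain ⟨y, rfl⟩ := h
  rw [DirectSum.component.of, dif_neg hij]

/-- The unary operation, as a linear map. -/
def Ops.one {V W : GrVect k} {c : ℤ} (f : Ops V W c) : Tot V →ₗ[k] Tot W := f.multilin.slot [] []

lemma Ops.one_apply {V W : GrVect k} {c : ℤ} (f : Ops V W c) (x : Tot V) : f.one x = f.op [x] :=
  rfl

lemma Ops.one_degree {V W : GrVect k} {c : ℤ} (f : Ops V W c) {i : ℤ} {x : Tot V}
    (h : x ∈ homog V i) : f.one x ∈ homog W (i + c - 1) := by
  obtain ⟨y, rfl⟩ := h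
  simpa [Ops.one_apply] using f.degree [⟨i, y⟩]

lemma AInfStr.one_one {V : GrVect k} (m : AInfStr V) (x : Tot V) : m.one (m.one x) = 0 := by
  have h := m.rel [x]
  have h1 : ∀ y, m.op [0, y] = 0 := fun y => m.multilin.zero [] [y]
  have h2 : ∀ y, m.op [y, 0] = 0 := fun y => m.multilin.zero [y] []
  simpa [insertSum, splits, m.nil, h1, h2, Ops.one_apply] using h

lemma AInfHom.one_comm {A B : AInfAlg k} (f : AInfHom A B) (x : Tot A.V) :
    f.one (A.str.one x) = B.str.one (f.one x) := by
  have h := f.rel [x]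
  have h1 : ∀ y, f.op [0, y] = 0 := fun y => f.multilin.zero [] [y]
  have h2 : ∀ y, f.op [y, 0] = 0 := fun y => f.multilin.zero [y] []
  simpa [insertSum, splits, A.str.nil, h1, h2, Ops.one_apply, blockSum, parts, blockSign, blockMap,
    blockDeg] using h

lemma AInfHom.one_comp {A B C : AInfAlg k} (f : AInfHom A B) (g : AInfHom B C) (x : Tot A.V) :
    (f.comp g).one x = g.one (f.one x) := by
  change blockSum f.op g.op [x] = g.op [f.op [x]]
  simp [blockSum, parts, blockSign, blockMap, blockDeg]

/-- The underlying cochain complex `(A, m_1)` of an `A_∞`-algebra. -/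
noncomputable def AInfAlg.complex (A : AInfAlg k) : CochainComplex (ModuleCat.{u} k) ℤ where
  X := A.V
  d i j := ModuleCat.ofHom (DirectSum.component k ℤ (fun i => A.V i) j ∘ₗ A.str.one ∘ₗ el A.V i)
  shape i j hij := by
    ext x
    have h := A.str.one_degree (x := el A.V i x) ⟨x, rfl⟩
    exact component_eq_zero h (fun e => hij (by simp; lia))
  d_comp_d' i j l hij hjl := by
    ext x
    have h := A.str.one_degree (x := el A.V i x) ⟨x, rfl⟩
    have e : i + 2 - 1 = j := by simp at hij; lia
    rw [e] at h
    simp only [ModuleCat.hom_comp, ModuleCat.hom_ofHom, LinearMap.comp_apply]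
    rw [el_component h, AInfStr.one_one]
    simp

/-- The chain map `f_1` underlying an `∞`-morphism. -/
noncomputable def AInfHom.chainMap {A B : AInfAlg k} (f : AInfHom A B) :
    A.complex ⟶ B.complex where
  f i := ModuleCat.ofHom (DirectSum.component k ℤ (fun i => B.V i) i ∘ₗ f.one ∘ₗ el A.V i)
  comm' i j hij := by
    ext x
    have e : i + 2 - 1 = j := by simp at hij; lia
    have e' : i + 1 - 1 = i := by lia
    have e'' : j + 1 - 1 = j := by lia
    have h1 := A.str.one_degree (x := el A.V i x) ⟨x, rfl⟩
    have h2 := f.one_degree (x := el A.V i x) ⟨x, rfl⟩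
    rw [e] at h1
    rw [e'] at h2
    change DirectSum.component k ℤ (fun i => B.V i) j (B.str.one (el B.V i
        (DirectSum.component k ℤ (fun i => B.V i) i (f.one (el A.V i x))))) =
      DirectSum.component k ℤ (fun i => B.V i) j (f.one (el A.V j
        (DirectSum.component k ℤ (fun i => A.V i) j (A.str.one (el A.V i x)))))
    rw [el_component h1, el_component h2, AInfHom.one_comm]

/-- The functor sending an `A_∞`-algebra to its underlying cochain complex. -/
noncomputable def complexFunctor (k : Type u) [Field k] :
    AInfAlg k ⥤ CochainComplex (ModuleCat.{u} k) ℤ where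
  obj A := A.complex
  map f := AInfHom.chainMap f
  map_id A := by
    ext i x
    exact DirectSum.component.lof_self k (M := fun i => A.V i) i x
  map_comp {A B C} f g := by
    ext i x
    have h := f.one_degree (x := el A.V i x) ⟨x, rfl⟩
    rw [show i + 1 - 1 = i by lia] at h
    change DirectSum.component k ℤ (fun i => C.V i) i ((AInfHom.comp f g).one (el A.V i x)) =
      DirectSum.component k ℤ (fun i => C.V i) i (g.one (el B.V i
        (DirectSum.component k ℤ (fun i => B.V i) i (f.one (el A.V i x)))))
    rw [el_component h, AInfHom.one_comp]

/-- The cohomology functor `A ↦ H^*(A, m_1)` from `A_∞`-algebras to graded vector spaces. -/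
noncomputable def cohomology (k : Type u) [Field k] : AInfAlg k ⥤ GrVect k :=
  complexFunctor k ⋙ HomologicalComplex.gradedHomologyFunctor (ModuleCat.{u} k) (ComplexShape.up ℤ)

/-- The `∞`-quasi-isomorphisms: the `∞`-morphisms `f` such that `f_1` is a quasi-isomorphism. -/
def infQuasiIso (k : Type u) [Field k] : MorphismProperty (AInfAlg k) :=
  fun _ _ f => QuasiIso ((complexFunctor k).map f)

/-- The homotopy category of `A_∞`-algebras: the localization of the category of `A_∞`-algebras
and `∞`-morphisms at the `∞`-quasi-isomorphisms. -/
abbrev Ho (k : Type u) [Field k] := (infQuasiIso k).Localization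

/-- The localization functor. -/
abbrev toHo (k : Type u) [Field k] : AInfAlg k ⥤ Ho k := (infQuasiIso k).Q

lemma cohomology_inverts (k : Type u) [Field k] :
    (infQuasiIso k).IsInvertedBy (cohomology k) := by
  intro A B f hf
  have hf' : QuasiIso ((complexFunctor k).map f) := hf
  have : ∀ i, IsIso ((cohomology k).map f i) := fun i => by
    have : QuasiIsoAt ((complexFunctor k).map f) i := inferInstance
    exact (quasiIsoAt_iff_isIso_homologyMap _ i).1 this
  exact (isIso_pi_iff _).2 this

/-- The forgetful functor from the homotopy category of `A_∞`-algebras to graded vector spaces: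
the functor induced by cohomology (an `A_∞`-algebra with `m_1 = 0` is its own cohomology). -/
noncomputable def forgetHo (k : Type u) [Field k] : Ho k ⥤ GrVect k :=
  Localization.Construction.lift (cohomology k) (cohomology_inverts k)

end Cohomology

/-! ### Differential graded algebras and transfer data -/

/-- A (cohomologically graded, not necessarily unital) differential graded associative algebra. -/
structure DGAlg (k : Type u) [Field k] where
  V : GrVect k
  d : Tot V →ₗ[k] Tot V
  mul : Tot V →ₗ[k] Tot V →ₗ[k] Tot V
  d_degree : ∀ i x, d (el V i x) ∈ homog V (i + 1)
  mul_degree : ∀ i j x y, mul (el V i x) (el V j y) ∈ homog V (i + j)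
  d_d : ∀ x, d (d x) = 0
  /-- `d (x y) = (d x) y + (-1)^{|x|} x (d y)` -/
  leibniz : ∀ x y, d (mul x y) = mul (d x) y + mul (sgn V 1 x) (d y)
  assoc : ∀ x y z, mul (mul x y) z = mul x (mul y z)

/-- A morphism of differential graded algebras. -/
structure DGHom (A B : DGAlg k) where
  f : Tot A.V →ₗ[k] Tot B.V
  degree : ∀ i x, f (el A.V i x) ∈ homog B.V i
  comm : ∀ x, f (A.d x) = B.d (f x)
  map_mul : ∀ x y, f (A.mul x y) = B.mul (f x) (f y)

lemma mem_homog_of_degree {V W : GrVect k} {f : Tot V →ₗ[k] Tot W} {e : ℤ → ℤ}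
    (hf : ∀ i x, f (el V i x) ∈ homog W (e i)) {i : ℤ} {x : Tot V} (h : x ∈ homog V i) :
    f x ∈ homog W (e i) := by
  obtain ⟨y, rfl⟩ := h
  exact hf i y

lemma DGHom.ext {A B : DGAlg k} {g h : DGHom A B} (e : g.f = h.f) : g = h := by
  cases g; cases h; cases e; rfl

/-- The category of differential graded algebras. -/
instance : Category (DGAlg k) where
  Hom A B := DGHom A B
  id A := ⟨LinearMap.id, fun _ x => ⟨x, rfl⟩, fun _ => rfl, fun _ _ => rfl⟩
  comp g h := ⟨h.f ∘ₗ g.f, fun i x => mem_homog_of_degree (e := fun i => i) h.degree (g.degree i x),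
    by simp [g.comm, h.comm], by simp [g.map_mul, h.map_mul]⟩

/-- The operations `m_1 = d`, `m_2 = ` product, and `m_n = 0` for `n ≥ 3`. -/
def DGAlg.op (A : DGAlg k) : List (Tot A.V) → Tot A.V
  | [x] => A.d x
  | [x, y] => A.mul x y
  | _ => 0

lemma DGAlg.op_nil (A : DGAlg k) : A.op [] = 0 := rfl
lemma DGAlg.op_one (A : DGAlg k) (x : Tot A.V) : A.op [x] = A.d x := rfl
lemma DGAlg.op_two (A : DGAlg k) (x y : Tot A.V) : A.op [x, y] = A.mul x y := rfl
lemma DGAlg.op_three (A : DGAlg k) (x y z : Tot A.V) (l : List (Tot A.V)) :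
    A.op (x :: y :: z :: l) = 0 := rfl

lemma DGAlg.op_of_length (A : DGAlg k) {l : List (Tot A.V)} (h : 3 ≤ l.length) : A.op l = 0 := by
  rcases l with _ | ⟨a, _ | ⟨b, _ | ⟨c, l⟩⟩⟩
  · simp at h
  · simp at h
  · simp at h
  · rfl

lemma DGAlg.multilin_op (A : DGAlg k) : Multilin k A.op := by
  constructor
  · intro p x y r
    rcases p with _ | ⟨a, _ | ⟨b, p⟩⟩
    · rcases r with _ | ⟨c, _ | ⟨d, r⟩⟩ <;> simp [op_one, op_two, op_three]
    · cases r <;> simp [op_two, op_three]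
    · cases p <;> simp [op_three]
  · intro p c x r
    rcases p with _ | ⟨a, _ | ⟨b, p⟩⟩
    · rcases r with _ | ⟨c, _ | ⟨d, r⟩⟩ <;> simp [op_one, op_two, op_three]
    · cases r <;> simp [op_two, op_three]
    · cases p <;> simp [op_three]

lemma DGAlg.op_rel (A : DGAlg k) (l : List (Tot A.V)) : insertSum A.op A.op l = 0 := by
  rcases l with _ | ⟨a, _ | ⟨b, _ | ⟨c, _ | ⟨d, l⟩⟩⟩⟩
  · simp [insertSum, splits, op_nil, op_one]
  · simp [insertSum, splits, op_nil, op_one, op_two, A.d_d]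
  · simp [insertSum, splits, op_nil, op_one, op_two, op_three, A.leibniz]
  · simp [insertSum, splits, op_nil, op_one, op_two, op_three, A.assoc,
      sgn_even A.V (a := 2) (by decide)]
  · have hl : 4 ≤ (a :: b :: c :: d :: l).length := by simp
    generalize a :: b :: c :: d :: l = L at hl
    have : ∀ s ∈ splits L, (lsum (splits s.2) fun t =>
        (-1 : k) ^ (s.1.length + t.1.length * t.2.length) •
          A.op (s.1.map (sgn A.V t.1.length) ++ A.op t.1 :: t.2)) = 0 := by
      intro s hs
      rw [← lsum_zero (splits s.2)]
      refine lsum_congr fun t ht => ?_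
      have h1 := congrArg List.length (mem_splits hs)
      have h2 := congrArg List.length (mem_splits ht)
      rw [List.length_append] at h1 h2
      by_cases h : t.1.length = 0 ∨ 3 ≤ t.1.length
      · have h0 : A.op t.1 = 0 := by
          rcases h with h | h
          · rw [List.length_eq_zero_iff.1 h, op_nil]
          · exact A.op_of_length h
        rw [h0, A.multilin_op.zero, smul_zero]
      · rw [A.op_of_length (by simp; omega), smul_zero]
    unfold insertSum
    rw [lsum_congr this, lsum_zero]

/-- A differential graded algebra as an `A_∞`-algebra. -/
def DGAlg.aInf (A : DGAlg k) : AInfAlg k where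
  V := A.V
  str :=
    { op := A.op
      nil := rfl
      multilin := A.multilin_op
      degree := by
        intro l
        rcases l with _ | ⟨a, _ | ⟨b, _ | ⟨c, l⟩⟩⟩
        · simp [DGAlg.op_nil]
        · have := A.d_degree a.1 a.2
          have e : ([a].map Sigma.fst).sum + 2 - ([a].length : ℤ) = a.1 + 1 := by simp; ring
          rw [e]
          exact this
        · have := A.mul_degree a.1 b.1 a.2 b.2
          have e : ([a, b].map Sigma.fst).sum + 2 - ([a, b].length : ℤ) = a.1 + b.1 := by simp
          rw [e]
          exact this
        · simp [DGAlg.op_three]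
      rel := A.op_rel }

/-- A morphism of differential graded algebras as an `∞`-morphism. -/
def DGHom.aInf {A B : DGAlg k} (g : DGHom A B) : AInfHom A.aInf B.aInf :=
  AInfHom.ofStrict g.f g.degree (by
    intro l
    rcases l with _ | ⟨a, _ | ⟨b, _ | ⟨c, l⟩⟩⟩
    · exact map_zero g.f
    · exact g.comm a
    · exact g.map_mul a b
    · exact map_zero g.f)

/-- The inclusion of differential graded algebras into `A_∞`-algebras. -/
def dgToAInf (k : Type u) [Field k] : DGAlg k ⥤ AInfAlg k where
  obj A := A.aInf
  map g := DGHom.aInf g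
  map_id A := rfl
  map_comp {A B C} g h := AInfHom.ext (funext fun l => by
    refine Eq.trans ?_ (blockSum_strict (DGHom.aInf g).toOps (fun _ _ _ => rfl)
      (DGHom.aInf h).multilin l).symm
    rcases l with _ | ⟨a, _ | ⟨b, l⟩⟩ <;> rfl)

/-- A contraction of the underlying complex of `A` onto a graded vector space `H` with zero
differential. -/
structure Contraction (A : DGAlg k) where
  H : GrVect k
  i : Tot H →ₗ[k] Tot A.V
  p : Tot A.V →ₗ[k] Tot H
  h : Tot A.V →ₗ[k] Tot A.V
  i_degree : ∀ n x, i (el H n x) ∈ homog A.V n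
  p_degree : ∀ n x, p (el A.V n x) ∈ homog H n
  h_degree : ∀ n x, h (el A.V n x) ∈ homog A.V (n - 1)
  d_i : ∀ x, A.d (i x) = 0
  p_d : ∀ x, p (A.d x) = 0
  homotopy : ∀ x, i (p x) - x = A.d (h x) + h (A.d x)
  p_i : ∀ x, p (i x) = x
  h_i : ∀ x, h (i x) = 0
  p_h : ∀ x, p (h x) = 0
  h_h : ∀ x, h (h x) = 0

/-- A transfer datum `(A, H, i, p, h)`. -/
structure TransDatum (k : Type u) [Field k] where
  A : DGAlg k
  c : Contraction A

/-- The category of transfer data, whose morphisms are the morphisms of differential graded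
algebras `A ⟶ A'`; no compatibility with the contractions is required. -/
instance : Category (TransDatum k) where
  Hom D D' := D.A ⟶ D'.A
  id D := 𝟙 D.A
  comp f g := CategoryStruct.comp (obj := DGAlg k) f g
  id_comp f := Category.id_comp (obj := DGAlg k) f
  comp_id f := Category.comp_id (obj := DGAlg k) f
  assoc f g h := Category.assoc (obj := DGAlg k) f g h

/-- The functor `(A, H, i, p, h) ↦ A`. -/
def transForget (k : Type u) [Field k] : TransDatum k ⥤ DGAlg k where
  obj D := D.A
  map f := f

/-- A copersistent object of `Trans` has finitely many changes if there are finitely many classes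
of real numbers for the relation "the structure morphism is an isomorphism". -/
def HasFinitelyManyChanges (k : Type u) [Field k] : ObjectProperty (ℝᵒᵖ ⥤ TransDatum k) :=
  fun X => Finite (Quot fun r s : ℝ => ∃ h : r ≤ s, IsIso (X.map (homOfLE h).op))

/-- Copersistent transfer data with finitely many changes. -/
abbrev FTrans (k : Type u) [Field k] := (HasFinitelyManyChanges k).FullSubcategory

/-- The persistent cohomology `r ↦ H^*(A^r)` of copersistent transfer data. -/
noncomputable def persistentCohomology (k : Type u) [Field k] : FTrans k ⥤ (ℝᵒᵖ ⥤ GrVect k) :=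
  (HasFinitelyManyChanges k).ι ⋙ (Functor.whiskeringRight _ _ _).obj
    (transForget k ⋙ dgToAInf k ⋙ cohomology k)

/-- `λ_n = ∑_{s + t = n} (-1)^{s + 1} μ ∘ (f_s ⊗ f_t)` evaluated on a list of length `n`, where
`μ` is the product of `A` and `f_t` has degree `1 - t`. -/
def transferKernel {A : DGAlg k} {H : GrVect k} (f : List (Tot H) → Tot A.V)
    (l : List (Tot H)) : Tot A.V :=
  lsum (splits l) fun s => (-1 : k) ^ (s.1.length + 1) •
    A.mul (f (s.1.map (sgn H (s.2.length + 1)))) (f s.2)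

/-- `m` is the homotopy transferred `A_∞`-structure on `H` and `f` is the corresponding extension
of `i` to an `∞`-morphism: `m_1 = 0`, `f_1 = i`, and, for `n ≥ 2`, `m_n = p ∘ λ_n` and
`f_n = h ∘ λ_n`, where `λ_n = ∑_{s + t = n} (-1)^{s + 1} μ ∘ (f_s ⊗ f_t)`. This is the recursive
form of the sum over planar binary trees with leaves labelled by `i`, vertices by `μ`, internal
edges by `h` and root by `p` (resp. `h`). -/
structure IsTransferred (D : TransDatum k) (m : AInfStr D.c.H)
    (f : (⟨D.c.H, m⟩ : AInfAlg k) ⟶ (dgToAInf k).obj D.A) : Prop where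
  m_one : ∀ x, m.op [x] = 0
  f_one : ∀ x, (AInfHom.toOps f).op [x] = D.c.i x
  m_op : ∀ x y l, m.op (x :: y :: l) =
    D.c.p (transferKernel (A := D.A) (AInfHom.toOps f).op (x :: y :: l))
  f_op : ∀ x y l, (AInfHom.toOps f).op (x :: y :: l) =
    D.c.h (transferKernel (A := D.A) (AInfHom.toOps f).op (x :: y :: l))

/-! ### Cochains of `Δ`-complexes -/

section Cochains

open Opposite Simplicial

/-- The category of `Δ`-complexes, i.e. of semi-simplicial sets. -/
abbrev DeltaComplex := SemiSimplexCategoryᵒᵖ ⥤ Type u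

/-- The `n`-simplices of a `Δ`-complex. -/
abbrev simplices (S : DeltaComplex.{u}) (n : ℕ) : Type u := S.obj (op ⦋n⦌ₛ)

/-- The face of an `n`-simplex whose vertices are given by an increasing map. -/
def face (S : DeltaComplex.{u}) {m n : ℕ} (e : Fin (m + 1) ↪o Fin (n + 1)) (x : simplices S n) :
    simplices S m :=
  S.map (SemiSimplexCategory.homEquiv.symm e : ⦋m⦌ₛ ⟶ ⦋n⦌ₛ).op x

lemma face_face (S : DeltaComplex.{u}) {l m n : ℕ} (e : Fin (l + 1) ↪o Fin (m + 1))
    (e' : Fin (m + 1) ↪o Fin (n + 1)) (x : simplices S n) :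
    face S e (face S e' x) = face S (e.trans e') x := by
  unfold face
  have h : (SemiSimplexCategory.homEquiv.symm e : ⦋l⦌ₛ ⟶ ⦋m⦌ₛ) ≫
      (SemiSimplexCategory.homEquiv.symm e' : ⦋m⦌ₛ ⟶ ⦋n⦌ₛ) =
      SemiSimplexCategory.homEquiv.symm (e.trans e') := by
    apply SemiSimplexCategory.hom_ext
    simp
  rw [← ConcreteCategory.comp_apply, ← S.map_comp, ← op_comp, h]

lemma face_naturality {S T : DeltaComplex.{u}} (g : S ⟶ T) {m n : ℕ}
    (e : Fin (m + 1) ↪o Fin (n + 1)) (x : simplices S n) :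
    g.app (op ⦋m⦌ₛ) (face S e x) = face T e (g.app (op ⦋n⦌ₛ) x) := by
  unfold face
  rw [← ConcreteCategory.comp_apply, g.naturality, ConcreteCategory.comp_apply]

/-- The increasing map onto the first `m + 1` vertices. -/
def frontEmb {m n : ℕ} (h : m ≤ n) : Fin (m + 1) ↪o Fin (n + 1) :=
  Fin.castLEOrderEmb (Nat.succ_le_succ h)

/-- The increasing map onto the last `m + 1` vertices. -/
def backEmb {m n : ℕ} (h : m ≤ n) : Fin (m + 1) ↪o Fin (n + 1) :=
  OrderEmbedding.ofStrictMono (fun i => ⟨n - m + i, by omega⟩) (fun i j hij => by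
    simp only [Fin.lt_def] at hij ⊢; omega)

lemma frontEmb_val {m n : ℕ} (h : m ≤ n) (i : Fin (m + 1)) : (frontEmb h i : ℕ) = i := rfl

lemma backEmb_val {m n : ℕ} (h : m ≤ n) (i : Fin (m + 1)) : (backEmb h i : ℕ) = n - m + i := rfl

/-- The cochains of degree `i` of a `Δ`-complex: the functions on the set of simplices of
dimension `i` (so `0` if `i < 0`). -/
abbrev Cochain (k : Type u) (S : DeltaComplex.{u}) (i : ℤ) : Type u :=
  ∀ n : {n : ℕ // (n : ℤ) = i}, simplices S n.1 → k

variable (k) (S : DeltaComplex.{u})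

/-- The coboundary `(d φ)(x) = ∑_j (-1)^j φ (d_j x)`. -/
def coboundary (i : ℤ) : Cochain k S i →ₗ[k] Cochain k S (i + 1) where
  toFun φ n x := match n, x with
    | ⟨0, _⟩, _ => 0
    | ⟨n + 1, hn⟩, x => ∑ j : Fin (n + 2), (-1 : k) ^ (j : ℕ) *
        φ ⟨n, by push_cast at hn; omega⟩ (face S (Fin.succAboveOrderEmb j) x)
  map_add' φ ψ := by
    funext n x
    obtain ⟨_ | n, hn⟩ := n
    · simp
    · simp [mul_add, Finset.sum_add_distrib]
  map_smul' c φ := by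
    funext n x
    obtain ⟨_ | n, hn⟩ := n
    · simp
    · simp [Finset.mul_sum, mul_left_comm]

variable {k S} in
/-- The cup product: `(φ ∪ ψ)(x) = φ(front face of x) ψ(back face of x)`. -/
def cupFun {i j : ℤ} (φ : Cochain k S i) (ψ : Cochain k S j) : Cochain k S (i + j) :=
  fun n x => if h : 0 ≤ i ∧ 0 ≤ j then
    φ ⟨i.toNat, Int.toNat_of_nonneg h.1⟩
        (face S (frontEmb (m := i.toNat) (n := n.1) (by have := n.2; omega)) x) *
      ψ ⟨j.toNat, Int.toNat_of_nonneg h.2⟩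
        (face S (backEmb (m := j.toNat) (n := n.1) (by have := n.2; omega)) x)
  else 0

/-- The cup product as a bilinear map. -/
def cup (i j : ℤ) : Cochain k S i →ₗ[k] Cochain k S j →ₗ[k] Cochain k S (i + j) :=
  LinearMap.mk₂ k cupFun
    (fun φ φ' ψ => by funext n x; by_cases h : 0 ≤ i ∧ 0 ≤ j <;> simp [cupFun, h, add_mul])
    (fun c φ ψ => by funext n x; by_cases h : 0 ≤ i ∧ 0 ≤ j <;> simp [cupFun, h, mul_assoc])
    (fun φ ψ ψ' => by funext n x; by_cases h : 0 ≤ i ∧ 0 ≤ j <;> simp [cupFun, h, mul_add])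
    (fun c φ ψ => by funext n x; by_cases h : 0 ≤ i ∧ 0 ≤ j <;> simp [cupFun, h, mul_left_comm])

/-- The graded vector space of cochains. -/
def cochainSpace : GrVect k := fun i => ModuleCat.of k (Cochain k S i)

variable {k S}

lemma coboundary_apply {i : ℤ} (φ : Cochain k S i) (n : ℕ) (hn : ((n + 1 : ℕ) : ℤ) = i + 1)
    (x : simplices S (n + 1)) (hn' : (n : ℤ) = i) :
    coboundary k S i φ ⟨n + 1, hn⟩ x = ∑ j : Fin (n + 2), (-1 : k) ^ (j : ℕ) *
        φ ⟨n, hn'⟩ (face S (Fin.succAboveOrderEmb j) x) := rfl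

lemma cup_apply {i j : ℤ} (φ : Cochain k S i) (ψ : Cochain k S j) (n p q : ℕ)
    (hn : (n : ℤ) = i + j) (hp : (p : ℤ) = i) (hq : (q : ℤ) = j) (x : simplices S n)
    (hpn : p ≤ n) (hqn : q ≤ n) :
    cup k S i j φ ψ ⟨n, hn⟩ x =
      φ ⟨p, hp⟩ (face S (frontEmb hpn) x) * ψ ⟨q, hq⟩ (face S (backEmb hqn) x) := by
  subst hp hq
  have h : (0 : ℤ) ≤ p ∧ (0 : ℤ) ≤ q := by omega
  simp only [cup, LinearMap.mk₂_apply, cupFun, dif_pos h]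
  rfl

lemma Cochain.eq_zero {i : ℤ} (h : i < 0) (φ : Cochain k S i) : φ = 0 := by
  funext n x
  have := n.2
  omega

variable (k S) in
/-- The coboundary on the total space. -/
def totD : Tot (cochainSpace k S) →ₗ[k] Tot (cochainSpace k S) :=
  DirectSum.toModule k ℤ _ fun i => (el (cochainSpace k S) (i + 1)) ∘ₗ coboundary k S i

variable (k S) in
/-- The cup product on the total space. -/
def totCup : Tot (cochainSpace k S) →ₗ[k] Tot (cochainSpace k S) →ₗ[k] Tot (cochainSpace k S) :=
  DirectSum.toModule k ℤ _ fun i => LinearMap.flip <| DirectSum.toModule k ℤ _ fun j =>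
    LinearMap.flip ((cup k S i j).compr₂ (el (cochainSpace k S) (i + j)))

/-- The inclusion of cochains into the total space. -/
abbrev cel {i : ℤ} (φ : Cochain k S i) : Tot (cochainSpace k S) := el (cochainSpace k S) i φ

lemma cel_zero {i : ℤ} : cel (0 : Cochain k S i) = 0 := map_zero (el (cochainSpace k S) i)

lemma cel_add_smul {i : ℤ} (φ ψ : Cochain k S i) (c : k) :
    cel φ + c • cel ψ = cel (φ + c • ψ) :=
  ((map_add (el (cochainSpace k S) i) φ (c • ψ : Cochain k S i)).trans
    (congrArg _ (map_smul (el (cochainSpace k S) i) c ψ))).symm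

lemma totD_el {i : ℤ} (φ : Cochain k S i) : totD k S (cel φ) = cel (coboundary k S i φ) :=
  DirectSum.toModule_lof k i φ

lemma totCup_el {i j : ℤ} (φ : Cochain k S i) (ψ : Cochain k S j) :
    totCup k S (cel φ) (cel ψ) = cel (cup k S i j φ ψ) := by
  have h1 : totCup k S (cel φ) = _ := DirectSum.toModule_lof k i φ
  rw [h1]
  have h2 := DirectSum.toModule_lof k (M := fun i => cochainSpace k S i)
    (φ := fun j => LinearMap.flip ((cup k S i j).compr₂ (el (cochainSpace k S) (i + j)))) j ψ
  exact LinearMap.congr_fun h2 φ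

/-- Transport of cochains along an equality of degrees. -/
def Cochain.cast {i j : ℤ} (h : i = j) (φ : Cochain k S i) : Cochain k S j :=
  fun n => φ ⟨n.1, n.2.trans h.symm⟩

lemma cel_cast {i j : ℤ} (h : i = j) (φ : Cochain k S i) : cel φ = cel (φ.cast h) := by
  subst h; rfl

lemma cochain_hom_ext {M : Type*} [AddCommMonoid M] [Module k M]
    {f g : Tot (cochainSpace k S) →ₗ[k] M}
    (h : ∀ (p : ℕ) (φ : Cochain k S p), f (cel φ) = g (cel φ)) : f = g := by
  apply DirectSum.linearMap_ext
  intro i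
  apply LinearMap.ext
  intro φ
  change f (cel φ) = g (cel φ)
  by_cases hi : i < 0
  · rw [Cochain.eq_zero hi φ, cel_zero, map_zero, map_zero]
  · obtain ⟨p, rfl⟩ := Int.eq_ofNat_of_zero_le (not_lt.1 hi)
    exact h p φ

lemma face_congr {m n : ℕ} {e e' : Fin (m + 1) ↪o Fin (n + 1)} (h : ∀ i, (e i : ℕ) = e' i)
    (x : simplices S n) : face S e x = face S e' x := by
  have : e = e' := by ext i; exact h i
  rw [this]

lemma coboundary_coboundary (p : ℕ) (φ : Cochain k S p) :
    coboundary k S _ (coboundary k S _ φ) = 0 := by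
  funext n x
  obtain ⟨n, hn⟩ := n
  obtain rfl : n = p + 2 := by omega
  rw [coboundary_apply _ (p + 1) hn x (by push_cast; rfl)]
  simp only [coboundary_apply φ p _ _ rfl, face_face, Finset.mul_sum]
  simp only [Pi.zero_apply, ← Finset.sum_product']
  let T : Finset (Fin (p + 1 + 2) × Fin (p + 2)) := Finset.univ.filter fun ij => (ij.1 : ℕ) ≤ (ij.2 : ℕ)
  rw [Finset.univ_product_univ, ← Finset.sum_add_sum_compl T, ← eq_neg_iff_add_eq_zero,
    ← Finset.sum_neg_distrib]
  let f : ∀ ij : Fin (p + 1 + 2) × Fin (p + 2), ij ∈ T → Fin (p + 1 + 2) × Fin (p + 2) := fun ij hij =>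
    (ij.2.succ, Fin.castLT ij.1 (lt_of_le_of_lt (Finset.mem_filter.mp hij).right (Fin.is_lt ij.2)))
  apply Finset.sum_bij f
  · intro ij hij
    simp_rw [T, f, Finset.compl_filter, Finset.mem_filter_univ, Fin.val_succ,
      Fin.val_castLT] at hij ⊢
    lia
  · rintro ⟨i, j⟩ hij ⟨i', j'⟩ hij' h
    simp only [f, Prod.mk.injEq, Fin.ext_iff, Fin.val_succ, Fin.val_castLT] at h ⊢
    omega
  · rintro ⟨i', j'⟩ hij'
    simp_rw [T, Finset.compl_filter, Finset.mem_filter_univ, not_le] at hij'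
    refine ⟨(⟨j', by omega⟩, ⟨i' - 1, by omega⟩), ?_, ?_⟩
    · simp only [T, Finset.mem_filter_univ]; omega
    · simp [f, Fin.ext_iff]; omega
  · rintro ⟨i, j⟩ hij
    have hij' : (i : ℕ) ≤ j := by simpa [T] using hij
    simp only [f, Fin.val_succ, Fin.val_castLT]
    have e : face S ((Fin.succAboveOrderEmb j).trans (Fin.succAboveOrderEmb i)) x =
        face S ((Fin.succAboveOrderEmb (Fin.castLT i (lt_of_le_of_lt hij' j.2))).trans
          (Fin.succAboveOrderEmb j.succ)) x := by
      apply face_congr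
      intro a
      simp only [RelEmbedding.coe_trans, Function.comp_apply, Fin.succAboveOrderEmb_apply,
        Fin.succAbove, Fin.lt_def]
      split_ifs <;> simp at * <;> omega
    rw [e]
    ring

lemma cup_leibniz (p q : ℕ) (φ : Cochain k S p) (ψ : Cochain k S q) 
    (x : simplices S (p + q + 1)) (h1) (h2) (h3) :
    coboundary k S _ (cup k S _ _ φ ψ) ⟨p + q + 1, h1⟩ x =
      cup k S _ _ (coboundary k S _ φ) ψ ⟨p + q + 1, h2⟩ x +
        (-1) ^ p * cup k S _ _ φ (coboundary k S _ ψ) ⟨p + q + 1, h3⟩ x := by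
  rw [coboundary_apply _ (p + q) h1 x (by push_cast; rfl),
    cup_apply _ _ (p + q + 1) (p + 1) q h2 (by push_cast; rfl) rfl x (by omega) (by omega),
    cup_apply _ _ (p + q + 1) p (q + 1) h3 rfl (by push_cast; rfl) x (by omega) (by omega),
    coboundary_apply φ p _ _ rfl, coboundary_apply ψ q _ _ rfl]
  simp only [cup_apply φ ψ (p + q) p q _ rfl rfl _ (Nat.le_add_right p q) (Nat.le_add_left q p),
    face_face]
  have hc : (p + 1) + (q + 1) = p + q + 2 := by omega
  rw [← Equiv.sum_comp (finCongr hc), Fin.sum_univ_add]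
  rw [Fin.sum_univ_castSucc (n := p + 1), Fin.sum_univ_succ (n := q + 1)]
  have ef : ∀ j : Fin (p + 1), face S ((frontEmb (Nat.le_add_right p q)).trans
      (Fin.succAboveOrderEmb (finCongr hc (Fin.castAdd (q + 1) j)))) x =
      face S ((Fin.succAboveOrderEmb j.castSucc).trans (frontEmb (by omega))) x := by
    intro j
    apply face_congr
    intro a
    simp only [RelEmbedding.coe_trans, Function.comp_apply, Fin.succAboveOrderEmb_apply,
        Fin.succAbove, Fin.lt_def]
    split_ifs <;> simp [frontEmb_val] at * <;> omega
  have eb : ∀ j : Fin (p + 1), face S ((backEmb (Nat.le_add_left q p)).trans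
      (Fin.succAboveOrderEmb (finCongr hc (Fin.castAdd (q + 1) j)))) x =
      face S (backEmb (by omega)) x := by
    intro j
    apply face_congr
    intro a
    simp only [RelEmbedding.coe_trans, Function.comp_apply, Fin.succAboveOrderEmb_apply,
        Fin.succAbove, Fin.lt_def]
    split_ifs <;> simp [backEmb_val] at * <;> omega
  have ef' : ∀ j : Fin (q + 1), face S ((frontEmb (Nat.le_add_right p q)).trans
      (Fin.succAboveOrderEmb (finCongr hc (Fin.natAdd (p + 1) j)))) x =
      face S (frontEmb (by omega)) x := by
    intro j
    apply face_congr
    intro a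
    simp only [RelEmbedding.coe_trans, Function.comp_apply, Fin.succAboveOrderEmb_apply,
        Fin.succAbove, Fin.lt_def]
    split_ifs <;> simp [frontEmb_val] at * <;> omega
  have eb' : ∀ j : Fin (q + 1), face S ((backEmb (Nat.le_add_left q p)).trans
      (Fin.succAboveOrderEmb (finCongr hc (Fin.natAdd (p + 1) j)))) x =
      face S ((Fin.succAboveOrderEmb j.succ).trans (backEmb (by omega))) x := by
    intro j
    apply face_congr
    intro a
    simp only [RelEmbedding.coe_trans, Function.comp_apply, Fin.succAboveOrderEmb_apply,
        Fin.succAbove, Fin.lt_def]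
    split_ifs <;> simp [backEmb_val] at * <;> omega
  have el : face S ((Fin.succAboveOrderEmb (Fin.last (p + 1))).trans
      (frontEmb (show p + 1 ≤ p + q + 1 by omega))) x =
      face S (frontEmb (show p ≤ p + q + 1 by omega)) x := by
    apply face_congr
    intro a
    simp [frontEmb]
  have e0 : face S ((Fin.succAboveOrderEmb (0 : Fin (q + 2))).trans
      (backEmb (show q + 1 ≤ p + q + 1 by omega))) x =
      face S (backEmb (show q ≤ p + q + 1 by omega)) x := by
    apply face_congr
    intro a
    simp [backEmb_val]
    omega
  simp only [ef, eb, ef', eb', el, e0]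
  simp only [finCongr_apply, Fin.val_cast, Fin.val_castAdd, Fin.val_natAdd, Fin.val_castSucc,
    Fin.val_last, Fin.val_zero, Fin.val_succ, add_mul, Finset.sum_mul, mul_add, Finset.mul_sum]
  have r1 : ∀ a b c : k, a * (b * c) = a * b * c := fun a b c => (mul_assoc a b c).symm
  have r2 : ∀ j : Fin (q + 1), ∀ a b : k, (-1 : k) ^ (p + 1 + (j : ℕ)) * (a * b) =
      (-1) ^ p * (a * ((-1) ^ ((j : ℕ) + 1) * b)) := fun j a b => by ring
  simp only [r2]
  simp only [r1]
  ring

lemma cup_assoc (p q r : ℕ) (φ : Cochain k S p) (ψ : Cochain k S q) (χ : Cochain k S r)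
    (x : simplices S (p + q + r)) (h1) (h2) :
    cup k S _ _ (cup k S _ _ φ ψ) χ ⟨p + q + r, h1⟩ x =
      cup k S _ _ φ (cup k S _ _ ψ χ) ⟨p + q + r, h2⟩ x := by
  rw [cup_apply _ _ _ (p + q) r h1 (by push_cast; rfl) rfl x (by omega) (by omega),
    cup_apply _ _ _ p q _ rfl rfl _ (by omega) (by omega),
    cup_apply _ _ _ p (q + r) h2 rfl (by push_cast; rfl) x (by omega) (by omega),
    cup_apply _ _ _ q r _ rfl rfl _ (by omega) (by omega)]
  simp only [face_face]
  rw [mul_assoc]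
  refine congrArg₂ (· * ·) (congrArg _ (face_congr (fun a => ?_) x))
    (congrArg₂ (· * ·) (congrArg _ (face_congr (fun a => ?_) x))
      (congrArg _ (face_congr (fun a => ?_) x)))
  · simp [frontEmb_val]
  · simp [frontEmb_val, backEmb_val]
    omega
  · simp [backEmb_val]
    omega

variable (k S) in
/-- The differential graded algebra of cochains of a `Δ`-complex. -/
def cochainAlg : DGAlg k where
  V := cochainSpace k S
  d := totD k S
  mul := totCup k S
  d_degree i φ := ⟨coboundary k S i φ, (totD_el φ).symm⟩
  mul_degree i j φ ψ := ⟨cup k S i j φ ψ, (totCup_el φ ψ).symm⟩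
  d_d x := by
    have : totD k S ∘ₗ totD k S = 0 := cochain_hom_ext fun p φ => by
      rw [LinearMap.comp_apply, totD_el, totD_el, coboundary_coboundary, cel_zero]
      rfl
    exact LinearMap.congr_fun this x
  leibniz x y := by
    have : (totCup k S).compr₂ (totD k S) = (totCup k S) ∘ₗ totD k S +
        ((totCup k S) ∘ₗ sgn (cochainSpace k S) 1).compl₂ (totD k S) :=
      cochain_hom_ext fun p φ => cochain_hom_ext fun q ψ => by
        have hs : sgn (cochainSpace k S) 1 (cel φ) = (-1 : k) ^ p • cel φ := by
          simpa using sgn_el (cochainSpace k S) 1 p φ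
        simp only [LinearMap.compr₂_apply, LinearMap.add_apply, LinearMap.comp_apply,
          LinearMap.compl₂_apply, hs, map_smul, LinearMap.smul_apply, totCup_el, totD_el]
        rw [cel_cast (show (p : ℤ) + q + 1 = (p + q + 1 : ℕ) by push_cast; ring)
            (coboundary k S _ (cup k S _ _ φ ψ)),
          cel_cast (show (p : ℤ) + 1 + q = (p + q + 1 : ℕ) by push_cast; ring)
            (cup k S _ _ (coboundary k S _ φ) ψ),
          cel_cast (show (p : ℤ) + (q + 1) = (p + q + 1 : ℕ) by push_cast; ring)
            (cup k S _ _ φ (coboundary k S _ ψ)),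
          cel_add_smul]
        refine congrArg (el (cochainSpace k S) _) ?_
        funext n x
        obtain ⟨n, hn⟩ := n
        obtain rfl : n = p + q + 1 := by omega
        exact cup_leibniz p q φ ψ x _ _ _
    exact LinearMap.congr_fun (LinearMap.congr_fun this x) y
  assoc x y z := by
    have : (totCup k S).compr₂ (totCup k S) =
        ((LinearMap.llcomp k _ _ _) ∘ₗ (totCup k S)).compl₂ (totCup k S) :=
      cochain_hom_ext fun p φ => cochain_hom_ext fun q ψ => cochain_hom_ext fun r χ => by
        simp only [LinearMap.compr₂_apply, LinearMap.comp_apply,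
          LinearMap.compl₂_apply, LinearMap.llcomp_apply, totCup_el]
        rw [cel_cast (show (p : ℤ) + q + r = (p + q + r : ℕ) by push_cast; ring)
            (cup k S _ _ (cup k S _ _ φ ψ) χ),
          cel_cast (show (p : ℤ) + (q + r) = (p + q + r : ℕ) by push_cast; ring)
            (cup k S _ _ φ (cup k S _ _ ψ χ))]
        refine congrArg (el (cochainSpace k S) _) ?_
        funext n x
        obtain ⟨n, hn⟩ := n
        obtain rfl : n = p + q + r := by omega
        exact cup_assoc p q r φ ψ χ x _ _
    exact LinearMap.congr_fun (LinearMap.congr_fun (LinearMap.congr_fun this x) y) z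


/-- The pullback of cochains along a morphism of `Δ`-complexes. -/
def cochainPull (k : Type u) [Field k] {S T : DeltaComplex.{u}} (g : S ⟶ T) (i : ℤ) :
    Cochain k T i →ₗ[k] Cochain k S i where
  toFun φ n x := φ n (g.app (op ⦋n.1⦌ₛ) x)
  map_add' _ _ := rfl
  map_smul' _ _ := rfl

/-- The pullback of cochains on the total spaces. -/
def totPull (k : Type u) [Field k] {S T : DeltaComplex.{u}} (g : S ⟶ T) :
    Tot (cochainSpace k T) →ₗ[k] Tot (cochainSpace k S) :=
  DirectSum.toModule k ℤ _ fun i => (el (cochainSpace k S) i) ∘ₗ cochainPull k g i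

lemma totPull_el {S T : DeltaComplex.{u}} (g : S ⟶ T) {i : ℤ} (φ : Cochain k T i) :
    totPull k g (cel φ) = cel (cochainPull k g i φ) :=
  DirectSum.toModule_lof k i φ

lemma cochainPull_coboundary {S T : DeltaComplex.{u}} (g : S ⟶ T) (p : ℕ) (φ : Cochain k T p) :
    cochainPull k g _ (coboundary k T _ φ) = coboundary k S _ (cochainPull k g _ φ) := by
  funext n x
  obtain ⟨n, hn⟩ := n
  obtain rfl : n = p + 1 := by omega
  change coboundary k T _ φ ⟨p + 1, hn⟩ (g.app (op ⦋p + 1⦌ₛ) x) = _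
  rw [coboundary_apply _ p hn _ rfl, coboundary_apply _ p hn _ rfl]
  refine Finset.sum_congr rfl fun j _ => ?_
  change _ = _ * φ ⟨p, rfl⟩ (g.app (op ⦋p⦌ₛ) _)
  rw [face_naturality]

lemma cochainPull_cup {S T : DeltaComplex.{u}} (g : S ⟶ T) (p q : ℕ) (φ : Cochain k T p)
    (ψ : Cochain k T q) :
    cochainPull k g _ (cup k T _ _ φ ψ) =
      cup k S _ _ (cochainPull k g _ φ) (cochainPull k g _ ψ) := by
  funext n x
  obtain ⟨n, hn⟩ := n
  obtain rfl : n = p + q := by omega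
  change cup k T _ _ φ ψ ⟨p + q, hn⟩ (g.app (op ⦋p + q⦌ₛ) x) = _
  rw [cup_apply φ ψ (p + q) p q hn rfl rfl _ (by omega) (by omega),
    cup_apply _ _ (p + q) p q hn rfl rfl _ (by omega) (by omega)]
  change _ = φ ⟨p, rfl⟩ (g.app (op ⦋p⦌ₛ) _) * ψ ⟨q, rfl⟩ (g.app (op ⦋q⦌ₛ) _)
  rw [face_naturality, face_naturality]

variable (k) in
/-- The morphism of cochain algebras induced by a morphism of `Δ`-complexes. -/
def cochainMap {S T : DeltaComplex.{u}} (g : S ⟶ T) : DGHom (cochainAlg k T) (cochainAlg k S) where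
  f := totPull k g
  degree i φ := ⟨cochainPull k g i φ, (totPull_el g φ).symm⟩
  comm x := by
    have : totPull k g ∘ₗ totD k T = totD k S ∘ₗ totPull k g := cochain_hom_ext fun p φ => by
      rw [LinearMap.comp_apply, LinearMap.comp_apply, totD_el, totPull_el, totPull_el, totD_el,
        cochainPull_coboundary]
    exact LinearMap.congr_fun this x
  map_mul x y := by
    have : (totCup k T).compr₂ (totPull k g) =
        ((totCup k S) ∘ₗ totPull k g).compl₂ (totPull k g) :=
      cochain_hom_ext fun p φ => cochain_hom_ext fun q ψ => by
        simp only [LinearMap.compr₂_apply, LinearMap.comp_apply, LinearMap.compl₂_apply,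
          totCup_el, totPull_el, cochainPull_cup]
    exact LinearMap.congr_fun (LinearMap.congr_fun this x) y

variable (k) in
/-- The cochain algebra functor. -/
def cochains : DeltaComplex.{u}ᵒᵖ ⥤ DGAlg k where
  obj S := cochainAlg k S.unop
  map g := cochainMap k g.unop
  map_id S := DGHom.ext <| by
    refine cochain_hom_ext fun p φ => ?_
    exact totPull_el (𝟙 S.unop) φ
  map_comp g h := DGHom.ext <| by
    refine cochain_hom_ext fun p φ => ?_
    refine (totPull_el (h.unop ≫ g.unop) φ).trans ?_
    refine Eq.trans ?_ (congrArg (totPull k h.unop) (totPull_el g.unop φ)).symm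
    exact (totPull_el h.unop (cochainPull k g.unop p φ)).symm

/-! ### Finite filtered data -/

/-- The set of all simplices of a `Δ`-complex. -/
abbrev AllSimplices (S : DeltaComplex.{u}) : Type u := Σ n : ℕ, simplices S n

/-- `α` is a face of `β`. -/
def IsFace (S : DeltaComplex.{u}) (α β : AllSimplices S) : Prop :=
  ∃ e : Fin (α.1 + 1) ↪o Fin (β.1 + 1), face S e β.2 = α.2

/-- The map on simplices induced by a morphism of `Δ`-complexes. -/
def mapSimplices {S T : DeltaComplex.{u}} (g : S ⟶ T) (α : AllSimplices S) : AllSimplices T :=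
  ⟨α.1, g.app _ α.2⟩

/-- The conditions defining finite filtered data. -/
structure IsFiniteFiltered (X : ℝ ⥤ DeltaComplex.{u}) : Prop where
  finite : ∀ r, Finite (AllSimplices (X.obj r))
  injective : ∀ {a b : ℝ} (h : a ≤ b), Function.Injective (mapSimplices (X.map (homOfLE h)))
  finite_changes : Finite (Quot fun a b : ℝ => ∃ h : a ≤ b, IsIso (X.map (homOfLE h)))
  /-- There are total orders on the sets of simplices such that faces come first, and such that
  old simplices come before new ones. -/
  order : ∃ le : ∀ a : ℝ, LinearOrder (AllSimplices (X.obj a)),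
    (∀ (a : ℝ) (α β : AllSimplices (X.obj a)), IsFace (X.obj a) α β → (le a).le α β) ∧
    ∀ (a b : ℝ) (h : a < b) (α : AllSimplices (X.obj a)) (β : AllSimplices (X.obj b)),
      β ∉ Set.range (mapSimplices (X.map (homOfLE h.le))) →
        (le b).le (mapSimplices (X.map (homOfLE h.le)) α) β

/-- The property of being finite filtered data. -/
def finiteFiltered : ObjectProperty (ℝ ⥤ DeltaComplex.{u}) := fun X => IsFiniteFiltered X

/-- The category of finite filtered data: a full subcategory of persistent `Δ`-complexes. -/
abbrev FData := (finiteFiltered.{u}).FullSubcategory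

/-- A choice of contractions of the cochain algebras occurring in finite filtered data. -/
abbrev ContractionChoice (k : Type u) [Field k] :=
  ∀ (X : FData.{u}) (r : ℝ), Contraction ((cochains k).obj (op (X.obj.obj r)))

/-- The copersistent transfer datum of finite filtered data. -/
def transferData (c : ContractionChoice.{u} k) (X : FData.{u}) : ℝᵒᵖ ⥤ TransDatum k where
  obj r := ⟨(cochains k).obj (op (X.obj.obj r.unop)), c X r.unop⟩
  map f := (cochains k).map (X.obj.map f.unop).op
  map_id r := by
    rw [unop_id, X.obj.map_id, op_id, (cochains k).map_id]
    rfl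
  map_comp f g := by
    rw [unop_comp, X.obj.map_comp, op_comp, (cochains k).map_comp]
    rfl

lemma transferData_finite (c : ContractionChoice.{u} k) (X : FData.{u}) :
    HasFinitelyManyChanges k (transferData c X) := by
  have hX : Finite (Quot fun a b : ℝ => ∃ h : a ≤ b, IsIso (X.obj.map (homOfLE h))) :=
    X.property.finite_changes
  have hr : ∀ a b : ℝ, (∃ h : a ≤ b, IsIso (X.obj.map (homOfLE h))) →
      ∃ h : a ≤ b, IsIso ((transferData c X).map (homOfLE h).op) := by
    rintro a b ⟨h, hi⟩
    refine ⟨h, ?_⟩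
    have e : IsIso ((cochains k).map (X.obj.map (homOfLE h)).op) := inferInstance
    obtain ⟨g, h1, h2⟩ := e
    exact ⟨g, h1, h2⟩
  exact Finite.of_surjective (Quot.map id hr) (by
    rintro ⟨a⟩
    exact ⟨Quot.mk _ a, rfl⟩)

/-- The functor sending finite filtered data to the copersistent transfer data of their cochain
algebras. -/
def transferFunctor (c : ContractionChoice k) : FData.{u}ᵒᵖ ⥤ FTrans k where
  obj X := ⟨transferData c X.unop, transferData_finite c X.unop⟩
  map {X Y} g := ObjectProperty.homMk
    { app := fun r => ((cochains k).map (g.unop.hom.app r.unop).op :)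
      naturality := fun r s f => by
        change (cochains k).map _ ≫ (cochains k).map _ = (cochains k).map _ ≫ (cochains k).map _
        rw [← Functor.map_comp, ← Functor.map_comp, ← op_comp, ← op_comp, g.unop.hom.naturality] }
  map_id X := by
    apply ObjectProperty.hom_ext
    apply NatTrans.ext
    funext r
    exact (cochains k).map_id _
  map_comp f g := by
    apply ObjectProperty.hom_ext
    apply NatTrans.ext
    funext r
    exact (cochains k).map_comp (f.unop.hom.app r.unop).op (g.unop.hom.app r.unop).op

end Cochains

/-! ### Interleavings of copersistent objects -/

section Interleaving

open Opposite

variable {C : Type*} [Category C]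

/-- The shift `F[ε]` of a copersistent object: `F[ε]^r = F^{r - ε}`. -/
def shift (F : ℝᵒᵖ ⥤ C) (ε : ℝ) : ℝᵒᵖ ⥤ C :=
  (Monotone.functor (f := fun r : ℝ => r - ε) fun _ _ h => sub_le_sub_right h ε).op ⋙ F

/-- The structure morphism `F^r ⟶ F^s` for `s ≤ r`. -/
def structureMap (F : ℝᵒᵖ ⥤ C) {r s : ℝ} (h : s ≤ r) : F.obj (op r) ⟶ F.obj (op s) :=
  F.map (homOfLE h).op

/-- Two copersistent objects are `ε`-interleaved if there are `μ : F ⟶ G[ε]` and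
`ν : G ⟶ F[ε]` such that `ν[ε] ∘ μ` and `μ[ε] ∘ ν` are given by the structure morphisms. -/
def Interleaved (F G : ℝᵒᵖ ⥤ C) (ε : ℝ) : Prop :=
  ∃ (hε : 0 ≤ ε) (μ : F ⟶ shift G ε) (ν : G ⟶ shift F ε), ∀ r : ℝ,
    μ.app (op r) ≫ ν.app (op (r - ε)) =
      structureMap F (show r - ε - ε ≤ r by linarith) ∧
    ν.app (op r) ≫ μ.app (op (r - ε)) =
      structureMap G (show r - ε - ε ≤ r by linarith)

/-- The interleaving distance of two copersistent objects, with values in `[0, ∞]`. -/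
noncomputable def interleavingDist (F G : ℝᵒᵖ ⥤ C) : ENNReal :=
  ⨅ (ε : NNReal) (_ : Interleaved F G ε), (ε : ENNReal)

end Interleaving

/-! ### The `A_∞`-interleaving distance -/

section Distance

open Opposite

/-- The interleaving distance, in the homotopy category of `A_∞`-algebras, of the copersistent
objects that a functor `F` associates with the cochain algebras of finite filtered data. -/
noncomputable def aInfDist (F : FTrans k ⥤ (ℝᵒᵖ ⥤ Ho k)) (c : ContractionChoice.{u} k)
    (X Y : FData.{u}) : ENNReal :=
  interleavingDist (F.obj ((transferFunctor c).obj (op X)))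
    (F.obj ((transferFunctor c).obj (op Y)))

end Distance

end AInf

namespace AInf

/-! ### Sums over splittings -/

section Splittings

variable {α : Type*} {M : Type*} [AddCommMonoid M]

/-! On suspensions (the twist by `tw`) almost all Koszul signs disappear: the relations of an
`A_∞`-structure `b` say that inserting `b` into itself gives zero, and those of an `∞`-morphism `F`
say that inserting `b` into `F` equals applying the target structure to the values of `F` on
consecutive blocks. The only remaining sign is the operator `ssgn` on the entries to the left of the
insertion.

The extension of `i` is the fixed point of `F = i + h λ(F)`, where `λ(F)` sums the products of the
values of `F` on the two pieces of a list; with `λ = λ(F)` one sets `m = p λ`. The heart is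
`d_kernelBar`: `d λ` is minus the insertion of `m` into `λ`. It is proved by induction on length.
The Leibniz rule reduces `d λ` to `d F` on shorter lists, the identity `ip - 1 = dh + hd` turns `d
F` into the insertion of `m` into `F` minus `λ`, and the terms in `λ` cancel by associativity.
Applying `h` to `d_kernelBar` yields the relations of the extension of `i`; applying `p` yields
those of `m`.

The extension of `p` uses the tensor trick. Precomposition with the sum of the `(ip)^{⊗ a} ⊗ h ⊗
id^{⊗ c}` is an operator `hIns` on families, and `hIns_dIns` is the resulting homotopy formula
between `(ip)^{⊗ n}` and the identity. One solves `P = p + hIns (pRest P)`, where `pRest P` only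
involves `P` on shorter lists. The failure of `P` to be an `∞`-morphism vanishes by induction on
length (`pDefect_eq_zero`): if it vanishes on shorter lists, it is killed by `dIns` because
coderivations square to zero (`dIns_pDefect`), by `hIns` because of the recursion and the side
conditions (`hIns_pDefect`), and on the image of `i^{⊗ n}` because the extensions of `i` and `p`
compose strictly to the identity (`pDefect_map_i`). The homotopy formula then leaves nothing.

The linear parts of the two extensions are homotopy inverse through `h`, so both are
`∞`-quasi-isomorphisms. Since `p ∘ i` is strictly the identity, their classes are mutually inverse,
with no `∞`-homotopy to construct. Hence `D ↦ [H]` is the functor `D ↦ [A]` conjugated by these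
isomorphisms; this gives functoriality and the comparison with persistent cohomology.

Contractions come from linear algebra: `d` has a graded generalized inverse `s` with `sds = s` and
`s² = 0`, and `H` is the image of `1 - ds - sd`. The distance axioms hold for interleavings in any
category. The choice of contractions is immaterial because morphisms of transfer data ignore them,
so identity maps of cochain algebras are isomorphisms between any two choices. -/

lemma lsum_splits_append_cons (p : List α) (x : α) (r : List α) (Ψ : List α → List α → M) :
    lsum (splits (p ++ x :: r)) (fun s => Ψ s.1 s.2) =
      lsum (splits p) (fun s => Ψ s.1 (s.2 ++ x :: r)) +
        lsum (splits r) (fun s => Ψ (p ++ x :: s.1) s.2) := by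
  induction p generalizing Ψ with
  | nil => simp [splits]
  | cons a p ih =>
    simp only [List.cons_append, splits, lsum_cons, lsum_map]
    rw [ih fun u v => Ψ (a :: u) v, add_assoc]

lemma lsum_mem {N S : Type*} [AddCommMonoid N] [SetLike S N] [AddSubmonoidClass S N] (s : S)
    {L : List α} {f : α → N} (h : ∀ x ∈ L, f x ∈ s) : lsum L f ∈ s := by
  induction L with
  | nil => exact zero_mem s
  | cons a L ih =>
    rw [lsum_cons]
    exact add_mem (h a (by simp)) (ih fun x hx => h x (by simp [hx]))

lemma lsum_eq_zero {L : List α} {f : α → M} (h : ∀ x ∈ L, f x = 0) : lsum L f = 0 := by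
  rw [lsum_congr h, lsum_zero]

lemma lsum_sub {N : Type*} [AddCommGroup N] (L : List α) (f g : α → N) :
    lsum L (fun x => f x - g x) = lsum L f - lsum L g := by
  induction L with
  | nil => simp
  | cons a L ih => simp [ih]; abel

lemma lsum_neg {N : Type*} [AddCommGroup N] (L : List α) (f : α → N) :
    lsum L (fun x => - f x) = - lsum L f := by
  induction L with
  | nil => simp
  | cons a L ih => simp [ih]; abel

lemma length_mem_splits {l : List α} {s : List α × List α} (h : s ∈ splits l) :
    s.1.length + s.2.length = l.length := by
  rw [← mem_splits h, List.length_append]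

/-- A sum over splittings whose summands vanish when the second part is nonempty. -/
lemma lsum_splits_of_right {l : List α} {Ψ : List α → List α → M}
    (h : ∀ p x r, Ψ p (x :: r) = 0) : lsum (splits l) (fun s => Ψ s.1 s.2) = Ψ l [] := by
  induction l generalizing Ψ with
  | nil => simp [splits]
  | cons a l ih =>
    simp only [splits, lsum_cons, lsum_map, h, zero_add]
    exact ih (Ψ := fun p r => Ψ (a :: p) r) fun p x r => h _ _ _

/-- A sum over splittings whose summands vanish when the first part is nonempty. -/
lemma lsum_splits_of_left {l : List α} {Ψ : List α → List α → M}
    (h : ∀ p x r, Ψ (x :: p) r = 0) : lsum (splits l) (fun s => Ψ s.1 s.2) = Ψ [] l := by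
  cases l with
  | nil => simp [splits]
  | cons a l =>
    simp only [splits, lsum_cons, lsum_map, h, lsum_zero, add_zero]

/-- Blocks are nonempty, so the blocks other than `B` use up at least `s.length - 1` entries. As
soon as there are two blocks, each is shorter than `l`; recursions on length rely on this. -/
lemma length_of_mem_parts {l : List α} {s : List (List α)} (h : s ∈ parts l) :
    s.length ≤ l.length ∧ ∀ B ∈ s, B.length + (s.length - 1) ≤ l.length := by
  obtain ⟨h1, h2⟩ := mem_parts h
  subst h1
  clear h
  induction s with
  | nil => simp
  | cons B s ih =>
    obtain ⟨h3, h4⟩ := ih fun C hC => h2 C (by simp [hC])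
    have hB := List.length_pos_iff.2 (h2 B (by simp))
    refine ⟨by simp only [List.length_cons, List.flatten_cons, List.length_append]; omega,
      fun C hC => ?_⟩
    simp only [List.flatten_cons, List.length_append, List.length_cons]
    rcases List.mem_cons.1 hC with rfl | hC
    · omega
    · have := h4 C hC
      have := List.length_pos_of_mem hC
      omega

/-- A sum over decompositions into blocks in which only the finest decomposition contributes. -/
lemma lsum_parts_finest {l : List α} {Ψ : List (List α) → M}
    (h : ∀ s ∈ parts l, s.length < l.length → Ψ s = 0) :
    lsum (parts l) Ψ = Ψ (l.map fun x => [x]) := by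
  induction l generalizing Ψ with
  | nil => simp [parts]
  | cons a l ih =>
    have key : ∀ s ∈ parts l, lsum (consParts a s) Ψ = Ψ ([a] :: s) := by
      intro s hs
      cases s with
      | nil => simp
      | cons B s =>
        -- Joining `a` to the first block leaves fewer blocks than entries, so the hypothesis kills
        -- that term.
        rw [consParts_cons, lsum_cons, lsum_cons, lsum_nil, add_zero, h ((a :: B) :: s), add_zero]
        · simp only [parts, List.mem_flatMap]
          exact ⟨_, hs, by simp⟩
        · have := (length_of_mem_parts hs).1
          simp only [List.length_cons] at this ⊢
          omega
    rw [lsum_parts_cons, lsum_congr key, ih, List.map_cons]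
    intro s hs hl
    refine h _ ?_ (by simpa using hl)
    simp only [parts, List.mem_flatMap]
    refine ⟨s, hs, ?_⟩
    cases s <;> simp

end Splittings

/-! ### Insertions -/

section Insertions

variable {k A M : Type*} [Field k] [AddCommGroup A] [Module k A] [AddCommGroup M]
  {σ : A →ₗ[k] A} {b : List A → A} {φ ψ : List A → M}

/-- The sum of `φ ∘ (σ^{⊗ p} ⊗ b_q ⊗ id^{⊗ r})` over `p + q + r = n`, evaluated on lists. -/
def insertAlong (σ : A →ₗ[k] A) (b : List A → A) (φ : List A → M) (l : List A) : M :=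
  lsum (splits l) fun s => lsum (splits s.2) fun t => φ (s.1.map σ ++ b t.1 :: t.2)

lemma insertAlong_nil : insertAlong σ b φ [] = φ [b []] := by simp [insertAlong, splits]

/-- The inserted operation either starts at the first entry or passes over it, leaving `σ` behind.
Inductions on the list, with `φ` generalized, go through this. -/
lemma insertAlong_cons (x : A) (l : List A) :
    insertAlong σ b φ (x :: l) = lsum (splits (x :: l)) (fun t => φ (b t.1 :: t.2)) +
      insertAlong σ b (fun r => φ (σ x :: r)) l := by
  simp only [insertAlong, splits, lsum_cons, lsum_map, List.map_nil, List.nil_append, List.map_cons,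
    List.cons_append]

lemma insertAlong_add_fun (l : List A) :
    insertAlong σ b (fun l => φ l + ψ l) l = insertAlong σ b φ l + insertAlong σ b ψ l := by
  simp only [insertAlong, lsum_add]

lemma insertAlong_sub_fun (l : List A) :
    insertAlong σ b (fun l => φ l - ψ l) l = insertAlong σ b φ l - insertAlong σ b ψ l := by
  simp only [insertAlong, lsum_sub]

lemma insertAlong_zero_fun (l : List A) : insertAlong σ b (fun _ => (0 : M)) l = 0 := by
  simp only [insertAlong, lsum_zero]

end Insertions

/-! ### Multilinear families -/

section MultilinearFamilies

variable {k A M N : Type*} [Field k] [AddCommGroup A] [Module k A]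
  [AddCommGroup M] [Module k M] [AddCommGroup N] [Module k N]

lemma Multilin.cons {φ : List A → M} (h : Multilin k φ) (x : A) :
    Multilin k fun l => φ (x :: l) :=
  ⟨fun p => h.add (x :: p), fun p => h.smul (x :: p)⟩

lemma Multilin.append_left {φ : List A → M} (h : Multilin k φ) (q : List A) :
    Multilin k fun l => φ (q ++ l) :=
  ⟨fun p x y r => by simpa using h.add (q ++ p) x y r,
    fun p c x r => by simpa using h.smul (q ++ p) c x r⟩

lemma Multilin.sub_fun {φ ψ : List A → M} (h : Multilin k φ) (h' : Multilin k ψ) :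
    Multilin k fun l => φ l - ψ l where
  add p x y r := by simp only [h.add, h'.add]; abel
  smul p c x r := by simp only [h.smul, h'.smul, smul_sub]

/-- Sums over splittings of families which are multilinear in both parts. -/
lemma multilin_lsum_splits {Ψ : List A → List A → M} (h₁ : ∀ r, Multilin k fun p => Ψ p r)
    (h₂ : ∀ p, Multilin k (Ψ p)) : Multilin k fun l => lsum (splits l) fun s => Ψ s.1 s.2 where
  add p x y r := by
    simp only [lsum_splits_append_cons, (h₁ _).add, (h₂ _).add, lsum_add]
    abel
  smul p c x r := by
    simp only [lsum_splits_append_cons, (h₁ _).smul, (h₂ _).smul, smul_add, smul_lsum]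

lemma multilin_insertAlong (σ : A →ₗ[k] A) {b : List A → A} (hb : Multilin k b)
    {φ : List A → M} (hφ : Multilin k φ) : Multilin k (insertAlong σ b φ) := by
  refine multilin_lsum_splits
    (Ψ := fun u v => lsum (splits v) fun t => φ (u.map σ ++ b t.1 :: t.2)) (fun r => ?_)
    fun p => ?_
  · refine ⟨fun p x y q => ?_, fun p c x q => ?_⟩
    · simp only [List.map_append, List.map_cons, map_add, List.append_assoc, List.cons_append,
        hφ.add, lsum_add]
    · simp only [List.map_append, List.map_cons, map_smul, List.append_assoc, List.cons_append,
        hφ.smul, smul_lsum]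
  · refine multilin_lsum_splits (Ψ := fun u v => φ (p.map σ ++ b u :: v)) (fun r => ?_) fun u => ?_
    · refine ⟨fun p x y q => ?_, fun p c x q => ?_⟩
      · simp only [hb.add, hφ.add]
      · simp only [hb.smul, hφ.smul]
    · exact (hφ.append_left _).cons (A := A) (b u)

variable {σ : A →ₗ[k] A} {b b' : List A → A} {φ ψ : List A → M}

/-- Insertion of a unary operation. -/
lemma insertAlong_unary_cons (hφ : Multilin k φ) (b0 : b [] = 0) (hb : ∀ x y l, b (x :: y :: l) = 0)
    (x : A) (l : List A) :
    insertAlong σ b φ (x :: l) = φ (b [x] :: l) + insertAlong σ b (fun r => φ (σ x :: r)) l := by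
  have h0 : ∀ l, φ (0 :: l) = 0 := hφ.zero []
  rw [insertAlong_cons, splits, lsum_cons, lsum_map]
  dsimp only
  rw [lsum_splits_of_left (Ψ := fun p r => φ (b (x :: p) :: r)), b0, h0, zero_add]
  intro p y r
  rw [hb, h0]

lemma insertAlong_add_insert (hφ : Multilin k φ) (l : List A) :
    insertAlong σ (fun l => b l + b' l) φ l = insertAlong σ b φ l + insertAlong σ b' φ l := by
  simp only [insertAlong, hφ.add, lsum_add]

lemma insertAlong_comp (g : M →ₗ[k] N) (l : List A) :
    insertAlong σ b (fun l => g (φ l)) l = g (insertAlong σ b φ l) := by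
  simp only [insertAlong, map_lsum]

/-- Insertion of a unary operation only involves lists of the same length. -/
lemma insertAlong_unary_congr (hφ : Multilin k φ) (hψ : Multilin k ψ)
    (b0 : b [] = 0) (hb : ∀ x y l, b (x :: y :: l) = 0) {l : List A}
    (h : ∀ l' : List A, l'.length = l.length → φ l' = ψ l') :
    insertAlong σ b φ l = insertAlong σ b ψ l := by
  induction l generalizing φ ψ with
  | nil => rw [insertAlong_nil, insertAlong_nil, b0, hφ.eq_zero (by simp), hψ.eq_zero (by simp)]
  | cons x l ih =>
    rw [insertAlong_unary_cons hφ b0 hb, insertAlong_unary_cons hψ b0 hb, h _ (by simp),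
      ih (hφ.cons _) (hψ.cons _)]
    intro l' hl'
    exact h _ (by simp [hl'])

end MultilinearFamilies

/-! ### Graded families of multilinear maps -/

section GradedFamilies

variable {k : Type u} [Field k] {U V W X : GrVect k}

/-- Lists of homogeneous elements of total degree `n`. -/
def HomogList (V : GrVect k) (n : ℤ) (l : List (Tot V)) : Prop :=
  ∃ l' : List (Σ i : ℤ, V i), l = l'.map (fun a => el V a.1 a.2) ∧ (l'.map Sigma.fst).sum = n

lemma HomogList.nil : HomogList V 0 [] := ⟨[], rfl, rfl⟩

lemma HomogList.cons {x : Tot V} {l : List (Tot V)} {i n : ℤ} (hx : x ∈ homog V i)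
    (hl : HomogList V n l) : HomogList V (i + n) (x :: l) := by
  obtain ⟨l', rfl, rfl⟩ := hl
  obtain ⟨y, rfl⟩ := hx
  exact ⟨⟨i, y⟩ :: l', rfl, by simp⟩

lemma HomogList.append {p r : List (Tot V)} {a c : ℤ} (hp : HomogList V a p)
    (hr : HomogList V c r) : HomogList V (a + c) (p ++ r) := by
  obtain ⟨p', rfl, rfl⟩ := hp
  obtain ⟨r', rfl, rfl⟩ := hr
  exact ⟨p' ++ r', by simp, by simp⟩

lemma HomogList.of_append {p r : List (Tot V)} {n : ℤ} (h : HomogList V n (p ++ r)) :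
    ∃ a c, a + c = n ∧ HomogList V a p ∧ HomogList V c r := by
  obtain ⟨l', h1, rfl⟩ := h
  obtain ⟨p', r', rfl, rfl, rfl⟩ := List.map_eq_append_iff.1 h1.symm
  exact ⟨_, _, by simp, ⟨p', rfl, rfl⟩, ⟨r', rfl, rfl⟩⟩

lemma HomogList.of_mem_splits {l : List (Tot V)} {n : ℤ} (h : HomogList V n l)
    {s : List (Tot V) × List (Tot V)} (hs : s ∈ splits l) :
    ∃ a c, a + c = n ∧ HomogList V a s.1 ∧ HomogList V c s.2 :=
  HomogList.of_append (by rwa [mem_splits hs])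

lemma HomogList.map {l : List (Tot V)} {n : ℤ} (h : HomogList V n l) {f : Tot V →ₗ[k] Tot W}
    (hf : ∀ i x, f (el V i x) ∈ homog W i) : HomogList W n (l.map f) := by
  obtain ⟨l', rfl, rfl⟩ := h
  induction l' with
  | nil => exact HomogList.nil
  | cons a l' ih => exact HomogList.cons (hf a.1 a.2) ih

lemma HomogList.tw {l : List (Tot V)} {n : ℤ} (h : HomogList V n l) :
    HomogList V n (tw V l) := by
  obtain ⟨l', rfl, rfl⟩ := h
  induction l' with
  | nil => exact HomogList.nil
  | cons a l' ih => exact HomogList.cons (sgn_mem_homog _ ⟨a.2, rfl⟩) ih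

namespace Ops

variable {c c' c'' : ℤ}

lemma mem_homog (f : Ops V W c) {l : List (Tot V)} {n : ℤ} (h : HomogList V n l) :
    f.op l ∈ homog W (n + c - l.length) := by
  obtain ⟨l', rfl, rfl⟩ := h
  simpa using f.degree l'

/-- A constructor for graded families of multilinear maps. -/
def mkHomog (φ : List (Tot V) → Tot W) (h0 : φ [] = 0) (hφ : Multilin k φ)
    (hd : ∀ n l, HomogList V n l → φ l ∈ homog W (n + c - l.length)) : Ops V W c where
  op := φ
  nil := h0
  multilin := hφ
  degree l := by simpa using hd _ _ ⟨l, rfl, rfl⟩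

/-- The family on the suspension, on which most signs disappear. -/
def twist (f : Ops V W c) : Ops V W c :=
  mkHomog (fun l => f.op (tw V l)) f.nil f.multilin.comp_tw fun n l h => by
    simpa using f.mem_homog h.tw

lemma twist_op (f : Ops V W c) (l : List (Tot V)) : f.twist.op l = f.op (tw V l) := rfl

lemma twist_twist (f : Ops V W c) : f.twist.twist = f :=
  Ops.ext (funext fun l => congrArg f.op (tw_tw l))

instance : Zero (Ops V W c) :=
  ⟨mkHomog (fun _ => 0) rfl Multilin.zero_fun fun _ _ _ => zero_mem _⟩

/-- The sum of two families. -/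
def add (f g : Ops V W c) : Ops V W c :=
  mkHomog (fun l => f.op l + g.op l) (by simp [f.nil, g.nil]) (f.multilin.add_fun g.multilin)
    fun _ _ h => Submodule.add_mem _ (f.mem_homog h) (g.mem_homog h)

/-- The difference of two families. -/
def sub (f g : Ops V W c) : Ops V W c :=
  mkHomog (fun l => f.op l - g.op l) (by simp [f.nil, g.nil]) (f.multilin.sub_fun g.multilin)
    fun _ _ h => Submodule.sub_mem _ (f.mem_homog h) (g.mem_homog h)

/-- Postcomposition with a linear map of degree `c' - c`. -/
def postcomp (f : Ops V W c) (g : Tot W →ₗ[k] Tot X)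
    (hg : ∀ i x, g (el W i x) ∈ homog X (i + (c' - c))) : Ops V X c' :=
  mkHomog (fun l => g (f.op l)) (by simp [f.nil]) (f.multilin.comp_linear g) fun n l h => by
    convert mem_homog_of_degree (e := fun i => i + (c' - c)) hg (f.mem_homog h) using 2
    ring

/-- A linear map as a family concentrated in arity `1`. -/
def unary (g : Tot V →ₗ[k] Tot W) (hg : ∀ i x, g (el V i x) ∈ homog W (i + (c - 1))) :
    Ops V W c where
  op
    | [x] => g x
    | _ => 0
  nil := rfl
  multilin := by
    constructor
    · intro p x y r
      rcases p with _ | ⟨a, p⟩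
      · cases r <;> simp
      · cases p <;> simp
    · intro p c x r
      rcases p with _ | ⟨a, p⟩
      · cases r <;> simp
      · cases p <;> simp
  degree l := by
    rcases l with _ | ⟨a, _ | ⟨b, l⟩⟩
    · simp
    · simpa [add_sub_assoc] using hg a.1 a.2
    · simp

lemma unary_single (g : Tot V →ₗ[k] Tot W) (hg : ∀ i x, g (el V i x) ∈ homog W (i + (c - 1)))
    (x : Tot V) : (unary g hg).op [x] = g x := rfl

lemma unary_cons_cons (g : Tot V →ₗ[k] Tot W)
    (hg : ∀ i x, g (el V i x) ∈ homog W (i + (c - 1))) (x y : Tot V) (l : List (Tot V)) :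
    (unary g hg).op (x :: y :: l) = 0 := rfl

/-- `insertAlong` for graded families. -/
def insert (σ : Tot V →ₗ[k] Tot V) (hσ : ∀ i x, σ (el V i x) ∈ homog V i) (b : Ops V V c)
    (φ : Ops V W c') (hc : c + c' - 1 = c'') : Ops V W c'' :=
  mkHomog (insertAlong σ b.op φ.op)
    (by rw [insertAlong_nil, b.nil, φ.multilin.eq_zero (by simp)])
    (multilin_insertAlong σ b.multilin φ.multilin) fun n l h => by
      refine lsum_mem _ fun s hs => lsum_mem _ fun t ht => ?_
      obtain ⟨n₁, n₂, rfl, h₁, h₂⟩ := h.of_mem_splits hs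
      obtain ⟨n₃, n₄, rfl, h₃, h₄⟩ := h₂.of_mem_splits ht
      convert φ.mem_homog ((h₁.map hσ).append (HomogList.cons (b.mem_homog h₃) h₄)) using 2
      rw [← length_mem_splits hs, ← length_mem_splits ht]
      simp only [List.length_append, List.length_map, List.length_cons]
      push_cast
      rw [← hc]
      ring

/-- The minus sign in `ssgn` contributes one factor per entry, which cancels the dependence of the
degree `c - n` on the arity `n`. On suspensions every family thus has a single parity. -/
lemma ssgn_comm' (f : Ops V W c) (l : List (Tot V)) :
    f.op (l.map (ssgn V)) = (-1 : k) ^ (c.natAbs + 1) • ssgn W (f.op l) := by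
  have e2 := f.multilin.smul_map_const [] [] (l.map (sgn V 1)) (-1 : k)
  simp only [List.nil_append, List.append_nil] at e2
  rw [map_ssgn, e2, f.sgn_comm, smul_smul, ← pow_add, List.length_map]
  have : (ssgn W (f.op l)) = (-1 : k) • sgn W 1 (f.op l) := by simp [ssgn]
  rw [this, smul_smul, ← pow_succ]
  congr 1
  apply neg_one_pow_congr
  simp only [Nat.even_add, Nat.even_mul, Nat.not_even_one]
  tauto

lemma op_ssgn_of_one (f : Ops V W 1) (l : List (Tot V)) :
    f.op (l.map (ssgn V)) = ssgn W (f.op l) := by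
  rw [ssgn_comm']; simp

lemma op_ssgn_of_two (f : Ops V W 2) (l : List (Tot V)) :
    f.op (l.map (ssgn V)) = - ssgn W (f.op l) := by
  rw [ssgn_comm', show (2 : ℤ).natAbs = 2 from rfl]
  simp [pow_succ]

/-- Composition of families on suspensions. -/
def barComp (f : Ops V W 1) (φ : Ops W X c) : Ops V X c := (Ops.comp f.twist φ.twist).twist

lemma barComp_op (f : Ops V W 1) (φ : Ops W X c) : (f.barComp φ).op = barBlock f.op φ.op := by
  funext l
  refine (blockSum_tw f.twist φ.twist.multilin l).trans ?_
  simp only [twist_op, tw_tw]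

/-- An operator on families whose value on lists of length at most `n` only depends on the values
on lists of length less than `n` has a fixed point. -/
lemma exists_fixedPoint (T : Ops V W c → Ops V W c)
    (hT : ∀ (f g : Ops V W c) (l : List (Tot V)),
      (∀ l', l'.length < l.length → f.op l' = g.op l') → (T f).op l = (T g).op l) :
    ∃ f, T f = f := by
  -- Iterating `T` stabilizes: on lists of length at most `n`, all iterates from the `n`-th on
  -- agree.
  have key : ∀ n m (l : List (Tot V)), l.length ≤ n → l.length ≤ m →
      (T^[n] 0).op l = (T^[m] 0).op l := by
    intro n
    induction n with
    | zero =>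
      intro m l h _
      obtain rfl := List.length_eq_zero_iff.1 (Nat.le_zero.1 h)
      rw [Ops.nil, Ops.nil]
    | succ n ih =>
      intro m l h1 h2
      cases m with
      | zero =>
        obtain rfl := List.length_eq_zero_iff.1 (Nat.le_zero.1 h2)
        rw [Ops.nil, Ops.nil]
      | succ m =>
        rw [Function.iterate_succ_apply', Function.iterate_succ_apply']
        exact hT _ _ _ fun l' hl' => ih m l' (by omega) (by omega)
  -- The fixed point is the diagonal limit: on lists of length `n` it is the `n`-th iterate.
  -- Multilinearity and degree concern one length at a time, so they are inherited.
  let f : Ops V W c := mkHomog (fun l => (T^[l.length] 0).op l) (Ops.nil _)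
    ⟨fun p x y r => by
      simp only [List.length_append, List.length_cons, Ops.multilin _ |>.add],
    fun p a x r => by
      simp only [List.length_append, List.length_cons, Ops.multilin _ |>.smul]⟩
    fun n l h => Ops.mem_homog _ h
  refine ⟨f, Ops.ext (funext fun l => ?_)⟩
  rw [hT f (T^[l.length] 0) l fun l' hl' => key _ _ _ le_rfl hl'.le,
    ← Function.iterate_succ_apply' T]
  exact key _ _ _ (Nat.le_succ _) le_rfl

end Ops

end GradedFamilies

/-! ### Homotopy transfer: the structure on `H` and the extension of `i` -/

section Transfer

variable {k : Type u} [Field k]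

/-! ### Differential graded algebras on suspensions -/

namespace DGAlg

variable (A : DGAlg k)

lemma sgn_mul (n : ℕ) (x y : Tot A.V) :
    sgn A.V n (A.mul x y) = A.mul (sgn A.V n x) (sgn A.V n y) := by
  have h : A.mul (sgn A.V n x) (sgn A.V n y) = (-1 : k) ^ (n * 4) • sgn A.V n (A.mul x y) :=
    A.aInf.str.toOps.sgn_comm n [x, y]
  rw [h, Even.neg_one_pow ⟨n * 2, by ring⟩, one_smul]

lemma d_sgn_one (x : Tot A.V) : A.d (sgn A.V 1 x) = - sgn A.V 1 (A.d x) := by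
  have h : A.d (sgn A.V 1 x) = (-1 : k) ^ (1 * 3) • sgn A.V 1 (A.d x) :=
    A.aInf.str.toOps.sgn_comm 1 [x]
  rw [h, Odd.neg_one_pow (by decide), neg_one_smul]

/-- The operations on the suspension. -/
def bar : Ops A.V A.V 2 := A.aInf.str.toOps.twist

lemma bar_one (x : Tot A.V) : A.bar.op [x] = A.d x := by
  change A.aInf.str.op [sgn A.V 0 x] = _
  rw [sgn_zero]
  rfl

lemma bar_two (x y : Tot A.V) : A.bar.op [x, y] = A.mul (sgn A.V 1 x) y := by
  change A.aInf.str.op [sgn A.V 1 x, sgn A.V 0 y] = _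
  rw [sgn_zero]
  rfl

lemma sgn_one_sgn_one (V : GrVect k) (x : Tot V) : sgn V 1 (sgn V 1 x) = x := by
  rw [sgn_sgn, sgn_even V (a := 1 + 1) even_two, LinearMap.id_apply]

lemma lsum_mul {ι : Type*} (L : List ι) (f : ι → Tot A.V) (y : Tot A.V) :
    A.mul (lsum L f) y = lsum L fun s => A.mul (f s) y :=
  map_lsum (A.mul.flip y) L f

lemma mul_lsum {ι : Type*} (L : List ι) (x : Tot A.V) (f : ι → Tot A.V) :
    A.mul x (lsum L f) = lsum L fun s => A.mul x (f s) :=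
  map_lsum (A.mul x) L f

lemma sgn_lsum {ι : Type*} (V : GrVect k) (n : ℕ) (L : List ι) (f : ι → Tot V) :
    sgn V n (lsum L f) = lsum L fun s => sgn V n (f s) :=
  map_lsum (sgn V n) L f

lemma bar_three (x y z : Tot A.V) (l : List (Tot A.V)) : A.bar.op (x :: y :: z :: l) = 0 := rfl

variable {A} {H : GrVect k}

/-- The sum of `μ ∘ (F_s ⊗ F_t)` over `s + t = n` on suspensions. -/
def prodSum (A : DGAlg k) {H : GrVect k} (F : Ops H A.V 1) : Ops H A.V 2 :=
  Ops.mkHomog (fun l => lsum (splits l) fun s => A.mul (sgn A.V 1 (F.op s.1)) (F.op s.2))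
    (by simp [splits, F.nil])
    (multilin_lsum_splits (Ψ := fun p r => A.mul (sgn A.V 1 (F.op p)) (F.op r))
      (fun r => ⟨fun p x y q => by simp [F.multilin.add], fun p c x q => by simp [F.multilin.smul]⟩)
      fun p => F.multilin.comp_linear _)
    fun n l h => by
      refine lsum_mem _ fun s hs => ?_
      obtain ⟨a, c, rfl, ha, hc⟩ := h.of_mem_splits hs
      obtain ⟨x, hx⟩ := sgn_mem_homog 1 (F.mem_homog ha)
      obtain ⟨y, hy⟩ := F.mem_homog hc
      rw [← hx, ← hy]
      convert A.mul_degree _ _ x y using 2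
      rw [← length_mem_splits hs]
      push_cast
      ring

lemma prodSum_op (F : Ops H A.V 1) (l : List (Tot H)) :
    (A.prodSum F).op l = lsum (splits l) fun s => A.mul (sgn A.V 1 (F.op s.1)) (F.op s.2) := rfl

/-- The cut falls to the right or to the left of `x`. In the second case the left factor sees only
entries hit by `ssgn`, which commutes with `F`; composed with `sgn` it gives `-1`, whence the minus
sign of the derivation rule. -/
lemma prodSum_append_cons (F : Ops H A.V 1) (p r : List (Tot H)) (x : Tot H) :
    (A.prodSum F).op (p.map (ssgn H) ++ x :: r) =
      lsum (splits r) (fun s =>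
        A.mul (sgn A.V 1 (F.op (p.map (ssgn H) ++ x :: s.1))) (F.op s.2)) -
      lsum (splits p) (fun s => A.mul (F.op s.1) (F.op (s.2.map (ssgn H) ++ x :: r))) := by
  have e : ∀ x, sgn A.V 1 (ssgn A.V x) = - x := by
    intro x
    change sgn A.V 1 (-(sgn A.V 1 x)) = _
    rw [map_neg, sgn_one_sgn_one]
  rw [prodSum_op, lsum_splits_append_cons _ _ _ fun u v => A.mul (sgn A.V 1 (F.op u)) (F.op v),
    splits_map, lsum_map, sub_eq_neg_add, ← lsum_neg]
  simp only [Ops.op_ssgn_of_one, e, map_neg, LinearMap.neg_apply]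

lemma prodSum_single (F : Ops H A.V 1) (x : Tot H) : (A.prodSum F).op [x] = 0 := by
  simp [prodSum_op, splits, F.nil]

/-- A family vanishes on the empty list, so only cuts into two nonempty, hence strictly shorter,
pieces contribute. This makes the recursion for the extension of `i` well founded. -/
lemma prodSum_congr {F G : Ops H A.V 1} {l : List (Tot H)}
    (h : ∀ l', l'.length < l.length → F.op l' = G.op l') :
    (A.prodSum F).op l = (A.prodSum G).op l := by
  rw [prodSum_op, prodSum_op]
  refine lsum_congr fun s hs => ?_
  have hl := length_mem_splits hs
  rcases h1 : s.1 with _ | ⟨a, p⟩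
  · simp [Ops.nil]
  rcases h2 : s.2 with _ | ⟨a', r⟩
  · simp [Ops.nil]
  rw [h1, h2] at hl
  rw [h (a :: p) (by simp at hl ⊢; omega), h (a' :: r) (by simp at hl ⊢; omega)]

/-- The operations of a dg-algebra stop at arity two, so only decompositions into one block (giving
`d`) or two blocks (giving the product) survive. -/
lemma barBlock_bar (F : Ops H A.V 1) (l : List (Tot H)) :
    barBlock F.op A.bar.op l = A.d (F.op l) + (A.prodSum F).op l := by
  cases l with
  | nil => simp [barBlock, parts, Ops.nil]
  | cons x l =>
    unfold barBlock
    rw [parts_cons]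
    have key : ∀ t ∈ splits l, (lsum (parts t.2) fun s =>
        A.bar.op (((x :: t.1) :: s).map F.op)) =
        -- The `match` records the one-block term, present only when nothing remains; there the
        -- product term is zero because `F` vanishes on the empty list.
        (match t.2 with
          | [] => A.d (F.op (x :: t.1))
          | _ => 0) + A.mul (sgn A.V 1 (F.op (x :: t.1))) (F.op t.2) := by
      rintro ⟨p, r⟩ _
      cases r with
      | nil => simp [parts, bar_one, Ops.nil]
      | cons y r =>
        rw [lsum_parts_single]
        · simp [bar_two]
        · intro B C s
          simp [bar_three]
    rw [lsum_congr key, lsum_add, prodSum_op, splits, lsum_cons, lsum_map, F.nil, map_zero,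
      map_zero, LinearMap.zero_apply, zero_add]
    refine congrArg (· + _) ?_
    exact lsum_splits_of_right (Ψ := fun p r => match r with
          | [] => A.d (F.op (x :: p))
          | _ => 0) (fun _ _ _ => rfl)

/-- Moving the extra `sgn 1` of `λ_n` out of the left factor `F` costs `(-1)^{1 + s}`, which is
exactly the sign `(-1)^{s + 1}` in the definition of `λ_n`. -/
lemma prodSum_tw (F : Ops H A.V 1) (l : List (Tot H)) :
    (A.prodSum F).op (tw H l) = transferKernel (A := A) F.twist.op l := by
  rw [prodSum_op, transferKernel, splits_tw, lsum_map]
  refine lsum_congr fun s _ => ?_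
  dsimp only
  rw [Ops.twist_op, Ops.twist_op, tw_map_sgn, add_comm s.2.length 1, ← map_map_sgn,
    F.sgn_comm 1, map_smul, LinearMap.smul_apply, smul_smul, ← pow_add, Even.neg_one_pow, one_smul]
  simp only [List.length_map, length_tw, Int.natAbs_one, Nat.even_add, Nat.even_mul,
    Nat.not_even_one]
  tauto

end DGAlg

/-- A summand evaluates `φ` on `p + 1 + r` entries, so only `p = r = 0` survives. -/
lemma insertAlong_of_unary {A M : Type*} [AddCommGroup A] [Module k A] [AddCommGroup M]
    {σ : A →ₗ[k] A} {b : List A → A} {φ : List A → M}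
    (hφ : ∀ x y l, φ (x :: y :: l) = 0) (l : List A) : insertAlong σ b φ l = φ [b l] := by
  have h : ∀ (p r : List A) (x : A), p ≠ [] → φ (p.map σ ++ x :: r) = 0 := by
    intro p r x hp
    obtain ⟨a, p, rfl⟩ := List.exists_cons_of_ne_nil hp
    cases p <;> simp [hφ]
  unfold insertAlong
  rw [lsum_splits_of_left (Ψ := fun p r => lsum (splits r) fun t => φ (p.map σ ++ b t.1 :: t.2))]
  · rw [lsum_splits_of_right (Ψ := fun p r => φ (([] : List A).map σ ++ b p :: r))]
    · rfl
    · intro p x r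
      exact hφ _ _ _
  · intro p x r
    exact lsum_eq_zero fun t _ => h _ _ _ (by simp)

/-! ### The transferred structure and the extension of `i` -/

namespace TransDatum

variable (D : TransDatum k)

/-- The recursion for the extension of `i`. -/
def iStep (F : Ops D.c.H D.A.V 1) : Ops D.c.H D.A.V 1 :=
  (Ops.unary D.c.i (by simpa using D.c.i_degree)).add
    ((D.A.prodSum F).postcomp D.c.h D.c.h_degree)

lemma exists_iBar : ∃ F, D.iStep F = F :=
  Ops.exists_fixedPoint _ fun F G l h => by
    change _ + D.c.h ((D.A.prodSum F).op l) = _ + D.c.h ((D.A.prodSum G).op l)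
    rw [DGAlg.prodSum_congr h]

/-- The extension of `i`, on suspensions. -/
noncomputable def iBar : Ops D.c.H D.A.V 1 := D.exists_iBar.choose

/-- The sums `λ_n`, on suspensions. -/
noncomputable def kernelBar : Ops D.c.H D.A.V 2 := D.A.prodSum D.iBar

/-- The transferred structure, on suspensions. -/
noncomputable def mBar : Ops D.c.H D.c.H 2 :=
  D.kernelBar.postcomp D.c.p (by simpa using D.c.p_degree)

lemma iBar_op (l : List (Tot D.c.H)) :
    D.iBar.op l = (Ops.unary (c := 1) D.c.i (by simpa using D.c.i_degree)).op l +
      D.c.h (D.kernelBar.op l) :=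
  (congrArg (fun F : Ops D.c.H D.A.V 1 => F.op l) D.exists_iBar.choose_spec).symm

lemma kernelBar_single (x : Tot D.c.H) : D.kernelBar.op [x] = 0 := DGAlg.prodSum_single _ _

lemma iBar_single (x : Tot D.c.H) : D.iBar.op [x] = D.c.i x := by
  rw [iBar_op, kernelBar_single, map_zero, add_zero, Ops.unary_single]

lemma iBar_cons_cons (x y : Tot D.c.H) (l : List (Tot D.c.H)) :
    D.iBar.op (x :: y :: l) = D.c.h (D.kernelBar.op (x :: y :: l)) := by
  rw [iBar_op, Ops.unary_cons_cons, zero_add]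

lemma mBar_op (l : List (Tot D.c.H)) : D.mBar.op l = D.c.p (D.kernelBar.op l) := rfl

lemma mBar_single (x : Tot D.c.H) : D.mBar.op [x] = 0 := by
  rw [mBar_op, kernelBar_single, map_zero]

/-- The values of the recursion lie in the images of `i` and `h`, both killed by `h`. This is why
the extension of `p` reduces to `p` on them. -/
lemma h_iBar (l : List (Tot D.c.H)) : D.c.h (D.iBar.op l) = 0 := by
  rcases l with _ | ⟨x, _ | ⟨y, l⟩⟩
  · simp [Ops.nil]
  · rw [iBar_single, D.c.h_i]
  · rw [iBar_cons_cons, D.c.h_h]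

lemma d_unary_i (l : List (Tot D.c.H)) :
    D.A.d ((Ops.unary (c := 1) D.c.i (by simpa using D.c.i_degree)).op l) = 0 := by
  rcases l with _ | ⟨x, _ | ⟨y, l⟩⟩
  · simp [Ops.nil]
  · exact D.c.d_i x
  · simp [Ops.unary_cons_cons]

/-- Inserting `m = p λ` into `i + h λ` gives `i p λ - h d λ` by the hypothesis, and this is `λ + d h
λ` by the homotopy relation; finally `d i = 0`. The hypothesis is about the list `l` only, so the
lemma can be used inside the induction which proves that hypothesis. -/
lemma insertAlong_iBar_of {l : List (Tot D.c.H)}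
    (h : D.A.d (D.kernelBar.op l) =
      - insertAlong (ssgn D.c.H) D.mBar.op D.kernelBar.op l) :
    insertAlong (ssgn D.c.H) D.mBar.op D.iBar.op l = D.A.d (D.iBar.op l) + D.kernelBar.op l := by
  have e : D.iBar.op = fun l => (Ops.unary (c := 1) D.c.i (by simpa using D.c.i_degree)).op l +
      D.c.h (D.kernelBar.op l) := funext D.iBar_op
  rw [e, insertAlong_add_fun, insertAlong_of_unary fun _ _ _ => rfl, Ops.unary_single,
    insertAlong_comp, map_add, d_unary_i, zero_add, mBar_op]
  rw [eq_neg_iff_add_eq_zero, add_comm, ← eq_neg_iff_add_eq_zero] at h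
  rw [h, map_neg, ← sub_eq_add_neg, sub_eq_iff_eq_add]
  have := D.c.homotopy (D.kernelBar.op l)
  rw [sub_eq_iff_eq_add] at this
  rw [this]
  abel

/-- Both sides are the sum of all triple products over cuts into three pieces, by associativity in
`A`. -/
lemma kernelBar_assoc (l : List (Tot D.c.H)) :
    (lsum (splits l) fun s => D.A.mul (sgn D.A.V 1 (D.kernelBar.op s.1)) (D.iBar.op s.2)) =
      lsum (splits l) fun s => D.A.mul (D.iBar.op s.1) (D.kernelBar.op s.2) := by
  simp only [kernelBar, DGAlg.prodSum_op, DGAlg.sgn_lsum, DGAlg.lsum_mul, DGAlg.mul_lsum,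
    DGAlg.sgn_mul, DGAlg.sgn_one_sgn_one, D.A.assoc]
  exact splits_coassoc l fun a b c => D.A.mul (D.iBar.op a)
    (D.A.mul (sgn D.A.V 1 (D.iBar.op b)) (D.iBar.op c))

/-- The inserted operation lands in one of the two factors of the product, the second case carrying
the sign of `prodSum_append_cons`; reassociating the cuts isolates that factor. -/
lemma insertAlong_kernelBar (l : List (Tot D.c.H)) :
    insertAlong (ssgn D.c.H) D.mBar.op D.kernelBar.op l =
      (lsum (splits l) fun s => D.A.mul (sgn D.A.V 1
        (insertAlong (ssgn D.c.H) D.mBar.op D.iBar.op s.1)) (D.iBar.op s.2)) -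
      lsum (splits l) fun s => D.A.mul (D.iBar.op s.1)
        (insertAlong (ssgn D.c.H) D.mBar.op D.iBar.op s.2) := by
  simp only [insertAlong, kernelBar, DGAlg.prodSum_append_cons, lsum_sub, DGAlg.sgn_lsum,
    DGAlg.lsum_mul, DGAlg.mul_lsum]
  congr 1
  · rw [splits_coassoc l fun a b c => lsum (splits b) fun t => D.A.mul (sgn D.A.V 1
      (D.iBar.op (a.map (ssgn D.c.H) ++ D.mBar.op t.1 :: t.2))) (D.iBar.op c)]
    refine lsum_congr fun s _ => ?_
    exact (splits_coassoc s.2 fun a b c => D.A.mul (sgn D.A.V 1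
      (D.iBar.op (s.1.map (ssgn D.c.H) ++ D.mBar.op a :: b))) (D.iBar.op c)).symm
  · rw [← splits_coassoc l fun a b c => lsum (splits c) fun t => D.A.mul (D.iBar.op a)
      (D.iBar.op (b.map (ssgn D.c.H) ++ D.mBar.op t.1 :: t.2))]
    exact lsum_congr fun s _ => lsum_comm _ _ _

/-- The key identity. Leibniz reduces `d λ` to `d F` on shorter lists, which `insertAlong_iBar_of`
rewrites as the insertion of `m` into `F` minus `λ`. The insertions assemble to the right-hand side
by `insertAlong_kernelBar`, while the terms in `λ` cancel by `kernelBar_assoc`. -/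
lemma d_kernelBar (l : List (Tot D.c.H)) :
    D.A.d (D.kernelBar.op l) = - insertAlong (ssgn D.c.H) D.mBar.op D.kernelBar.op l := by
  induction hn : l.length using Nat.strong_induction_on generalizing l with
  | _ n ih =>
  subst hn
  have hd : ∀ l' : List (Tot D.c.H), l'.length < l.length → D.A.d (D.iBar.op l') =
      insertAlong (ssgn D.c.H) D.mBar.op D.iBar.op l' - D.kernelBar.op l' := fun l' hl' => by
    rw [D.insertAlong_iBar_of (ih _ hl' l' rfl), add_sub_cancel_right]
  have key : ∀ s ∈ splits l, D.A.d (D.A.mul (sgn D.A.V 1 (D.iBar.op s.1)) (D.iBar.op s.2)) =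
      (D.A.mul (D.iBar.op s.1) (insertAlong (ssgn D.c.H) D.mBar.op D.iBar.op s.2) -
      D.A.mul (sgn D.A.V 1 (insertAlong (ssgn D.c.H) D.mBar.op D.iBar.op s.1))
        (D.iBar.op s.2)) +
      (D.A.mul (sgn D.A.V 1 (D.kernelBar.op s.1)) (D.iBar.op s.2) -
        D.A.mul (D.iBar.op s.1) (D.kernelBar.op s.2)) := by
    intro s hs
    have hl := length_mem_splits hs
    -- Cuts with an empty piece contribute zero on both sides; the remaining pieces are strictly
    -- shorter than `l`, as the induction requires.
    have h0 : insertAlong (ssgn D.c.H) D.mBar.op D.iBar.op [] = 0 := by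
      rw [insertAlong_nil, Ops.nil, iBar_single, map_zero]
    rcases h1 : s.1 with _ | ⟨a, p⟩
    · simp [Ops.nil, h0]
    rcases h2 : s.2 with _ | ⟨a', r⟩
    · simp [Ops.nil, h0]
    rw [h1, h2] at hl
    rw [D.A.leibniz, D.A.d_sgn_one, hd _ (by simp at hl ⊢; omega),
      hd (a' :: r) (by simp at hl ⊢; omega), DGAlg.sgn_one_sgn_one]
    simp only [map_sub, map_neg, LinearMap.neg_apply, LinearMap.sub_apply]
    abel
  rw [insertAlong_kernelBar]
  conv_lhs => rw [kernelBar, DGAlg.prodSum_op, map_lsum]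
  rw [lsum_congr key, lsum_add, lsum_sub, lsum_sub, kernelBar_assoc, sub_self, add_zero, neg_sub]

lemma insertAlong_iBar (l : List (Tot D.c.H)) :
    insertAlong (ssgn D.c.H) D.mBar.op D.iBar.op l = barBlock D.iBar.op D.A.bar.op l := by
  rw [D.insertAlong_iBar_of (D.d_kernelBar l), DGAlg.barBlock_bar]
  rfl

/-- Apply `p` to `d_kernelBar` and use `p d = 0`. -/
lemma insertAlong_mBar (l : List (Tot D.c.H)) :
    insertAlong (ssgn D.c.H) D.mBar.op D.mBar.op l = 0 := by
  have e : D.mBar.op = fun l => D.c.p (D.kernelBar.op l) := funext D.mBar_op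
  conv_lhs => rw [e, insertAlong_comp, ← e]
  have h := D.d_kernelBar l
  rw [eq_neg_iff_add_eq_zero, add_comm, ← eq_neg_iff_add_eq_zero] at h
  rw [h, map_neg, D.c.p_d, neg_zero]

/-- The transferred structure. -/
noncomputable def m : AInfStr D.c.H where
  toOps := D.mBar.twist
  rel l := by
    obtain ⟨l, rfl⟩ := tw_surjective l
    rw [insertSum_tw _ D.mBar.twist.multilin]
    refine Eq.trans ?_ (D.insertAlong_mBar l)
    simp only [Ops.twist_op, tw_tw]
    rfl

/-- The transferred `A_∞`-algebra. -/
noncomputable abbrev transferred : AInfAlg k := ⟨D.c.H, D.m⟩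

/-- The extension of `i` to an `∞`-morphism. -/
noncomputable def iInf : D.transferred ⟶ (dgToAInf k).obj D.A where
  toOps := D.iBar.twist
  rel l := by
    obtain ⟨l, rfl⟩ := tw_surjective l
    refine (insertSum_tw D.m.toOps D.iBar.twist.multilin l).trans ?_
    refine Eq.trans ?_ (blockSum_tw D.iBar.twist D.A.aInf.str.multilin l).symm
    simp only [Ops.twist_op, tw_tw]
    refine Eq.trans ?_ (D.insertAlong_iBar l)
    change barInsert (fun l => D.mBar.twist.op (tw _ l)) D.iBar.op l = _
    simp only [Ops.twist_op, tw_tw]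
    rfl

lemma isTransferred : IsTransferred D D.m D.iInf where
  m_one x := by
    change D.mBar.op (tw _ [x]) = 0
    simp [tw, mBar_single]
  f_one x := by
    change D.iBar.op (tw _ [x]) = _
    simp [tw, iBar_single]
  m_op x y l := by
    change D.c.p (D.kernelBar.op (tw _ (x :: y :: l))) = _
    rw [kernelBar, DGAlg.prodSum_tw]
    rfl
  f_op x y l := by
    change D.iBar.op (tw _ (x :: y :: l)) = D.c.h (transferKernel D.iBar.twist.op (x :: y :: l))
    rw [← DGAlg.prodSum_tw, tw, tw, iBar_cons_cons]
    rfl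

end TransDatum

end Transfer

/-! ### Insertions and decompositions into blocks -/

section BarIdentities

variable {k : Type u} [Field k] {V W : GrVect k} {M : Type*} [AddCommGroup M] [Module k M]

lemma ssgn_ssgn (x : Tot V) : ssgn V (ssgn V x) = x := by
  change -(sgn V 1 (-(sgn V 1 x))) = x
  rw [map_neg, neg_neg, DGAlg.sgn_one_sgn_one]

lemma insertAlong_cons_of_nil {A : Type*} [AddCommGroup A] [Module k A] {σ : A →ₗ[k] A}
    {b : List A → A} (b0 : b [] = 0) {φ : List A → M} (hφ : Multilin k φ) (x : A) (l : List A) :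
    insertAlong σ b φ (x :: l) = lsum (splits l) (fun s => φ (b (x :: s.1) :: s.2)) +
      insertAlong σ b (fun r => φ (σ x :: r)) l := by
  have h0 : ∀ l, φ (0 :: l) = 0 := hφ.zero []
  rw [insertAlong_cons, splits, lsum_cons, lsum_map, b0, h0, zero_add]

lemma Multilin.lsum_head {A ι : Type*} [AddCommGroup A] [Module k A] {φ : List A → M}
    (hφ : Multilin k φ) (L : List ι) (f : ι → A) (r : List A) :
    φ (AInf.lsum L f :: r) = AInf.lsum L fun i => φ (f i :: r) :=
  hφ.lsum [] r L f

/-- The coderivation extending an `A_∞`-structure squares to zero. -/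
lemma insertAlong_insertAlong {b : Ops V V 2}
    (hb : ∀ l, insertAlong (ssgn V) b.op b.op l = 0) {φ : List (Tot V) → M} (hφ : Multilin k φ)
    (l : List (Tot V)) :
    insertAlong (ssgn V) b.op (insertAlong (ssgn V) b.op φ) l = 0 := by
  induction l generalizing φ with
  | nil =>
    rw [insertAlong_nil, (multilin_insertAlong (ssgn V) b.multilin hφ).eq_zero (by simp [b.nil])]
  | cons x l ih =>
    have e := fun (y : Tot V) (l : List (Tot V)) =>
      insertAlong_cons_of_nil (σ := ssgn V) b.nil hφ y l
    rw [insertAlong_cons_of_nil b.nil (multilin_insertAlong (ssgn V) b.multilin hφ)]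
    simp only [e, insertAlong_add_fun, lsum_add, ssgn_ssgn]
    -- The terms in which both insertions pass over `x` vanish by induction; there the two signs on
    -- `x` cancel.
    rw [ih (hφ.cons x), add_zero]
    -- Here the operation applied first passes over `x` and the one applied second starts at it. The
    -- second block either stops before the inserted value or contains it. In the former case the
    -- odd degree of `b` gives a minus sign, so these terms cancel those in which the two operations
    -- are applied in the opposite order.
    have h1 : insertAlong (ssgn V) b.op
        (fun r => lsum (splits r) fun s => φ (b.op (ssgn V x :: s.1) :: s.2)) l =
        - (lsum (splits l) fun s => insertAlong (ssgn V) b.op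
          (fun r => φ (ssgn V (b.op (x :: s.1)) :: r)) s.2) +
        lsum (splits l) fun s => lsum (splits s.2) fun t => lsum (splits t.2) fun r =>
          φ (b.op (ssgn V x :: (s.1.map (ssgn V) ++ b.op t.1 :: r.1)) :: r.2) := by
      have h2 : ∀ (p r : List (Tot V)) (y : Tot V),
          (lsum (splits (p.map (ssgn V) ++ y :: r)) fun s =>
            φ (b.op (ssgn V x :: s.1) :: s.2)) =
          - (lsum (splits p) fun s =>
            φ (ssgn V (b.op (x :: s.1)) :: (s.2.map (ssgn V) ++ y :: r))) +
          lsum (splits r) fun s =>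
            φ (b.op (ssgn V x :: (p.map (ssgn V) ++ y :: s.1)) :: s.2) := by
        intro p r y
        rw [lsum_splits_append_cons _ _ _ fun u v => φ (b.op (ssgn V x :: u) :: v), splits_map,
          lsum_map, ← lsum_neg]
        congr 1
        refine lsum_congr fun s _ => ?_
        have h3 := b.op_ssgn_of_two (x :: s.1)
        rw [List.map_cons] at h3
        rw [h3]
        exact map_neg (hφ.slot [] _) _
      simp only [insertAlong, h2, lsum_add, lsum_neg]
      congr 2
      rw [← splits_coassoc l fun a c d => lsum (splits d) fun t =>
        φ (ssgn V (b.op (x :: a)) :: (c.map (ssgn V) ++ b.op t.1 :: t.2))]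
      exact lsum_congr fun s _ => lsum_comm _ _ _
    rw [h1]
    -- What remains is nested: one operation acts on the output of the other. For a fixed outer
    -- block `x :: s.1` this is the relation `hb`.
    have h4 : ∀ s : List (Tot V) × List (Tot V),
        (lsum (splits s.1) fun q => φ (b.op (b.op (x :: q.1) :: q.2) :: s.2)) +
        (lsum (splits s.1) fun u => lsum (splits u.2) fun v =>
          φ (b.op (ssgn V x :: (u.1.map (ssgn V) ++ b.op v.1 :: v.2)) :: s.2)) = 0 := by
      intro s
      have h5 := hb (x :: s.1)
      rw [insertAlong_cons_of_nil b.nil b.multilin] at h5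
      have h6 := congrArg (fun y => φ (y :: s.2)) h5
      have h7 := hφ.zero [] s.2
      have h8 := fun y z => hφ.add [] y z s.2
      simp only [List.nil_append] at h7 h8
      simpa only [h7, h8, insertAlong, hφ.lsum_head] using h6
    have h9 := lsum_eq_zero (L := splits l) fun s _ => h4 s
    rw [lsum_add, splits_coassoc l fun a c d => φ (b.op (b.op (x :: a) :: c) :: d),
      splits_coassoc l fun a c d => lsum (splits c) fun v =>
        φ (b.op (ssgn V x :: (a.map (ssgn V) ++ b.op v.1 :: v.2)) :: d)] at h9
    have h10 := lsum_congr (L := splits l) fun s _ => splits_coassoc s.2 fun c d e =>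
        φ (b.op (ssgn V x :: (s.1.map (ssgn V) ++ b.op c :: d)) :: e)
    rw [h10] at h9
    rw [← h9]
    abel

/-- The sum of `φ ∘ ((τ F)^{⊗ p} ⊗ X_q ⊗ F^{⊗ r})`, evaluated on lists. -/
def blockInsert {N : Type*} [AddCommGroup N] (F X : List (Tot V) → Tot W)
    (φ : List (Tot W) → N) (l : List (Tot V)) : N :=
  lsum (splits l) fun s => lsum (parts s.1) fun s₁ => lsum (splits s.2) fun t =>
    lsum (parts t.2) fun s₃ => φ ((s₁.map F).map (ssgn W) ++ X t.1 :: s₃.map F)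

/-- Operating on consecutive values of `F` amounts to cutting the list into three and decomposing
each piece. Together with `insertAlong_barBlock` this puts both sides of a morphism relation in the
form `blockInsert`, where only the middle operations need comparing. -/
lemma barBlock_insertAlong (b' : List (Tot W) → Tot W) (F : List (Tot V) → Tot W)
    {φ : List (Tot W) → M} (hφ : Multilin k φ) (l : List (Tot V)) :
    barBlock F (insertAlong (ssgn W) b' φ) l = blockInsert F (barBlock F b') φ l := by
  simp only [barBlock, insertAlong, blockInsert, splits_map, lsum_map]
  rw [parts_splits l fun s₁ s' => lsum (splits s') fun t =>
    φ ((s₁.map F).map (ssgn W) ++ b' (t.1.map F) :: t.2.map F)]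
  refine lsum_congr fun s _ => lsum_congr fun s₁ _ => ?_
  rw [parts_splits s.2 fun s₂ s₃ =>
    φ ((s₁.map F).map (ssgn W) ++ b' (s₂.map F) :: s₃.map F)]
  refine lsum_congr fun t _ => ?_
  rw [lsum_comm]
  refine lsum_congr fun s₃ _ => ?_
  rw [hφ.lsum]

/-- The inserted value lies in exactly one block; the blocks to its left are made of entries hit by
`ssgn`, which `F` carries to its values. -/
lemma insertAlong_barBlock (b : List (Tot V) → Tot V) {F : List (Tot V) → Tot W}
    (hτ : ∀ l, F (l.map (ssgn V)) = ssgn W (F l)) {φ : List (Tot W) → M} (hφ : Multilin k φ)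
    (l : List (Tot V)) :
    insertAlong (ssgn V) b (barBlock F φ) l =
      blockInsert F (insertAlong (ssgn V) b F) φ l := by
  have hτ' : ∀ s : List (List (Tot V)),
      (s.map (List.map (ssgn V))).map F = (s.map F).map (ssgn W) := by
    intro s
    simp [Function.comp_def, hτ]
  simp only [blockInsert, barBlock, insertAlong, parts_append_cons, splits_map, parts_map, lsum_map,
    List.map_append, List.map_cons, hτ', hφ.lsum]
  rw [lsum_congr fun s _ => lsum_comm (splits s.2) (splits s.1) _]
  rw [splits_coassoc l fun l₁ x r => lsum (splits r) fun t => lsum (splits t.2) fun z =>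
    lsum (parts l₁) fun s₁ => lsum (parts z.2) fun s₃ =>
      φ ((s₁.map F).map (ssgn W) ++ F (x.map (ssgn V) ++ b t.1 :: z.1) :: s₃.map F)]
  refine lsum_congr fun s _ => ?_
  have h1 : ∀ s₁ : List (List (Tot V)), (lsum (splits s.2) fun t => lsum (parts t.2) fun s₃ =>
      lsum (splits t.1) fun x => lsum (splits x.2) fun y =>
        φ ((s₁.map F).map (ssgn W) ++ F (x.1.map (ssgn V) ++ b y.1 :: y.2) :: s₃.map F)) =
      lsum (splits s.2) fun x => lsum (splits x.2) fun y => lsum (splits y.2) fun z =>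
        lsum (parts z.2) fun s₃ =>
          φ ((s₁.map F).map (ssgn W) ++ F (x.1.map (ssgn V) ++ b y.1 :: z.1) :: s₃.map F) := by
    intro s₁
    have h2 : ∀ t : List (Tot V) × List (Tot V), (lsum (parts t.2) fun s₃ =>
        lsum (splits t.1) fun x => lsum (splits x.2) fun y =>
        φ ((s₁.map F).map (ssgn W) ++ F (x.1.map (ssgn V) ++ b y.1 :: y.2) :: s₃.map F)) =
        lsum (splits t.1) fun x => lsum (splits x.2) fun y => lsum (parts t.2) fun s₃ =>
        φ ((s₁.map F).map (ssgn W) ++ F (x.1.map (ssgn V) ++ b y.1 :: y.2) :: s₃.map F) := by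
      intro t
      rw [lsum_comm]
      refine lsum_congr fun x _ => ?_
      rw [lsum_comm]
    rw [lsum_congr fun t _ => h2 t]
    rw [splits_coassoc s.2 fun x y' l₃ => lsum (splits y') fun y => lsum (parts l₃) fun s₃ =>
      φ ((s₁.map F).map (ssgn W) ++ F (x.map (ssgn V) ++ b y.1 :: y.2) :: s₃.map F)]
    refine lsum_congr fun x _ => ?_
    rw [splits_coassoc x.2 fun y z l₃ => lsum (parts l₃) fun s₃ =>
      φ ((s₁.map F).map (ssgn W) ++ F (x.1.map (ssgn V) ++ b y :: z) :: s₃.map F)]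
  rw [lsum_congr fun s₁ _ => h1 s₁]
  rw [lsum_comm (parts s.1)]
  refine lsum_congr fun x _ => ?_
  rw [lsum_comm (parts s.1)]
  refine lsum_congr fun y _ => ?_
  rw [lsum_comm (parts s.1)]

/-- The value of `X` on the whole of `l` occurs only with no other blocks around it, hence only
inside `φ [x] = 0`. -/
lemma blockInsert_congr {N : Type*} [AddCommGroup N] {F X Y : List (Tot V) → Tot W}
    {φ : List (Tot W) → N}
    (hφ : ∀ x, φ [x] = 0) {l : List (Tot V)}
    (h : ∀ l' : List (Tot V), l'.length < l.length → X l' = Y l') :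
    blockInsert F X φ l = blockInsert F Y φ l := by
  refine lsum_congr fun s hs => lsum_congr fun s₁ hs₁ => lsum_congr fun t ht =>
    lsum_congr fun s₃ hs₃ => ?_
  have h1 := length_mem_splits hs
  have h2 := length_mem_splits ht
  by_cases hl : t.1.length < l.length
  · rw [h _ hl]
  · have h3 : s.1 = [] := List.length_eq_zero_iff.1 (by omega)
    have h4 : t.2 = [] := List.length_eq_zero_iff.1 (by omega)
    rw [h3] at hs₁
    rw [h4] at hs₃
    simp only [parts, List.mem_singleton] at hs₁ hs₃
    subst hs₁ hs₃
    simp [hφ]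

end BarIdentities

/-! ### Homotopy transfer: the extension of `p` -/

section Projection

variable {k : Type u} [Field k]

namespace TransDatum

variable (D : TransDatum k)

/-- The homotopy as a unary operation. -/
def hOp : Ops D.A.V D.A.V 0 := Ops.unary D.c.h (by simpa [sub_eq_add_neg] using D.c.h_degree)

/-- The differential as a unary operation. -/
def dOp : Ops D.A.V D.A.V 2 := Ops.unary D.A.d (by simpa using D.A.d_degree)

/-- The map `p` as a unary operation. -/
def pOp : Ops D.A.V D.c.H 1 := Ops.unary D.c.p (by simpa using D.c.p_degree)

/-- The product on the suspension. -/
def mulOp : Ops D.A.V D.A.V 2 := D.A.bar.sub D.dOp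

/-- The projection `i p`, with the sign of the suspension. -/
def proj : Tot D.A.V →ₗ[k] Tot D.A.V := ssgn D.A.V ∘ₗ D.c.i ∘ₗ D.c.p

lemma proj_apply (x : Tot D.A.V) : D.proj x = ssgn D.A.V (D.c.i (D.c.p x)) := rfl

lemma ssgn_degree (V : GrVect k) (i : ℤ) (x : V i) : ssgn V (el V i x) ∈ homog V i :=
  Submodule.neg_mem _ (sgn_mem_homog 1 ⟨x, rfl⟩)

lemma proj_degree (i : ℤ) (x : D.A.V i) : D.proj (el D.A.V i x) ∈ homog D.A.V i :=
  mem_homog_of_degree (e := fun i => i) (ssgn_degree _)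
    (mem_homog_of_degree (e := fun i => i) D.c.i_degree (D.c.p_degree i x))

lemma i_ssgn (x : Tot D.c.H) : D.c.i (ssgn D.c.H x) = ssgn D.A.V (D.c.i x) :=
  (Ops.unary (c := 1) D.c.i (by simpa using D.c.i_degree)).op_ssgn_of_one [x]

lemma p_ssgn (x : Tot D.A.V) : D.c.p (ssgn D.A.V x) = ssgn D.c.H (D.c.p x) :=
  D.pOp.op_ssgn_of_one [x]

lemma d_ssgn (x : Tot D.A.V) : D.A.d (ssgn D.A.V x) = - ssgn D.A.V (D.A.d x) :=
  D.dOp.op_ssgn_of_two [x]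

lemma h_ssgn (x : Tot D.A.V) : D.c.h (ssgn D.A.V x) = - ssgn D.A.V (D.c.h x) := by
  have h : D.c.h (ssgn D.A.V x) = (-1 : k) ^ ((0 : ℤ).natAbs + 1) • ssgn D.A.V (D.c.h x) :=
    D.hOp.ssgn_comm' [x]
  simpa using h

variable {M : Type*} [AddCommGroup M] [Module k M] {φ : List (Tot D.A.V) → M}

/-- The operator on families induced by the homotopy on tensor powers. -/
def hIns {N : Type*} [AddCommGroup N] (φ : List (Tot D.A.V) → N) :
    List (Tot D.A.V) → N := insertAlong D.proj D.hOp.op φ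

/-- The operator on families induced by the differential on tensor powers. -/
def dIns {N : Type*} [AddCommGroup N] (φ : List (Tot D.A.V) → N) :
    List (Tot D.A.V) → N :=
  insertAlong (ssgn D.A.V) D.dOp.op φ

lemma multilin_hIns (hφ : Multilin k φ) : Multilin k (D.hIns φ) :=
  multilin_insertAlong _ D.hOp.multilin hφ

lemma multilin_dIns (hφ : Multilin k φ) : Multilin k (D.dIns φ) :=
  multilin_insertAlong _ D.dOp.multilin hφ

lemma hIns_nil (hφ : Multilin k φ) : D.hIns φ [] = 0 := by
  rw [hIns, insertAlong_nil, D.hOp.nil, hφ.eq_zero (by simp)]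

lemma dIns_nil (hφ : Multilin k φ) : D.dIns φ [] = 0 := by
  rw [dIns, insertAlong_nil, D.dOp.nil, hφ.eq_zero (by simp)]

lemma hIns_cons (hφ : Multilin k φ) (x : Tot D.A.V) (l : List (Tot D.A.V)) :
    D.hIns φ (x :: l) = φ (D.c.h x :: l) + D.hIns (fun r => φ (D.proj x :: r)) l :=
  insertAlong_unary_cons hφ D.hOp.nil (fun _ _ _ => rfl) x l

lemma dIns_cons (hφ : Multilin k φ) (x : Tot D.A.V) (l : List (Tot D.A.V)) :
    D.dIns φ (x :: l) = φ (D.A.d x :: l) + D.dIns (fun r => φ (ssgn D.A.V x :: r)) l :=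
  insertAlong_unary_cons hφ D.dOp.nil (fun _ _ _ => rfl) x l

lemma hIns_congr {ψ : List (Tot D.A.V) → M} (hφ : Multilin k φ) (hψ : Multilin k ψ)
    {l : List (Tot D.A.V)} (h : ∀ l' : List (Tot D.A.V), l'.length = l.length → φ l' = ψ l') :
    D.hIns φ l = D.hIns ψ l :=
  insertAlong_unary_congr hφ hψ D.hOp.nil (fun _ _ _ => rfl) h

lemma dIns_congr {ψ : List (Tot D.A.V) → M} (hφ : Multilin k φ) (hψ : Multilin k ψ)
    {l : List (Tot D.A.V)} (h : ∀ l' : List (Tot D.A.V), l'.length = l.length → φ l' = ψ l') :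
    D.dIns φ l = D.dIns ψ l :=
  insertAlong_unary_congr hφ hψ D.dOp.nil (fun _ _ _ => rfl) h

lemma hIns_zero {N : Type*} [AddCommGroup N] (l : List (Tot D.A.V)) :
    D.hIns (fun _ => (0 : N)) l = 0 :=
  insertAlong_zero_fun l

lemma dIns_zero {N : Type*} [AddCommGroup N] (l : List (Tot D.A.V)) :
    D.dIns (fun _ => (0 : N)) l = 0 :=
  insertAlong_zero_fun l

lemma h_proj (x : Tot D.A.V) : D.c.h (D.proj x) = 0 := by
  rw [proj_apply, h_ssgn, D.c.h_i, map_zero, neg_zero]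

lemma d_proj (x : Tot D.A.V) : D.A.d (D.proj x) = 0 := by
  rw [proj_apply, d_ssgn, D.c.d_i, map_zero, neg_zero]

lemma hIns_eq_zero (hφ : Multilin k φ) {l : List (Tot D.A.V)} (hl : ∀ x ∈ l, D.c.h x = 0) :
    D.hIns φ l = 0 := by
  induction l generalizing φ with
  | nil => exact D.hIns_nil hφ
  | cons x l ih =>
    rw [D.hIns_cons hφ, hl x (by simp), ih (hφ.cons _) fun y hy => hl y (by simp [hy]), add_zero]
    exact hφ.zero [] l

/-- Two homotopies at the same entry give `h² = 0`. At different entries, one entry meets both `h`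
and the projection `ip`, and these annihilate each other in either order by `hi = 0` and `ph = 0`.
-/
lemma hIns_hIns (hφ : Multilin k φ) (l : List (Tot D.A.V)) : D.hIns (D.hIns φ) l = 0 := by
  induction l generalizing φ with
  | nil => exact D.hIns_nil (D.multilin_hIns hφ)
  | cons x l ih =>
    have h0 : ∀ r, φ (0 :: r) = 0 := hφ.zero []
    rw [D.hIns_cons (D.multilin_hIns hφ), D.hIns_cons hφ, D.c.h_h, h0, zero_add]
    have e : D.proj (D.c.h x) = 0 := by rw [proj_apply, D.c.p_h, map_zero, map_zero]
    simp only [e, h0, hIns_zero, zero_add, D.hIns_cons hφ, h_proj]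
    exact ih (hφ.cons _)

/-- The homotopy formula on tensor powers. -/
lemma hIns_dIns (hφ : Multilin k φ) (l : List (Tot D.A.V)) :
    D.hIns (D.dIns φ) l + D.dIns (D.hIns φ) l =
      φ (l.map fun x => D.c.i (D.c.p x)) - φ l := by
  induction l generalizing φ with
  | nil =>
    rw [D.hIns_nil (D.multilin_dIns hφ), D.dIns_nil (D.multilin_hIns hφ)]
    simp
  | cons x l ih =>
    have h0 : ∀ r, φ (0 :: r) = 0 := hφ.zero []
    have hneg : ∀ y r, φ (-y :: r) = - φ (y :: r) := fun y r => map_neg (hφ.slot [] r) y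
    have hadd : ∀ y z r, φ ((y + z) :: r) = φ (y :: r) + φ (z :: r) := hφ.add []
    have hsub : ∀ y z r, φ ((y - z) :: r) = φ (y :: r) - φ (z :: r) := fun y z r =>
      map_sub (hφ.slot [] r) y z
    have e1 : D.proj (D.A.d x) = 0 := by rw [proj_apply, D.c.p_d, map_zero, map_zero]
    have e2 : D.proj (ssgn D.A.V x) = D.c.i (D.c.p x) := by
      rw [proj_apply, p_ssgn, i_ssgn, ssgn_ssgn]
    have e3 : ssgn D.A.V (D.proj x) = D.c.i (D.c.p x) := by rw [proj_apply, ssgn_ssgn]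
    have e4 : D.dIns (fun r => - φ (ssgn D.A.V (D.c.h x) :: r)) l =
        - D.dIns (fun r => φ (ssgn D.A.V (D.c.h x) :: r)) l := by
      simp only [dIns, insertAlong, lsum_neg]
    have e5 : D.dIns (fun r => - φ (ssgn D.A.V (D.c.h x) :: r) +
          D.hIns (fun r' => φ (D.c.i (D.c.p x) :: r')) r) l =
        - D.dIns (fun r => φ (ssgn D.A.V (D.c.h x) :: r)) l +
          D.dIns (D.hIns fun r' => φ (D.c.i (D.c.p x) :: r')) l := by
      rw [← e4]
      exact insertAlong_add_fun l
    rw [D.hIns_cons (D.multilin_dIns hφ), D.dIns_cons (D.multilin_hIns hφ), D.dIns_cons hφ,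
      D.hIns_cons hφ]
    simp only [D.hIns_cons hφ, D.dIns_cons hφ, e1, e2, e3, d_proj, h0, hIns_zero, zero_add,
      add_zero, h_ssgn, hneg, e5]
    -- The mixed terms, with `h` on `x` and `d` further right, cancel since `h` anticommutes with
    -- `ssgn`. What is left telescopes: the homotopy relation replaces `x` by `ip x`, and the
    -- induction hypothesis replaces the remaining entries.
    have h1 := ih (hφ.cons (D.c.i (D.c.p x)))
    have h2 : φ (D.A.d (D.c.h x) :: l) + φ (D.c.h (D.A.d x) :: l) =
        φ (D.c.i (D.c.p x) :: l) - φ (x :: l) := by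
      rw [← hadd, ← D.c.homotopy, hsub]
    rw [List.map_cons]
    rw [add_comm, ← sub_eq_zero] at h1 h2 ⊢
    rw [← add_zero (0 : M)]
    nth_rewrite 1 [← h1]
    rw [← h2]
    abel

/-- The part of the relation for the extension of `p` which only involves lower arities. -/
noncomputable def pRest (P : Ops D.A.V D.c.H 1) : Ops D.A.V D.c.H 2 :=
  (Ops.insert (ssgn D.A.V) (ssgn_degree _) D.mulOp P (by norm_num)).sub (P.barComp D.mBar)

lemma pRest_op (P : Ops D.A.V D.c.H 1) (l : List (Tot D.A.V)) :
    (D.pRest P).op l = insertAlong (ssgn D.A.V) D.mulOp.op P.op l -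
      barBlock P.op D.mBar.op l := by
  rw [← Ops.barComp_op]
  rfl

/-- The recursion for the extension of `p`. -/
noncomputable def pStep (P : Ops D.A.V D.c.H 1) : Ops D.A.V D.c.H 1 :=
  D.pOp.add (Ops.insert D.proj D.proj_degree D.hOp (D.pRest P) (by norm_num))

lemma mulOp_single (x : Tot D.A.V) : D.mulOp.op [x] = 0 := by
  change D.A.bar.op [x] - D.A.d x = 0
  rw [DGAlg.bar_one, sub_self]

/-- With the differential removed, the inserted operation consumes at least two entries, so `φ` is
only evaluated on shorter lists. -/
lemma insertAlong_mulOp_congr {ψ : List (Tot D.A.V) → M} (hφ : Multilin k φ)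
    (hψ : Multilin k ψ) {l : List (Tot D.A.V)}
    (h : ∀ l' : List (Tot D.A.V), l'.length < l.length → φ l' = ψ l') :
    insertAlong (ssgn D.A.V) D.mulOp.op φ l = insertAlong (ssgn D.A.V) D.mulOp.op ψ l := by
  refine lsum_congr fun s hs => lsum_congr fun t ht => ?_
  have h1 := length_mem_splits hs
  have h2 := length_mem_splits ht
  rcases h3 : t.1 with _ | ⟨x, _ | ⟨y, r⟩⟩
  · rw [Ops.nil, hφ.eq_zero (by simp), hψ.eq_zero (by simp)]
  · rw [mulOp_single, hφ.eq_zero (by simp), hψ.eq_zero (by simp)]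
  · rw [h3] at h2
    refine h _ ?_
    simp at h2 ⊢
    omega

/-- A single block contributes nothing since `m_1 = 0`, and with two or more blocks each is shorter
than `l`. -/
lemma pRest_congr {P Q : Ops D.A.V D.c.H 1} {l : List (Tot D.A.V)}
    (h : ∀ l' : List (Tot D.A.V), l'.length < l.length → P.op l' = Q.op l') :
    (D.pRest P).op l = (D.pRest Q).op l := by
  rw [pRest_op, pRest_op, D.insertAlong_mulOp_congr P.multilin Q.multilin h]
  congr 1
  refine lsum_congr fun s hs => ?_
  have h1 := (length_of_mem_parts hs).2
  rcases s with _ | ⟨B, _ | ⟨C, s⟩⟩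
  · rfl
  · simp only [List.map_cons, List.map_nil, mBar_single]
  · refine congrArg _ (List.map_congr_left fun B' hB' => h _ ?_)
    have := h1 B' hB'
    simp at this
    omega

lemma exists_pBar : ∃ P, D.pStep P = P :=
  Ops.exists_fixedPoint _ fun P Q l h => by
    change _ + D.hIns (D.pRest P).op l = _ + D.hIns (D.pRest Q).op l
    -- The operator `hIns` preserves length, so the strict drop in length comes from `pRest`.
    rw [D.hIns_congr (D.pRest P).multilin (D.pRest Q).multilin fun l' hl' =>
      D.pRest_congr fun l'' hl'' => h _ (hl' ▸ hl'')]

/-- The extension of `p`, on suspensions. -/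
noncomputable def pBar : Ops D.A.V D.c.H 1 := D.exists_pBar.choose

lemma pBar_op (l : List (Tot D.A.V)) :
    D.pBar.op l = D.pOp.op l + D.hIns (D.pRest D.pBar).op l :=
  (congrArg (fun P : Ops D.A.V D.c.H 1 => P.op l) D.exists_pBar.choose_spec).symm

lemma pRest_single (P : Ops D.A.V D.c.H 1) (x : Tot D.A.V) : (D.pRest P).op [x] = 0 := by
  have h1 : ∀ y, P.op [0, y] = 0 := fun y => P.multilin.eq_zero (by simp)
  have h2 : ∀ y, P.op [y, 0] = 0 := fun y => P.multilin.eq_zero (by simp)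
  have h3 : P.op [0] = 0 := P.multilin.eq_zero (by simp)
  rw [pRest_op]
  simp [insertAlong, splits, barBlock, parts, mulOp_single, mBar_single, Ops.nil, h1, h2, h3]

lemma pBar_single (x : Tot D.A.V) : D.pBar.op [x] = D.c.p x := by
  have hm := (D.pRest D.pBar).multilin
  rw [pBar_op, D.hIns_cons hm, pRest_single, D.hIns_nil (hm.cons _), add_zero, add_zero]
  rfl

/-- In `P = p + hIns (pRest P)` the first term is killed by `ph = 0` and the second by `hIns_hIns`.
-/
lemma hIns_pBar (l : List (Tot D.A.V)) : D.hIns D.pBar.op l = 0 := by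
  have e : D.pBar.op = fun l => D.pOp.op l + D.hIns (D.pRest D.pBar).op l := funext D.pBar_op
  rw [e, hIns, insertAlong_add_fun]
  have h1 := D.hIns_hIns (D.pRest D.pBar).multilin l
  rw [hIns] at h1
  rw [h1, add_zero, insertAlong_of_unary fun _ _ _ => rfl]
  rcases l with _ | ⟨x, _ | ⟨y, l⟩⟩
  · exact map_zero D.c.p
  · exact D.c.p_h x
  · exact map_zero D.c.p

lemma pBar_of_h_eq_zero {l : List (Tot D.A.V)} (hl : ∀ x ∈ l, D.c.h x = 0) :
    D.pBar.op l = D.pOp.op l := by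
  rw [pBar_op, D.hIns_eq_zero (D.pRest D.pBar).multilin hl, add_zero]

/-- The identity as a unary operation. -/
def idOp (V : GrVect k) : Ops V V 1 := Ops.unary LinearMap.id (fun i x => by
  rw [sub_self, add_zero]
  exact ⟨x, rfl⟩)

/-- The values of `iBar` are killed by `h`, so on them `pBar` collapses to the unary `p`. Only one
block survives, and `pi = 1`, `ph = 0` finish. Thus the composite is strictly the identity, before
`pBar` is known to be a morphism. -/
lemma barBlock_iBar_pBar : barBlock D.iBar.op D.pBar.op = (idOp D.c.H).op := by
  funext l
  have e : barBlock D.iBar.op D.pBar.op l = barBlock D.iBar.op D.pOp.op l := by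
    refine lsum_congr fun s _ => D.pBar_of_h_eq_zero fun x hx => ?_
    obtain ⟨B, _, rfl⟩ := List.mem_map.1 hx
    exact D.h_iBar B
  rw [e]
  cases l with
  | nil => exact (zero_add _)
  | cons x l =>
    unfold barBlock
    rw [lsum_parts_single fun _ _ _ => rfl]
    change D.c.p (D.iBar.op (x :: l)) = _
    cases l with
    | nil =>
      rw [iBar_single, D.c.p_i]
      rfl
    | cons y l =>
      rw [iBar_cons_cons, D.c.p_h]
      rfl

/-- The failure of `pBar` to satisfy the relations of an `∞`-morphism. -/
noncomputable def pDefect : Ops D.A.V D.c.H 2 :=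
  (Ops.insert (ssgn D.A.V) (ssgn_degree _) D.A.bar D.pBar (by norm_num)).sub
    (D.pBar.barComp D.mBar)

lemma pDefect_op (l : List (Tot D.A.V)) :
    D.pDefect.op l = insertAlong (ssgn D.A.V) D.A.bar.op D.pBar.op l -
      barBlock D.pBar.op D.mBar.op l := by
  rw [← Ops.barComp_op]
  rfl

lemma insertAlong_bar (hφ : Multilin k φ) (l : List (Tot D.A.V)) :
    insertAlong (ssgn D.A.V) D.A.bar.op φ l =
      D.dIns φ l + insertAlong (ssgn D.A.V) D.mulOp.op φ l := by
  rw [dIns, ← insertAlong_add_insert hφ]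
  congr 1
  funext l
  change _ = D.dOp.op l + (D.A.bar.op l - D.dOp.op l)
  abel

lemma pDefect_eq (l : List (Tot D.A.V)) :
    D.pDefect.op l = D.dIns D.pBar.op l + (D.pRest D.pBar).op l := by
  rw [pDefect_op, pRest_op, D.insertAlong_bar D.pBar.multilin]
  abel

lemma insertAlong_bar_bar (l : List (Tot D.A.V)) :
    insertAlong (ssgn D.A.V) D.A.bar.op D.A.bar.op l = 0 :=
  (insertSum_tw D.A.aInf.str.toOps D.A.aInf.str.multilin l).symm.trans (D.A.aInf.str.rel _)

lemma pDefect_single (x : Tot D.A.V) : D.pDefect.op [x] = 0 := by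
  rw [pDefect_eq, pRest_single, D.dIns_cons D.pBar.multilin, pBar_single, D.c.p_d,
    D.dIns_nil (D.pBar.multilin.cons _), add_zero, add_zero]

/-- In length `n` the differential may be replaced by the full coderivation of `A`, since the
product only meets the defect on shorter lists. That coderivation kills the first term of the defect
because it squares to zero. For the second term, the relation on shorter lists moves it across
`pBar`, where it becomes the square of the coderivation of `m`. -/
lemma dIns_pDefect {n : ℕ} (hn : ∀ l : List (Tot D.A.V), l.length < n → D.pDefect.op l = 0)
    {l : List (Tot D.A.V)} (hl : l.length = n) : D.dIns D.pDefect.op l = 0 := by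
  subst hl
  have h1 := D.insertAlong_bar D.pDefect.multilin l
  rw [D.insertAlong_mulOp_congr D.pDefect.multilin Multilin.zero_fun hn, insertAlong_zero_fun,
    add_zero] at h1
  rw [← h1]
  have e : D.pDefect.op = fun l => insertAlong (ssgn D.A.V) D.A.bar.op D.pBar.op l -
      barBlock D.pBar.op D.mBar.op l := funext D.pDefect_op
  rw [e, insertAlong_sub_fun, insertAlong_insertAlong D.insertAlong_bar_bar D.pBar.multilin,
    insertAlong_barBlock _ D.pBar.op_ssgn_of_one D.mBar.multilin,
    -- Since `m_1 = 0`, knowing the relation on shorter lists is enough to exchange the two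
    -- operations.
    blockInsert_congr (Y := barBlock D.pBar.op D.mBar.op) D.mBar_single fun l' hl' => by
      rw [← sub_eq_zero, ← pDefect_op, hn l' hl'],
    ← barBlock_insertAlong _ _ D.mBar.multilin,
    show insertAlong (ssgn D.c.H) D.mBar.op D.mBar.op = fun _ => 0 from
      funext D.insertAlong_mBar]
  simp [barBlock]

/-- Compose the defect with `iBar`: every decomposition but the finest leads to a shorter list, so
the composite is the defect on `i^{⊗ n}`. On the other hand `iBar` is a morphism and `pBar ∘ iBar`
is the identity, so the composite is `m - m`. -/
lemma pDefect_map_i {n : ℕ} (hn : ∀ l : List (Tot D.A.V), l.length < n → D.pDefect.op l = 0)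
    {l : List (Tot D.c.H)} (hl : l.length = n) :
    D.pDefect.op (l.map D.c.i) = 0 := by
  subst hl
  have h1 : barBlock D.iBar.op D.pDefect.op l = D.pDefect.op (l.map D.c.i) := by
    unfold barBlock
    rw [lsum_parts_finest fun s _ hs => hn _ (by simpa using hs)]
    simp only [List.map_map, Function.comp_def, iBar_single]
  rw [← h1]
  have e : ∀ l, D.pDefect.op l = insertAlong (ssgn D.A.V) D.A.bar.op D.pBar.op l -
      barBlock D.pBar.op D.mBar.op l := D.pDefect_op
  have h2 : barBlock D.iBar.op D.pDefect.op l =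
      barBlock D.iBar.op (insertAlong (ssgn D.A.V) D.A.bar.op D.pBar.op) l -
        barBlock D.iBar.op (barBlock D.pBar.op D.mBar.op) l := by
    simp only [barBlock, e, lsum_sub]
  have h3 : barBlock D.iBar.op (insertAlong (ssgn D.A.V) D.A.bar.op D.pBar.op) l =
      insertAlong (ssgn D.c.H) D.mBar.op (barBlock D.iBar.op D.pBar.op) l :=
    (barInsert_barBlock D.insertAlong_iBar D.iBar.op_ssgn_of_one D.pBar.multilin l).symm
  rw [h2, h3, barBlock_assoc _ _ D.mBar.multilin, barBlock_iBar_pBar,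
    insertAlong_of_unary fun _ _ _ => rfl, barBlock_strict (fun _ _ _ => rfl) D.mBar.multilin,
    sub_eq_zero]
  change D.mBar.op l = D.mBar.op (l.map fun x => x)
  rw [List.map_id']

/-- The defect is `dIns pBar + pRest pBar`. As `hIns pBar = 0` and `pBar` vanishes on two or more
entries from the image of `ip`, the homotopy formula gives `hIns (dIns pBar) = -pBar`; the recursion
gives `hIns (pRest pBar) = pBar`. Arity at least two is needed for the unary part `p` to drop out.
-/
lemma hIns_pDefect (x y : Tot D.A.V) (l : List (Tot D.A.V)) :
    D.hIns D.pDefect.op (x :: y :: l) = 0 := by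
  have e : D.pDefect.op = fun l => D.dIns D.pBar.op l + (D.pRest D.pBar).op l :=
    funext D.pDefect_eq
  rw [e, hIns, insertAlong_add_fun]
  change D.hIns (D.dIns D.pBar.op) _ + D.hIns (D.pRest D.pBar).op _ = 0
  have h1 := D.hIns_dIns D.pBar.multilin (x :: y :: l)
  rw [show D.hIns D.pBar.op = fun _ => 0 from funext D.hIns_pBar, dIns_zero, add_zero,
    D.pBar_of_h_eq_zero (l := (x :: y :: l).map _)] at h1
  · have h2 : D.pOp.op ((x :: y :: l).map fun x => D.c.i (D.c.p x)) = 0 := rfl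
    have h3 : D.pOp.op (x :: y :: l) = 0 := rfl
    rw [h1, h2, D.pBar_op, h3]
    abel
  · intro z hz
    obtain ⟨w, _, rfl⟩ := List.mem_map.1 hz
    exact D.c.h_i _

lemma pDefect_eq_zero (l : List (Tot D.A.V)) : D.pDefect.op l = 0 := by
  induction hn : l.length using Nat.strong_induction_on generalizing l with
  | _ n ih =>
  replace ih : ∀ l' : List (Tot D.A.V), l'.length < n → D.pDefect.op l' = 0 :=
    fun l' hl' => ih _ hl' l' rfl
  rcases l with _ | ⟨x, _ | ⟨y, l⟩⟩
  · exact Ops.nil _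
  · exact D.pDefect_single x
  -- In the homotopy formula for the defect both composites vanish, and so does the value on the
  -- image of `ip`; the value on the list itself is all that remains.
  · have h1 := D.hIns_dIns D.pDefect.multilin (x :: y :: l)
    have h2 : (x :: y :: l).map (fun x => D.c.i (D.c.p x)) =
        ((x :: y :: l).map D.c.p).map D.c.i := by simp
    rw [h2, D.pDefect_map_i ih (by simpa using hn),
      D.hIns_congr (D.multilin_dIns D.pDefect.multilin) Multilin.zero_fun fun l' hl' =>
        D.dIns_pDefect ih (hl'.trans hn),
      D.dIns_congr (D.multilin_hIns D.pDefect.multilin) Multilin.zero_fun fun l' hl' => ?_,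
      hIns_zero, dIns_zero, add_zero, zero_sub, eq_comm, neg_eq_zero] at h1
    · exact h1
    · rcases l' with _ | ⟨x', _ | ⟨y', l'⟩⟩
      · simp at hl'
      · simp at hl'
      · exact D.hIns_pDefect x' y' l'

/-- The extension of `p` to an `∞`-morphism. -/
noncomputable def pInf : (dgToAInf k).obj D.A ⟶ D.transferred where
  toOps := D.pBar.twist
  rel l := by
    obtain ⟨l, rfl⟩ := tw_surjective l
    refine (insertSum_tw D.A.aInf.str.toOps D.pBar.twist.multilin l).trans ?_
    refine Eq.trans ?_ (blockSum_tw D.pBar.twist D.m.multilin l).symm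
    have h := (D.pDefect_op l).symm.trans (D.pDefect_eq_zero l)
    rw [sub_eq_zero] at h
    have e1 : (fun l => D.pBar.twist.op (tw D.A.V l)) = D.pBar.op :=
      congrArg Ops.op (Ops.twist_twist D.pBar)
    have e2 : (fun l => D.mBar.twist.op (tw D.c.H l)) = D.mBar.op :=
      congrArg Ops.op (Ops.twist_twist D.mBar)
    change insertAlong (ssgn D.A.V) D.A.bar.op (fun l => D.pBar.twist.op (tw D.A.V l)) l =
      barBlock (fun l => D.pBar.twist.op (tw D.A.V l)) (fun l => D.mBar.twist.op (tw D.c.H l)) l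
    rw [e1, e2, h]

lemma pInf_single (x : Tot D.A.V) : (AInfHom.toOps D.pInf).op [x] = D.c.p x := by
  change D.pBar.op (tw _ [x]) = _
  simp [tw, pBar_single]

lemma iInf_pInf : D.iInf ≫ D.pInf = 𝟙 _ := AInfHom.ext (funext fun l => by
  obtain ⟨l, rfl⟩ := tw_surjective l
  refine (blockSum_tw D.iBar.twist D.pBar.twist.multilin l).trans ?_
  simp only [Ops.twist_op, tw_tw]
  rw [barBlock_iBar_pBar]
  rcases l with _ | ⟨x, _ | ⟨y, l⟩⟩
  · rfl
  · change x = sgn _ 0 x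
    rw [sgn_zero]
    rfl
  · rfl)

end TransDatum

end Projection

/-! ### Existence of contractions -/

section Existence

variable {k : Type u} [Field k]

/-- Every linear map between vector spaces has a generalized inverse. -/
lemma exists_generalizedInverse {V W : Type*} [AddCommGroup V] [Module k V] [AddCommGroup W]
    [Module k W] (f : V →ₗ[k] W) : ∃ g : W →ₗ[k] V, ∀ x, f (g (f x)) = f x := by
  -- Compose a retraction `q` onto the range with a section `g` of the map onto its range.
  obtain ⟨g, hg⟩ := f.rangeRestrict.exists_rightInverse_of_surjective f.range_rangeRestrict
  obtain ⟨q, hq⟩ := (LinearMap.range f).subtype.exists_leftInverse_of_injective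
    (Submodule.ker_subtype _)
  refine ⟨g ∘ₗ q, fun x => ?_⟩
  have h1 : q (f x) = f.rangeRestrict x := LinearMap.congr_fun hq (f.rangeRestrict x)
  have h2 := congrArg Subtype.val (LinearMap.congr_fun hg (f.rangeRestrict x))
  simpa [h1] using h2

namespace DGAlg

variable (A : DGAlg k)

/-- There is a graded generalized inverse of the differential. -/
lemma exists_generalizedInverse_d : ∃ g : Tot A.V →ₗ[k] Tot A.V,
    (∀ i x, g (el A.V i x) ∈ homog A.V (i - 1)) ∧ ∀ x, A.d (g (A.d x)) = A.d x := by
  -- Indexing by the target degree `j` makes the inverse land in degree `j - 1` literally, so no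
  -- transport between degrees is needed.
  choose g hg using fun j : ℤ => exists_generalizedInverse
    (DirectSum.component k ℤ (fun i => A.V i) j ∘ₗ A.d ∘ₗ el A.V (j - 1))
  let G : Tot A.V →ₗ[k] Tot A.V := DirectSum.toModule k ℤ _ fun j => el A.V (j - 1) ∘ₗ g j
  have hG : ∀ j x, G (el A.V j x) = el A.V (j - 1) (g j x) := fun j x =>
    DirectSum.toModule_lof k (M := fun i => A.V i) j x
  refine ⟨G, fun i x => ⟨_, (hG i x).symm⟩, fun x => ?_⟩
  have key : ∀ j (x : A.V (j - 1)), A.d (G (A.d (el A.V (j - 1) x))) = A.d (el A.V (j - 1) x) := by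
    intro j x
    have hd : ∀ x, A.d (el A.V (j - 1) x) ∈ homog A.V j := fun x => by
      simpa using A.d_degree (j - 1) x
    rw [← el_component (hd x), hG, ← el_component (hd (g j _))]
    exact congrArg _ (hg j x)
  have e : A.d ∘ₗ G ∘ₗ A.d = A.d := by
    apply DirectSum.linearMap_ext
    intro i
    obtain ⟨j, rfl⟩ : ∃ j, i = j - 1 := ⟨i + 1, by ring⟩
    exact LinearMap.ext (key j)
  exact LinearMap.congr_fun e x

/-- The differential has a graded generalized inverse which squares to zero. -/
lemma exists_homotopy : ∃ s : Tot A.V →ₗ[k] Tot A.V,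
    (∀ i x, s (el A.V i x) ∈ homog A.V (i - 1)) ∧ (∀ x, A.d (s (A.d x)) = A.d x) ∧
      (∀ x, s (A.d (s x)) = s x) ∧ ∀ x, s (s x) = 0 := by
  obtain ⟨g, hg, hd⟩ := A.exists_generalizedInverse_d
  have gd : ∀ {i x}, x ∈ homog A.V i → g x ∈ homog A.V (i - 1) := fun h =>
    mem_homog_of_degree (e := fun i => i - 1) hg h
  have dd : ∀ {i x}, x ∈ homog A.V i → A.d x ∈ homog A.V (i + 1) := fun h =>
    mem_homog_of_degree (e := fun i => i + 1) A.d_degree h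
  -- With `d g d = d`, the map `g d g` satisfies `sds = s`. The right factor `1 - g d` is the
  -- identity after `d`, since `d² = 0`, and kills `g d`, which yields `s² = 0`.
  refine ⟨g ∘ₗ A.d ∘ₗ g ∘ₗ (LinearMap.id - g ∘ₗ A.d), fun i x => ?_, fun x => ?_, fun x => ?_,
    fun x => ?_⟩
  · have h0 : el A.V i x ∈ homog A.V i := ⟨x, rfl⟩
    have h1 := gd (dd h0)
    rw [add_sub_cancel_right] at h1
    have h2 := gd (dd (gd (Submodule.sub_mem _ h0 h1)))
    simpa using h2
  · simp [A.d_d, hd]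
  · simp [A.d_d, hd]
  · simp [hd]

/-- Every differential graded algebra has a contraction. -/
theorem nonempty_contraction : Nonempty (Contraction A) := by
  obtain ⟨s, hs, dsd, sds, ss⟩ := A.exists_homotopy
  -- This is the projection onto a complement of the images of `ds` and `sd`; its image consists of
  -- cocycles and represents cohomology.
  let q : Tot A.V →ₗ[k] Tot A.V := LinearMap.id - A.d ∘ₗ s - s ∘ₗ A.d
  have q_apply : ∀ x, q x = x - A.d (s x) - s (A.d x) := fun _ => rfl
  have dq : ∀ x, A.d (q x) = 0 := fun x => by simp [q_apply, A.d_d, dsd]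
  have qd : ∀ x, q (A.d x) = 0 := fun x => by simp [q_apply, A.d_d, dsd]
  have sq : ∀ x, s (q x) = 0 := fun x => by simp [q_apply, ss, sds]
  have qs : ∀ x, q (s x) = 0 := fun x => by simp [q_apply, ss, sds]
  have qq : ∀ x, q (q x) = q x := fun x => by
    conv_lhs => rw [q_apply (q x), dq, sq, map_zero, map_zero, sub_zero, sub_zero]
  have hq : ∀ i x, q (el A.V i x) ∈ homog A.V i := fun i x => by
    have h1 := mem_homog_of_degree (e := fun i => i + 1) A.d_degree (hs i x)
    have h2 := mem_homog_of_degree (e := fun i => i - 1) hs (A.d_degree i x)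
    simp only [sub_add_cancel, add_sub_cancel_right] at h1 h2
    exact Submodule.sub_mem _ (Submodule.sub_mem _ ⟨x, rfl⟩ h1) h2
  -- Its components in each degree are needed for the image to be a graded vector space.
  let Q : ∀ i : ℤ, A.V i →ₗ[k] A.V i := fun i =>
    DirectSum.component k ℤ (fun i => A.V i) i ∘ₗ q ∘ₗ el A.V i
  have hQ : ∀ i x, el A.V i (Q i x) = q (el A.V i x) := fun i x => el_component (hq i x)
  have QQ : ∀ i x, Q i (Q i x) = Q i x := fun i x => by
    change DirectSum.component k ℤ (fun i => A.V i) i (q (el A.V i (Q i x))) = _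
    rw [hQ, qq]
    rfl
  let H : GrVect k := fun i => ModuleCat.of k (LinearMap.range (Q i))
  let ι : Tot H →ₗ[k] Tot A.V := DirectSum.toModule k ℤ _ fun i =>
    el A.V i ∘ₗ (LinearMap.range (Q i)).subtype
  let π : Tot A.V →ₗ[k] Tot H := DirectSum.toModule k ℤ _ fun i => el H i ∘ₗ (Q i).rangeRestrict
  have hι : ∀ i (x : LinearMap.range (Q i)), ι (el H i x) = el A.V i x.1 := fun i x =>
    DirectSum.toModule_lof k (M := fun i => H i) i x
  have hπ : ∀ i (x : A.V i), π (el A.V i x) = el H i ((Q i).rangeRestrict x) := fun i x =>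
    DirectSum.toModule_lof k (M := fun i => A.V i) i x
  have ιπ : ∀ x, ι (π x) = q x := by
    have : ι ∘ₗ π = q := by
      apply DirectSum.linearMap_ext
      intro i
      ext x
      change _ = (q (el A.V i x) : Tot A.V) _
      rw [← hQ]
      change (ι (π (el A.V i x)) : Tot A.V) _ = _
      rw [hπ, hι]
      rfl
    exact LinearMap.congr_fun this
  have πι : ∀ x, π (ι x) = x := by
    have : π ∘ₗ ι = LinearMap.id := by
      apply DirectSum.linearMap_ext
      intro i
      apply LinearMap.ext
      intro x
      change π (ι (el H i x)) = el H i x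
      rw [hι i x, hπ]
      refine congrArg _ (Subtype.ext ?_)
      obtain ⟨x, y, rfl⟩ := x
      exact QQ i y
    exact LinearMap.congr_fun this
  have ι_inj : Function.Injective ι := Function.LeftInverse.injective πι
  have qι : ∀ x, q (ι x) = ι x := fun x => by rw [← ιπ, πι]
  exact ⟨{
    H := H
    i := ι
    p := π
    -- The sign comes from `ip - 1 = q - 1 = -(ds + sd)`.
    h := -s
    i_degree := fun n x => ⟨_, (hι n x).symm⟩
    p_degree := fun n x => ⟨_, (hπ n x).symm⟩
    h_degree := fun n x => Submodule.neg_mem _ (hs n x)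
    d_i := fun x => by rw [← qι, dq]
    p_d := fun x => ι_inj (by rw [ιπ, qd, map_zero])
    homotopy := fun x => by
      rw [ιπ, q_apply]
      simp only [LinearMap.neg_apply, map_neg]
      abel
    p_i := πι
    h_i := fun x => by rw [LinearMap.neg_apply, ← qι, sq, neg_zero]
    p_h := fun x => ι_inj (by rw [ιπ, LinearMap.neg_apply, map_neg, qs, neg_zero, map_zero])
    h_h := fun x => by simp [ss] }⟩

end DGAlg

end Existence

/-! ### The transferred structure in the homotopy category -/

section HomotopyCategory

variable {k : Type u} [Field k]

namespace TransDatum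

variable (D : TransDatum k)

lemma iInf_single (x : Tot D.c.H) : (AInfHom.toOps D.iInf).op [x] = D.c.i x :=
  D.isTransferred.f_one x

/-- The components of the homotopy `h`. -/
noncomputable def hHom (i j : ℤ) : ((complexFunctor k).obj ((dgToAInf k).obj D.A)).X i ⟶
    ((complexFunctor k).obj ((dgToAInf k).obj D.A)).X j :=
  ModuleCat.ofHom (DirectSum.component k ℤ (fun i => D.A.V i) j ∘ₗ D.c.h ∘ₗ el D.A.V i)

/-- The homotopy `h` as a homotopy of maps of cochain complexes. -/
noncomputable def homotopyPI :
    Homotopy ((complexFunctor k).map D.pInf ≫ (complexFunctor k).map D.iInf)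
      (𝟙 ((complexFunctor k).obj ((dgToAInf k).obj D.A))) where
  hom i j := D.hHom i j
  zero i j hij := by
    ext x
    exact component_eq_zero (D.c.h_degree i x) fun e => hij (by simp; lia)
  comm n := by
    rw [dNext_eq (i' := n + 1) _ (by simp), prevD_eq (j' := n - 1) _ (by simp)]
    refine ModuleCat.hom_ext (LinearMap.ext fun (x : D.A.V n) => ?_)
    have hp := D.c.p_degree n x
    have hi := mem_homog_of_degree (e := fun i => i) D.c.i_degree hp
    have hd := D.A.d_degree n x
    have hh := D.c.h_degree n x
    have h1 := D.c.homotopy (el D.A.V n x)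
    rw [sub_eq_iff_eq_add] at h1
    -- In components every map is followed by a projection to one degree; by homogeneity these
    -- projections can be removed, leaving the relation `ip = hd + dh + 1`.
    change DirectSum.component k ℤ (fun i => D.A.V i) n (D.iInf.one (el D.c.H n
        (DirectSum.component k ℤ (fun i => D.c.H i) n (D.pInf.one (el D.A.V n x))))) =
      DirectSum.component k ℤ (fun i => D.A.V i) n (D.c.h (el D.A.V (n + 1)
        (DirectSum.component k ℤ (fun i => D.A.V i) (n + 1) (D.A.d (el D.A.V n x))))) +
      DirectSum.component k ℤ (fun i => D.A.V i) n (D.A.d (el D.A.V (n - 1)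
        (DirectSum.component k ℤ (fun i => D.A.V i) (n - 1) (D.c.h (el D.A.V n x))))) + x
    have e1 : D.pInf.one (el D.A.V n x) = D.c.p (el D.A.V n x) := D.pInf_single _
    have e2 : ∀ y, D.iInf.one y = D.c.i y := D.iInf_single
    rw [e1, el_component hp, el_component hd, el_component hh, e2, h1, map_add, map_add,
      DirectSum.component.lof_self, add_comm (DirectSum.component _ _ _ _ (D.c.h _))]

/-- The homotopy equivalence underlying the transfer. -/
noncomputable def homotopyEquiv :
    HomotopyEquiv ((complexFunctor k).obj ((dgToAInf k).obj D.A))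
      ((complexFunctor k).obj D.transferred) where
  hom := (complexFunctor k).map D.pInf
  inv := (complexFunctor k).map D.iInf
  homotopyHomInvId := D.homotopyPI
  homotopyInvHomId := Homotopy.ofEq (by
    rw [← CategoryTheory.Functor.map_comp, iInf_pInf, CategoryTheory.Functor.map_id])

lemma infQuasiIso_pInf : infQuasiIso k D.pInf :=
  (inferInstance : QuasiIso D.homotopyEquiv.hom)

lemma infQuasiIso_iInf : infQuasiIso k D.iInf :=
  (inferInstance : QuasiIso D.homotopyEquiv.inv)

instance isIso_toHo_iInf : IsIso ((toHo k).map D.iInf) :=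
  (infQuasiIso k).Q_inverts _ D.infQuasiIso_iInf

lemma toHo_iInf_pInf : (toHo k).map D.iInf ≫ (toHo k).map D.pInf = 𝟙 _ := by
  rw [← CategoryTheory.Functor.map_comp, iInf_pInf, CategoryTheory.Functor.map_id]

/-- The class of `iInf` is invertible, so its one-sided inverse is two-sided. -/
lemma toHo_pInf_iInf : (toHo k).map D.pInf ≫ (toHo k).map D.iInf = 𝟙 _ := by
  rw [← cancel_epi ((toHo k).map D.iInf), ← Category.assoc, toHo_iInf_pInf, Category.id_comp,
    Category.comp_id]

end TransDatum

/-- The `∞`-morphism given by a morphism of transfer data. -/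
def transMap {D D' : TransDatum k} (g : D ⟶ D') :
    (dgToAInf k).obj D.A ⟶ (dgToAInf k).obj D'.A :=
  (transForget k ⋙ dgToAInf k).map g

lemma transMap_id (D : TransDatum k) : transMap (𝟙 D) = 𝟙 _ :=
  (transForget k ⋙ dgToAInf k).map_id D

lemma transMap_comp {D D' D'' : TransDatum k} (f : D ⟶ D') (g : D' ⟶ D'') :
    transMap (f ≫ g) = transMap f ≫ transMap g :=
  (transForget k ⋙ dgToAInf k).map_comp f g

variable (k) in
/-- The functor sending a transfer datum to the transferred `A_∞`-algebra, in the homotopy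
category. -/
noncomputable def transferHo : TransDatum k ⥤ Ho k where
  obj D := (toHo k).obj D.transferred
  map {D D'} g := (toHo k).map (D.iInf ≫ transMap g ≫ D'.pInf)
  map_id D := by
    rw [transMap_id, Category.id_comp, D.iInf_pInf, CategoryTheory.Functor.map_id]
  map_comp {D D' D''} f g := by
    rw [transMap_comp]
    simp only [CategoryTheory.Functor.map_comp, Category.assoc]
    -- The inner factor `[i] ∘ [p]` at the intermediate datum cancels, though only in the homotopy
    -- category.
    rw [reassoc_of% D'.toHo_pInf_iInf]

variable (k) in
/-- The inclusion of the transferred structures is a natural isomorphism. -/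
noncomputable def transferHoIso : transferHo k ≅ transForget k ⋙ dgToAInf k ⋙ toHo k :=
  NatIso.ofComponents
    (fun D => ⟨(toHo k).map D.iInf, (toHo k).map D.pInf, D.toHo_iInf_pInf, D.toHo_pInf_iInf⟩)
    fun {D D'} g => by
      change (toHo k).map (D.iInf ≫ transMap g ≫ D'.pInf) ≫ (toHo k).map D'.iInf =
        (toHo k).map D.iInf ≫ (toHo k).map (transMap g)
      simp only [CategoryTheory.Functor.map_comp, Category.assoc, D'.toHo_pInf_iInf,
        Category.comp_id]

variable (k) in
/-- The functor `H_*`. -/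
noncomputable def transferPersistent : FTrans k ⥤ (ℝᵒᵖ ⥤ Ho k) :=
  (HasFinitelyManyChanges k).ι ⋙ (Functor.whiskeringRight _ _ _).obj (transferHo k)

variable (k) in
/-- The underlying graded vector space of the transferred structure is cohomology. -/
noncomputable def transferForgetIso :
    transferHo k ⋙ forgetHo k ≅ transForget k ⋙ dgToAInf k ⋙ cohomology k :=
  Functor.isoWhiskerRight (transferHoIso k) (forgetHo k) ≪≫
    Functor.isoWhiskerLeft (transForget k ⋙ dgToAInf k)
      (eqToIso (Localization.Construction.fac (cohomology k) (cohomology_inverts k)))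

variable (k) in
/-- The composition of `H_*` with the forgetful functor is persistent cohomology. -/
noncomputable def persistentIso :
    transferPersistent k ⋙ (Functor.whiskeringRight ℝᵒᵖ (Ho k) (GrVect k)).obj (forgetHo k) ≅
      persistentCohomology k :=
  Functor.isoWhiskerLeft (HasFinitelyManyChanges k).ι
    ((Functor.whiskeringRight ℝᵒᵖ _ _).mapIso (transferForgetIso k))

/-- The cohomology functor factors through the localization by an equality of functors, so besides
the map induced by `iInf` the comparison contains only an `eqToHom`. -/
lemma persistentIso_app (X : FTrans k) (r : ℝᵒᵖ) :
    ((persistentIso k).hom.app X).app r =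
      (forgetHo k).map ((toHo k).map (X.obj.obj r).iInf) ≫
        eqToHom (congrArg (fun G : AInfAlg k ⥤ GrVect k => G.obj ((dgToAInf k).obj (X.obj.obj r).A))
          (Localization.Construction.fac (cohomology k) (cohomology_inverts k))) := by
  have h := eqToHom_app (Localization.Construction.fac (cohomology k) (cohomology_inverts k))
    ((dgToAInf k).obj (X.obj.obj r).A)
  exact congrArg ((forgetHo k).map ((toHo k).map (X.obj.obj r).iInf) ≫ ·) h

end HomotopyCategory

/-! ### The interleaving distance -/

section InterleavingDistance

open Opposite

variable {C : Type*} [Category C] {F G K : ℝᵒᵖ ⥤ C}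

lemma structureMap_naturality (μ : F ⟶ G) {r s : ℝ} (h : s ≤ r) :
    structureMap F h ≫ μ.app (op s) = μ.app (op r) ≫ structureMap G h :=
  μ.naturality _

@[simp] lemma structureMap_comp {r s t : ℝ} (h : s ≤ r) (h' : t ≤ s) :
    structureMap F h ≫ structureMap F h' = structureMap F (h'.trans h) := by
  unfold structureMap
  rw [← F.map_comp]
  rfl

@[simp] lemma structureMap_comp_assoc {r s t : ℝ} (h : s ≤ r) (h' : t ≤ s) {Z : C}
    (f : F.obj (op t) ⟶ Z) :
    structureMap F h ≫ structureMap F h' ≫ f = structureMap F (h'.trans h) ≫ f := by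
  rw [← Category.assoc, structureMap_comp]

/-- Families `F^r ⟶ G^{r - ε}` compatible with the structure morphisms. -/
def ShiftNatural {ε : ℝ} (μ : ∀ r : ℝ, F.obj (op r) ⟶ G.obj (op (r - ε))) : Prop :=
  ∀ {r s : ℝ} (h : s ≤ r),
    structureMap F h ≫ μ s = μ r ≫ structureMap G (sub_le_sub_right h ε)

/-- Two families form an interleaving on one side. -/
def ShiftInverse {ε : ℝ} (μ : ∀ r : ℝ, F.obj (op r) ⟶ G.obj (op (r - ε)))
    (ν : ∀ r : ℝ, G.obj (op r) ⟶ F.obj (op (r - ε))) (hε : 0 ≤ ε) : Prop :=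
  ∀ r : ℝ, μ r ≫ ν (r - ε) = structureMap F (show r - ε - ε ≤ r by linarith)

/-- Working with families instead of transformations to shifted functors avoids comparing iterated
shifts: indices such as `r - (ε + δ)` and `r - ε - δ` are reconciled by structure morphisms. -/
lemma interleaved_iff {ε : ℝ} : Interleaved F G ε ↔
    ∃ (hε : 0 ≤ ε) (μ : ∀ r : ℝ, F.obj (op r) ⟶ G.obj (op (r - ε)))
      (ν : ∀ r : ℝ, G.obj (op r) ⟶ F.obj (op (r - ε))),
      ShiftNatural μ ∧ ShiftNatural ν ∧ ShiftInverse μ ν hε ∧ ShiftInverse ν μ hε := by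
  constructor
  · rintro ⟨hε, μ, ν, h⟩
    exact ⟨hε, fun r => μ.app (op r), fun r => ν.app (op r), fun h => μ.naturality (homOfLE h).op,
      fun h => ν.naturality (homOfLE h).op, fun r => (h r).1, fun r => (h r).2⟩
  · rintro ⟨hε, μ, ν, hμ, hν, h, h'⟩
    exact ⟨hε, ⟨fun r => μ r.unop, fun r s f => hμ (leOfHom f.unop)⟩,
      ⟨fun r => ν r.unop, fun r s f => hν (leOfHom f.unop)⟩, fun r => ⟨h r, h' r⟩⟩

lemma Interleaved.refl (F : ℝᵒᵖ ⥤ C) : Interleaved F F 0 :=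
  -- The index `r - 0` is not literally `r`, so structure morphisms stand in for identities.
  interleaved_iff.2 ⟨le_rfl, fun r => structureMap F (show r - 0 ≤ r by simp),
    fun r => structureMap F (show r - 0 ≤ r by simp), fun _ => by simp, fun _ => by simp,
    fun _ => by simp, fun _ => by simp⟩

lemma Interleaved.symm {ε : ℝ} (h : Interleaved F G ε) : Interleaved G F ε := by
  obtain ⟨hε, μ, ν, h⟩ := h
  exact ⟨hε, ν, μ, fun r => (h r).symm⟩

lemma Interleaved.of_iso {F' G' : ℝᵒᵖ ⥤ C} {ε : ℝ} (e : F ≅ F') (e' : G ≅ G')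
    (h : Interleaved F G ε) : Interleaved F' G' ε := by
  obtain ⟨hε, μ, ν, hμ, hν, h, h'⟩ := interleaved_iff.1 h
  refine interleaved_iff.2 ⟨hε, fun r => e.inv.app (op r) ≫ μ r ≫ e'.hom.app (op (r - ε)),
    fun r => e'.inv.app (op r) ≫ ν r ≫ e.hom.app (op (r - ε)), fun hr => ?_, fun hr => ?_,
    fun r => ?_, fun r => ?_⟩
  · rw [reassoc_of% structureMap_naturality e.inv hr, reassoc_of% hμ hr, structureMap_naturality]
    simp only [Category.assoc]
  · rw [reassoc_of% structureMap_naturality e'.inv hr, reassoc_of% hν hr, structureMap_naturality]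
    simp only [Category.assoc]
  · simp only [Category.assoc, Iso.hom_inv_id_app_assoc]
    rw [reassoc_of% h r, structureMap_naturality, Iso.inv_hom_id_app_assoc]
  · simp only [Category.assoc, Iso.hom_inv_id_app_assoc]
    rw [reassoc_of% h' r, structureMap_naturality, Iso.inv_hom_id_app_assoc]

/-- The composite of families of degrees `ε` and `δ`. -/
def shiftComp {ε δ ρ : ℝ} (h : ε + δ = ρ) (μ : ∀ r : ℝ, F.obj (op r) ⟶ G.obj (op (r - ε)))
    (ν : ∀ r : ℝ, G.obj (op r) ⟶ K.obj (op (r - δ))) (r : ℝ) :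
    F.obj (op r) ⟶ K.obj (op (r - ρ)) :=
  μ r ≫ ν (r - ε) ≫ structureMap K (show r - ρ ≤ r - ε - δ by linarith)

lemma ShiftNatural.comp {ε δ ρ : ℝ} (h : ε + δ = ρ)
    {μ : ∀ r : ℝ, F.obj (op r) ⟶ G.obj (op (r - ε))}
    {ν : ∀ r : ℝ, G.obj (op r) ⟶ K.obj (op (r - δ))} (hμ : ShiftNatural μ) (hν : ShiftNatural ν) :
    ShiftNatural (shiftComp h μ ν) := fun hr => by
  unfold shiftComp
  rw [reassoc_of% hμ hr, reassoc_of% hν (sub_le_sub_right hr ε)]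
  simp

/-- Naturality moves the correcting structure morphism past `ν'`, so that `μ'` meets `ν'` and the
pair collapses to a structure morphism; moving that one past `ν` makes `μ` meet `ν`. The common
total `ρ` lets the two orders of summation share one shift. -/
lemma ShiftInverse.comp {ε δ ρ : ℝ} {hε : 0 ≤ ε} {hδ : 0 ≤ δ} (h : ε + δ = ρ) (h' : δ + ε = ρ)
    (hρ : 0 ≤ ρ)
    {μ : ∀ r : ℝ, F.obj (op r) ⟶ G.obj (op (r - ε))}
    {ν : ∀ r : ℝ, G.obj (op r) ⟶ F.obj (op (r - ε))}
    {μ' : ∀ r : ℝ, G.obj (op r) ⟶ K.obj (op (r - δ))}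
    {ν' : ∀ r : ℝ, K.obj (op r) ⟶ G.obj (op (r - δ))} (hν : ShiftNatural ν)
    (hν' : ShiftNatural ν') (i : ShiftInverse μ ν hε) (i' : ShiftInverse μ' ν' hδ) :
    ShiftInverse (shiftComp h μ μ') (shiftComp h' ν' ν) hρ := fun r => by
  unfold shiftComp
  simp only [Category.assoc]
  rw [reassoc_of% hν' (show r - ρ ≤ r - ε - δ by linarith), reassoc_of% i' (r - ε),
    structureMap_comp_assoc, reassoc_of% hν (show r - ρ - δ ≤ r - ε by linarith),
    reassoc_of% i r]
  simp

lemma Interleaved.trans {ε δ : ℝ} (h : Interleaved F G ε) (h' : Interleaved G K δ) :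
    Interleaved F K (ε + δ) := by
  obtain ⟨hε, μ, ν, hμ, hν, i, j⟩ := interleaved_iff.1 h
  obtain ⟨hδ, μ', ν', hμ', hν', i', j'⟩ := interleaved_iff.1 h'
  exact interleaved_iff.2 ⟨add_nonneg hε hδ, shiftComp rfl μ μ', shiftComp (add_comm δ ε) ν' ν,
    hμ.comp _ hμ', hν'.comp _ hν, i.comp _ _ _ hν hν' i', j'.comp _ _ _ hμ' hμ j⟩

lemma interleavingDist_self (F : ℝᵒᵖ ⥤ C) : interleavingDist F F = 0 :=
  le_antisymm (iInf₂_le_of_le 0 (by simpa using Interleaved.refl F) (by simp)) bot_le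

lemma interleavingDist_comm (F G : ℝᵒᵖ ⥤ C) : interleavingDist F G = interleavingDist G F :=
  le_antisymm (le_iInf₂ fun ε h => iInf₂_le ε h.symm) (le_iInf₂ fun ε h => iInf₂_le ε h.symm)

lemma interleavingDist_triangle (F G K : ℝᵒᵖ ⥤ C) :
    interleavingDist F K ≤ interleavingDist F G + interleavingDist G K := by
  unfold interleavingDist
  -- Addition on `[0, ∞]` commutes with these infima, so it suffices to add one interleaving of each
  -- pair.
  simp only [ENNReal.iInf_add, ENNReal.add_iInf]
  refine le_iInf₂ fun δ h' => le_iInf₂ fun ε h => ?_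
  exact iInf₂_le_of_le (ε + δ) (by simpa using h.trans h') (by simp)

lemma interleavingDist_congr {F' G' : ℝᵒᵖ ⥤ C} (e : F ≅ F') (e' : G ≅ G') :
    interleavingDist F G = interleavingDist F' G' :=
  le_antisymm (le_iInf₂ fun ε h => iInf₂_le ε (h.of_iso e.symm e'.symm))
    (le_iInf₂ fun ε h => iInf₂_le ε (h.of_iso e e'))

end InterleavingDistance

/-! ### Independence of the choice of contractions -/

section ContractionIndependence

open Opposite

variable {k : Type u} [Field k]

/-- The copersistent transfer data of finite filtered data do not depend on the contractions. -/
def transferFunctorIso (c c' : ContractionChoice.{u} k) (X : FData.{u}ᵒᵖ) :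
    (transferFunctor c).obj X ≅ (transferFunctor c').obj X :=
  (HasFinitelyManyChanges k).isoMk <| NatIso.ofComponents
    (fun r =>
      -- The identity of the cochain algebra is a morphism between transfer data with different
      -- contractions, since no compatibility is asked for.
      { hom := 𝟙 ((cochains k).obj (op (X.unop.obj.obj r.unop)))
        inv := 𝟙 ((cochains k).obj (op (X.unop.obj.obj r.unop)))
        hom_inv_id := Category.id_comp (obj := DGAlg k) _
        inv_hom_id := Category.id_comp (obj := DGAlg k) _ })
    fun _ => (Category.comp_id (obj := DGAlg k) _).trans (Category.id_comp (obj := DGAlg k) _).symm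

end ContractionIndependence

end AInf

/-! ### The main theorem -/

theorem mainTheorem2 (k : Type u) [Field k] :
    -- every dg algebra has a contraction
    (∀ A : AInf.DGAlg k, Nonempty (AInf.Contraction A)) ∧
    -- the transferred structures, the extensions of `i` and `p` to `∞`-morphisms, the functor
    ∃ (m : ∀ D : AInf.TransDatum k, AInf.AInfStr D.c.H)
      (iInf : ∀ D : AInf.TransDatum k,
        (⟨D.c.H, m D⟩ : AInf.AInfAlg k) ⟶ (AInf.dgToAInf k).obj D.A)
      (pInf : ∀ D : AInf.TransDatum k,
        (AInf.dgToAInf k).obj D.A ⟶ (⟨D.c.H, m D⟩ : AInf.AInfAlg k))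
      (F : AInf.FTrans k ⥤ (ℝᵒᵖ ⥤ AInf.Ho k)),
      (∀ D : AInf.TransDatum k,
        AInf.IsTransferred D (m D) (iInf D) ∧
        (∀ x, (AInf.AInfHom.toOps (pInf D)).op [x] = D.c.p x) ∧
        AInf.infQuasiIso k (iInf D) ∧ AInf.infQuasiIso k (pInf D) ∧
        (AInf.toHo k).map (iInf D) ≫ (AInf.toHo k).map (pInf D) = 𝟙 _ ∧
        (AInf.toHo k).map (pInf D) ≫ (AInf.toHo k).map (iInf D) = 𝟙 _) ∧
      -- the values of `F` on objects, structure morphisms and morphisms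
      (∃ e : ∀ (X : AInf.FTrans k) (r : ℝᵒᵖ),
          (F.obj X).obj r = (AInf.toHo k).obj ⟨(X.obj.obj r).c.H, m (X.obj.obj r)⟩,
        (∀ (X : AInf.FTrans k) (r s : ℝᵒᵖ) (f : r ⟶ s),
          (F.obj X).map f = eqToHom (e X r) ≫
            (AInf.toHo k).map (iInf (X.obj.obj r) ≫
              (AInf.transForget k ⋙ AInf.dgToAInf k).map (X.obj.map f) ≫
                pInf (X.obj.obj s)) ≫
            eqToHom (e X s).symm) ∧
        (∀ (X Y : AInf.FTrans k) (g : X ⟶ Y) (r : ℝᵒᵖ),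
          (F.map g).app r = eqToHom (e X r) ≫
            (AInf.toHo k).map (iInf (X.obj.obj r) ≫
              (AInf.transForget k ⋙ AInf.dgToAInf k).map (g.hom.app r) ≫
                pInf (Y.obj.obj r)) ≫
            eqToHom (e Y r).symm) ∧
        -- composition with the forgetful functor is persistent cohomology
        ∃ α : F ⋙ (Functor.whiskeringRight ℝᵒᵖ (AInf.Ho k) (AInf.GrVect k)).obj
              (AInf.forgetHo k) ≅ AInf.persistentCohomology k,
          ∀ (X : AInf.FTrans k) (r : ℝᵒᵖ),
            (α.hom.app X).app r = (AInf.forgetHo k).map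
                (eqToHom (e X r) ≫ (AInf.toHo k).map (iInf (X.obj.obj r))) ≫
              eqToHom (congrArg (fun G : AInf.AInfAlg k ⥤ AInf.GrVect k =>
                  G.obj ((AInf.dgToAInf k).obj (X.obj.obj r).A))
                (Localization.Construction.fac (AInf.cohomology k)
                  (AInf.cohomology_inverts k)))) ∧
      -- the interleaving distance on finite filtered data
      (∀ c : AInf.ContractionChoice.{u} k,
        (∀ X, AInf.aInfDist F c X X = 0) ∧
        (∀ X Y, AInf.aInfDist F c X Y = AInf.aInfDist F c Y X) ∧
        (∀ X Y Z, AInf.aInfDist F c X Z ≤ AInf.aInfDist F c X Y + AInf.aInfDist F c Y Z) ∧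
        ∀ (c' : AInf.ContractionChoice.{u} k) (X Y : AInf.FData.{u}),
          AInf.aInfDist F c X Y = AInf.aInfDist F c' X Y) := by
  refine ⟨fun A => A.nonempty_contraction, fun D => D.m, fun D => D.iInf, fun D => D.pInf,
    AInf.transferPersistent k, fun D => ⟨D.isTransferred, D.pInf_single, D.infQuasiIso_iInf,
      D.infQuasiIso_pInf, D.toHo_iInf_pInf, D.toHo_pInf_iInf⟩,
    ⟨fun X r => rfl, fun X r s f => ?_, fun X Y g r => ?_, AInf.persistentIso k, fun X r => ?_⟩,
    fun c => ⟨fun X => AInf.interleavingDist_self _, fun X Y => AInf.interleavingDist_comm _ _,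
      fun X Y Z => AInf.interleavingDist_triangle _ _ _, fun c' X Y =>
      AInf.interleavingDist_congr ((AInf.transferPersistent k).mapIso
        (AInf.transferFunctorIso c c' (Opposite.op X))) ((AInf.transferPersistent k).mapIso
        (AInf.transferFunctorIso c c' (Opposite.op Y)))⟩⟩
  -- The equality of objects was given by `rfl`, so each `eqToHom` is an identity.
  · exact ((Category.id_comp _).trans (Category.comp_id _)).symm
  · exact ((Category.id_comp _).trans (Category.comp_id _)).symm
  · refine (AInf.persistentIso_app X r).trans ?_
    refine congrArg (fun f => (AInf.forgetHo k).map f ≫ _) ?_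
    exact (Category.id_comp _).symm
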